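/- **Permutations.** Write a permutation $w\in\mathfrak S_n$ in one-line notation $w(1)\cdots w(n)$, multiply permutations as maps, and let $\ell(w)$ be the least number of adjacent transpositions with product $w$. For $p\in\mathfrak S_k$, an occurrence of $p$ in $w$ is a subsequence $w(j_1)\cdots w(j_k)$, $j_1<\dots<j_k$, in the same relative order as $p(1)\cdots p(k)$. The pair $(p,w)$ is *value-stable* if $w=w'v$ with $w',v\in\mathfrak S_n$, $\ell(w)=\ell(w')+\ell(v)$, and $p$ has an occurrence in consecutive positions of $w'$. A set of values $\{i_1,\dots,i_k\}$ forms a *value-stable occurrence of $p$ in $w$* if it is the set of values of such an occurrence in consecutive positions of such a $w'$, and these values also form an occurrence of $p$ in $w$. **Elnitsky polygons.** Fix vectors $d_1,\dots,d_n\in\mathbb R^2$ that point strictly downwards and whose directions turn strictly counterclockwise (for instance, of equal length). For a point $a$ and a word $u_1\cdots u_k$ of distinct labels in $\{1,\dots,n\}$, the Elnitsky polygon with top $a$ and this word is the closed region between its right border, the path from $a$ with successive edges $d_{u_1},\dots,d_{u_k}$, and its left border, the path from $a$ whose edges are the same vectors in increasing order of label; the two borders may touch, so (parts of) the polygon may degenerate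 to segments. Its edges are labeled by $\{u_1,\dots,u_k\}$. It is an $X(p)$-polygon if $u_1\cdots u_k$ is in the same relative order as $p(1)\cdots p(k)$. Elnitsky's polygon $X(w)$ is the one with top $0$ and word $w(1)\cdots w(n)$. A rhombus is an $X(21)$-polygon. **Paw tilings.** A *paw tiling* of $X(w)$ is a finite set of such Elnitsky polygons (*paws*) contained in $X(w)$ that, together with the border of $X(w)$, cover $X(w)$, such that no paw meets the interior of another paw, and such that the tiling is edge-to-edge (no vertex of a paw or of $X(w)$ lies in the relative interior of an edge of a paw or of $X(w)$). A paw $P$ in a paw tiling of $X(w)$ is *isolated* if, in every paw tiling of $X(w)$ that contains $P$ and whose other paws are all rhombi, no rhombus other than $P$ shares two edges with the right border of $P$. **Statement.** Let $w\in\mathfrak S_n$, $p\in\mathfrak S_k$ and $I=\{i_1,\dots,i_k\}\subseteq\{1,\dots,n\}$. There is a paw tiling of $X(w)$ that contains an isolated $X(p)$-paw with edges labeled by $I$ if and only if $(p,w)$ is value-stable and the values $i_1,\dots,i_k$ form a value-stable occurrence of $p$ in $w$. -/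

import Mathlib

/-! ### Permutations, length, patterns -/

/-- `s` is one of the adjacent transpositions `σ_i = (i, i+1)`. -/
def IsAdjacentTransposition {n : ℕ} (s : Equiv.Perm (Fin n)) : Prop :=
  ∃ i j : Fin n, (j : ℕ) = (i : ℕ) + 1 ∧ s = Equiv.swap i j

/-- The length `ℓ(w)`: the least number of adjacent transpositions whose product is `w`. -/
noncomputable def permLength {n : ℕ} (w : Equiv.Perm (Fin n)) : ℕ :=
  sInf {m : ℕ | ∃ s : List (Equiv.Perm (Fin n)),
    (∀ t ∈ s, IsAdjacentTransposition t) ∧ s.length = m ∧ s.prod = w}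

/-- `w(ι 0) ⋯ w(ι (k-1))` is an occurrence of the pattern `p` in `w`; the positions are
increasing because `ι` is an order embedding. -/
def IsOccurrenceAt {n k : ℕ} (p : Equiv.Perm (Fin k)) (w : Equiv.Perm (Fin n))
    (ι : Fin k ↪o Fin n) : Prop :=
  ∀ a b : Fin k, p a < p b ↔ w (ι a) < w (ι b)

/-- The set of values `{w(ι 0), …, w(ι (k-1))}`. -/
def valuesAt {n k : ℕ} (w : Equiv.Perm (Fin n)) (ι : Fin k ↪o Fin n) : Finset (Fin n) :=
  Finset.univ.image fun a => w (ι a)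

/-- The positions `ι 0 < ⋯ < ι (k-1)` are consecutive. -/
def ConsecutivePositions {n k : ℕ} (ι : Fin k ↪o Fin n) : Prop :=
  ∃ x : ℕ, ∀ a : Fin k, (ι a : ℕ) = x + (a : ℕ)

/-- `w = w' v` with `ℓ(w) = ℓ(w') + ℓ(v)`. -/
def IsReducedProduct {n : ℕ} (w w' v : Equiv.Perm (Fin n)) : Prop :=
  w = w' * v ∧ permLength w = permLength w' + permLength v

/-- `(p, w)` is a value-stable pair. -/
def ValueStable {n k : ℕ} (p : Equiv.Perm (Fin k)) (w : Equiv.Perm (Fin n)) : Prop :=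
  ∃ w' v : Equiv.Perm (Fin n), IsReducedProduct w w' v ∧
    ∃ ι : Fin k ↪o Fin n, IsOccurrenceAt p w' ι ∧ ConsecutivePositions ι

/-- `I` is the set of values of an occurrence of `p` in `w`. -/
def IsOccurrence {n k : ℕ} (p : Equiv.Perm (Fin k)) (w : Equiv.Perm (Fin n))
    (I : Finset (Fin n)) : Prop :=
  ∃ ι : Fin k ↪o Fin n, IsOccurrenceAt p w ι ∧ valuesAt w ι = I

/-- The values `I` form a value-stable occurrence of `p` in `w`: they form an occurrence of `p`
in `w`, and they are the values of a consecutively positioned `p`-pattern in some `w'` that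
witnesses that `(p, w)` is value-stable. -/
def IsValueStableOccurrence {n k : ℕ} (p : Equiv.Perm (Fin k)) (w : Equiv.Perm (Fin n))
    (I : Finset (Fin n)) : Prop :=
  IsOccurrence p w I ∧
    ∃ w' v : Equiv.Perm (Fin n), IsReducedProduct w w' v ∧
      ∃ ι : Fin k ↪o Fin n, IsOccurrenceAt p w' ι ∧ ConsecutivePositions ι ∧ valuesAt w' ι = I

/-! ### Elnitsky polygons in the plane -/

/-- `d i` is the edge vector of the sides labelled `i`. All of them point downwards, and the
directions turn strictly counterclockwise: the path with successive edges `d 0, d 1, …` is a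
convex left border running from the highest to the lowest vertex, and sides are parallel if and
only if they have the same label. Equal lengths are allowed but not required. -/
def IsEdgeSystem {n : ℕ} (d : Fin n → ℝ × ℝ) : Prop :=
  (∀ i, (d i).2 < 0) ∧ ∀ i j, i < j → 0 < (d i).1 * (d j).2 - (d j).1 * (d i).2

/-- An Elnitsky polygon with side labels in `Fin n`, given by its highest vertex and the labels
of its right border, read from top to bottom. Its left border carries the same labels in
increasing order. -/
@[ext]
structure ElnitskyPolygon (n : ℕ) where
  top : ℝ × ℝ
  word : List (Fin n)
  nodup : word.Nodup

/-- The edges (upper endpoint and label) of the path that starts at a point and whose successive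
edges carry the given labels. -/
def pathEdges {n : ℕ} (d : Fin n → ℝ × ℝ) : ℝ × ℝ → List (Fin n) → List ((ℝ × ℝ) × Fin n)
  | _, [] => []
  | a, i :: L => (a, i) :: pathEdges d (a + d i) L

/-- The vertices of that path. -/
def pathVertices {n : ℕ} (d : Fin n → ℝ × ℝ) : ℝ × ℝ → List (Fin n) → List (ℝ × ℝ)
  | a, [] => [a]
  | a, i :: L => a :: pathVertices d (a + d i) L

/-- The points of that path. -/
def pathPoints {n : ℕ} (d : Fin n → ℝ × ℝ) : ℝ × ℝ → List (Fin n) → Set (ℝ × ℝ)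
  | a, [] => {a}
  | a, i :: L => segment ℝ a (a + d i) ∪ pathPoints d (a + d i) L

namespace ElnitskyPolygon

variable {n : ℕ}

/-- The set of labels of the sides. -/
def labels (P : ElnitskyPolygon n) : Finset (Fin n) := P.word.toFinset

/-- The labels of the left border from top to bottom. -/
def leftWord (P : ElnitskyPolygon n) : List (Fin n) := P.labels.sort (· ≤ ·)

def rightEdges (d : Fin n → ℝ × ℝ) (P : ElnitskyPolygon n) : List ((ℝ × ℝ) × Fin n) :=
  pathEdges d P.top P.word

def leftEdges (d : Fin n → ℝ × ℝ) (P : ElnitskyPolygon n) : List ((ℝ × ℝ) × Fin n) :=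
  pathEdges d P.top P.leftWord

def edges (d : Fin n → ℝ × ℝ) (P : ElnitskyPolygon n) : List ((ℝ × ℝ) × Fin n) :=
  P.leftEdges d ++ P.rightEdges d

def vertices (d : Fin n → ℝ × ℝ) (P : ElnitskyPolygon n) : List (ℝ × ℝ) :=
  pathVertices d P.top P.leftWord ++ pathVertices d P.top P.word

def leftBorder (d : Fin n → ℝ × ℝ) (P : ElnitskyPolygon n) : Set (ℝ × ℝ) :=
  pathPoints d P.top P.leftWord

def rightBorder (d : Fin n → ℝ × ℝ) (P : ElnitskyPolygon n) : Set (ℝ × ℝ) :=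
  pathPoints d P.top P.word

/-- The closed region between the left and the right border. (The borders may touch.) -/
def region (d : Fin n → ℝ × ℝ) (P : ElnitskyPolygon n) : Set (ℝ × ℝ) :=
  {q | ∃ x₁ x₂ : ℝ, x₁ ≤ q.1 ∧ q.1 ≤ x₂ ∧
    (x₁, q.2) ∈ P.leftBorder d ∧ (x₂, q.2) ∈ P.rightBorder d}

/-- `P` is an `X(p)`-polygon: the string of labels of its right border is isomorphic to the
one-line notation of `p`. -/
def HasShape {k : ℕ} (P : ElnitskyPolygon n) (p : Equiv.Perm (Fin k)) : Prop :=
  ∃ h : P.word.length = k, ∀ a b : Fin k,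
    p a < p b ↔ P.word.get (a.cast h.symm) < P.word.get (b.cast h.symm)

/-- A rhombus is an `X(21)`-polygon. -/
def IsRhombus (P : ElnitskyPolygon n) : Prop :=
  P.HasShape (Equiv.swap (0 : Fin 2) 1)

end ElnitskyPolygon

/-- Elnitsky's polygon `X(w)`, with its highest vertex at the origin. -/
def elnitskyX {n : ℕ} (w : Equiv.Perm (Fin n)) : ElnitskyPolygon n where
  top := 0
  word := List.ofFn w
  nodup := List.nodup_ofFn.mpr w.injective

/-! ### Paw tilings -/

/-- `T` is a paw tiling of `X(w)`. Parts of `X(w)` or of a paw may degenerate to line segments: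
the former need not be covered by paws, and the latter must stay out of the interiors of the
other paws. The tiling is edge-to-edge. -/
structure IsPawTiling {n : ℕ} (d : Fin n → ℝ × ℝ) (w : Equiv.Perm (Fin n))
    (T : Set (ElnitskyPolygon n)) : Prop where
  finite : T.Finite
  subset : ∀ P ∈ T, P.region d ⊆ (elnitskyX w).region d
  cover : (elnitskyX w).region d ⊆
    ((elnitskyX w).leftBorder d ∪ (elnitskyX w).rightBorder d) ∪ ⋃ P ∈ T, P.region d
  nonoverlapping : ∀ P ∈ T, ∀ Q ∈ T, P ≠ Q → Disjoint (P.region d) (interior (Q.region d))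
  edge_to_edge : ∀ P ∈ insert (elnitskyX w) T, ∀ Q ∈ insert (elnitskyX w) T,
    ∀ x ∈ P.vertices d, ∀ e ∈ Q.edges d, x ∉ openSegment ℝ e.1 (e.1 + d e.2)

/-- The paw tilings of `X(w)` that contain the paw `P` and tile the rest of `X(w)` by rhombi. -/
def rhombicCompletions {n : ℕ} (d : Fin n → ℝ × ℝ) (w : Equiv.Perm (Fin n))
    (P : ElnitskyPolygon n) : Set (Set (ElnitskyPolygon n)) :=
  {T | IsPawTiling d w T ∧ P ∈ T ∧ ∀ Q ∈ T, Q ≠ P → Q.IsRhombus}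

/-- Two different edges of `Q` are edges of the right border of `P`. -/
def SharesTwoRightEdges {n : ℕ} (d : Fin n → ℝ × ℝ) (Q P : ElnitskyPolygon n) : Prop :=
  ∃ e₁ ∈ Q.edges d, ∃ e₂ ∈ Q.edges d, e₁ ≠ e₂ ∧ e₁ ∈ P.rightEdges d ∧ e₂ ∈ P.rightEdges d

/-- The paw `P` of the paw tiling `T` of `X(w)` is isolated in `T`. -/
def IsIsolatedPaw {n : ℕ} (d : Fin n → ℝ × ℝ) (w : Equiv.Perm (Fin n))
    (T : Set (ElnitskyPolygon n)) (P : ElnitskyPolygon n) : Prop :=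
  IsPawTiling d w T ∧ P ∈ T ∧
    ∀ S ∈ rhombicCompletions d w P, ∀ Q ∈ S, Q ≠ P → Q.IsRhombus → ¬ SharesTwoRightEdges d Q P

/-! All edge vectors point downwards, so the path of a word is the graph of a function of the
height. At a given depth its abscissa is the sum, over all labels, of the slope of the label times
the height of that label already traversed (`profile_eq_sum`). Slopes increase with the label. If
every inversion of `L` is an inversion of `L'`, then passing from `L` to `L'` moves traversed height
from smaller to larger labels. So the path of `L'` lies weakly to the right, and where the two
touch, every label has been traversed equally far (`WeakLE.profile_le_and`). Comparable words
therefore have paths that do not cross and meet edge-to-edge, even where regions degenerate.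

From words to tilings: start with the increasing word and repeatedly replace a sorted block by
another arrangement of it, staying below `w` in the weak order. The polygons swept out form a paw
tiling (`Sweep.isPawTiling`). By exchanging ascents, comparable words are always joined by a sweep
with rhombi (`WeakLE.exists_sweep`).

From tilings to words: any path from top to bottom along edges of a tiling is the path of a
permutation below `w` (`IsPawTiling.weakLE_of_path`). To see this, subdivide all paws into rhombi.
Between two different paths, some rhombus has its whole left border on the left path
(`Filling.exists_flip`); pushing the path across it adds one inversion, and induction on the number
of rhombi reaches the right path. Every vertex of a tiling has an edge leading up unless it is the
top, and one leading down unless it is at the bottom height. So the right border of a paw extends to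
such a path and is a block of consecutive entries of some `w'` below `w`
(`IsPawTiling.exists_word_through`). Since being below in the weak order is the same as being the
left factor of a reduced product (`exists_isReducedProduct_iff_weakLE`), paws correspond to patterns
in consecutive positions of such a `w'`.

Isolation is the condition that the labels of the right border appear in `w` in the same order. If
neighbours `a`, `b` on the border are reversed in `w`, one can sweep up to the paw and then flip
exactly these two edges, so the paw is not isolated (`IsIsolatedPaw.pairwise_sublist`). Conversely,
suppose a rhombus shares two right edges with the paw. If they are its left edges, it forces its
labels to be inverted in `w`, against the order on the border; if they are its right edges, it
overlaps the paw (`not_sharesTwoRightEdges`). -/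

/-! ### Paths as graphs over the height -/

section Profile

variable {n : ℕ} (d : Fin n → ℝ × ℝ)

/-- The vertical extent of an edge with label `i`. -/
def edgeHeight (i : Fin n) : ℝ := -(d i).2

/-- The horizontal displacement of an edge with label `i` per unit of depth. -/
noncomputable def edgeSlope (i : Fin n) : ℝ := (d i).1 / edgeHeight d i

/-- The sum of the edge vectors of a word. -/
def wordSum (L : List (Fin n)) : ℝ × ℝ := (L.map d).sum

/-- The vertical extent of the path of a word. -/
def wordHeight (L : List (Fin n)) : ℝ := (L.map (edgeHeight d)).sum

/-- The horizontal displacement of the path of a word at depth `t` below its top. -/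
noncomputable def profile : List (Fin n) → ℝ → ℝ
  | [], _ => 0
  -- The clamp extends the function to all depths: it is constant above the top and below the
  -- bottom, so no height hypotheses are needed to compare paths.
  | i :: L, t => edgeSlope d i * max 0 (min t (edgeHeight d i)) + profile L (t - edgeHeight d i)

/-- The vertical extent of the part of the edge labelled `l` that the path of a word has
traversed at depth `t` below its top. -/
noncomputable def usedHeight : List (Fin n) → ℝ → Fin n → ℝ
  | [], _, _ => 0
  | i :: L, t, l =>
    (if l = i then max 0 (min t (edgeHeight d i)) else 0) + usedHeight L (t - edgeHeight d i) l

/-- The abscissa at height `y` of the path of the word `L` with top `a`. -/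
noncomputable def pathX (a : ℝ × ℝ) (L : List (Fin n)) (y : ℝ) : ℝ :=
  a.1 + profile d L (a.2 - y)

variable {d}

theorem IsEdgeSystem.edgeHeight_pos (hd : IsEdgeSystem d) (i : Fin n) : 0 < edgeHeight d i := by
  have := hd.1 i
  unfold edgeHeight; linarith

theorem IsEdgeSystem.edgeSlope_mul (hd : IsEdgeSystem d) (i : Fin n) :
    edgeSlope d i * edgeHeight d i = (d i).1 := by
  have := hd.edgeHeight_pos i
  unfold edgeSlope; field_simp

theorem IsEdgeSystem.edgeSlope_lt (hd : IsEdgeSystem d) {i j : Fin n} (h : i < j) :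
    edgeSlope d i < edgeSlope d j := by
  have hi := hd.edgeHeight_pos i
  have hj := hd.edgeHeight_pos j
  have := hd.2 i j h
  unfold edgeSlope
  rw [div_lt_div_iff₀ hi hj]
  unfold edgeHeight at *
  nlinarith

theorem IsEdgeSystem.edgeSlope_injective (hd : IsEdgeSystem d) :
    Function.Injective (edgeSlope d) := by
  intro i j h
  rcases lt_trichotomy i j with h1 | h1 | h1
  · exact absurd h (hd.edgeSlope_lt h1).ne
  · exact h1
  · exact absurd h (hd.edgeSlope_lt h1).ne'

@[simp] theorem wordSum_nil : wordSum d [] = 0 := rfl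

@[simp] theorem wordSum_cons (i : Fin n) (L : List (Fin n)) :
    wordSum d (i :: L) = d i + wordSum d L := by simp [wordSum]

@[simp] theorem wordSum_append (L M : List (Fin n)) :
    wordSum d (L ++ M) = wordSum d L + wordSum d M := by simp [wordSum]

@[simp] theorem wordHeight_nil : wordHeight d [] = 0 := rfl

@[simp] theorem wordHeight_cons (i : Fin n) (L : List (Fin n)) :
    wordHeight d (i :: L) = edgeHeight d i + wordHeight d L := by simp [wordHeight]

@[simp] theorem wordHeight_append (L M : List (Fin n)) :
    wordHeight d (L ++ M) = wordHeight d L + wordHeight d M := by simp [wordHeight]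

theorem wordSum_snd (L : List (Fin n)) : (wordSum d L).2 = -wordHeight d L := by
  induction L with
  | nil => simp
  | cons i L ih => simp [ih, edgeHeight]; ring

theorem IsEdgeSystem.wordHeight_nonneg (hd : IsEdgeSystem d) (L : List (Fin n)) :
    0 ≤ wordHeight d L := by
  induction L with
  | nil => simp
  | cons i L ih => simp only [wordHeight_cons]; linarith [hd.edgeHeight_pos i]

theorem IsEdgeSystem.wordHeight_eq_zero (hd : IsEdgeSystem d) {L : List (Fin n)}
    (h : wordHeight d L = 0) : L = [] := by
  cases L with
  | nil => rfl
  | cons i L =>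
    simp only [wordHeight_cons] at h
    linarith [hd.edgeHeight_pos i, hd.wordHeight_nonneg L]

theorem wordHeight_perm {L M : List (Fin n)} (h : L.Perm M) : wordHeight d L = wordHeight d M :=
  (h.map _).sum_eq

theorem profile_of_nonpos (hd : IsEdgeSystem d) (L : List (Fin n)) {t : ℝ} (ht : t ≤ 0) :
    profile d L t = 0 := by
  induction L generalizing t with
  | nil => rfl
  | cons i L ih =>
    have := hd.edgeHeight_pos i
    simp only [profile]
    rw [ih (by linarith), min_eq_left (by linarith), max_eq_left ht]; simp

theorem usedHeight_of_nonpos (hd : IsEdgeSystem d) (L : List (Fin n)) {t : ℝ} (ht : t ≤ 0)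
    (l : Fin n) : usedHeight d L t l = 0 := by
  induction L generalizing t with
  | nil => rfl
  | cons i L ih =>
    have := hd.edgeHeight_pos i
    simp only [usedHeight]
    rw [ih (by linarith), min_eq_left (by linarith), max_eq_left ht]; simp

theorem profile_append (L M : List (Fin n)) (t : ℝ) :
    profile d (L ++ M) t = profile d L t + profile d M (t - wordHeight d L) := by
  induction L generalizing t with
  | nil => simp [profile]
  | cons i L ih =>
    simp only [List.cons_append, profile, ih, wordHeight_cons]
    rw [sub_sub]; ring

theorem usedHeight_append (L M : List (Fin n)) (t : ℝ) (l : Fin n) :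
    usedHeight d (L ++ M) t l = usedHeight d L t l + usedHeight d M (t - wordHeight d L) l := by
  induction L generalizing t with
  | nil => simp [usedHeight]
  | cons i L ih =>
    simp only [List.cons_append, usedHeight, ih, wordHeight_cons]
    rw [sub_sub]; ring

theorem profile_of_wordHeight_le (hd : IsEdgeSystem d) (L : List (Fin n)) {t : ℝ}
    (ht : wordHeight d L ≤ t) : profile d L t = (wordSum d L).1 := by
  induction L generalizing t with
  | nil => rfl
  | cons i L ih =>
    have := hd.edgeHeight_pos i
    have := hd.wordHeight_nonneg L
    simp only [wordHeight_cons] at ht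
    simp only [profile]
    rw [ih (by linarith), min_eq_right (by linarith), max_eq_right (by linarith),
      hd.edgeSlope_mul]
    simp

theorem usedHeight_of_wordHeight_le (hd : IsEdgeSystem d) {L : List (Fin n)} (hL : L.Nodup)
    {t : ℝ} (ht : wordHeight d L ≤ t) (l : Fin n) :
    usedHeight d L t l = if l ∈ L then edgeHeight d l else 0 := by
  induction L generalizing t with
  | nil => simp [usedHeight]
  | cons i L ih =>
    have := hd.edgeHeight_pos i
    have := hd.wordHeight_nonneg L
    simp only [wordHeight_cons] at ht
    rw [List.nodup_cons] at hL
    simp only [usedHeight]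
    rw [ih hL.2 (by linarith), min_eq_right (by linarith), max_eq_right (by linarith)]
    by_cases h : l = i
    · subst h; simp [hL.1]
    · simp [h]

theorem usedHeight_of_notMem {L : List (Fin n)} {l : Fin n} (h : l ∉ L) (t : ℝ) :
    usedHeight d L t l = 0 := by
  induction L generalizing t with
  | nil => rfl
  | cons i L ih =>
    simp only [List.mem_cons, not_or] at h
    simp [usedHeight, h.1, ih h.2]

theorem usedHeight_nonneg (L : List (Fin n)) (t : ℝ) (l : Fin n) : 0 ≤ usedHeight d L t l := by
  induction L generalizing t with
  | nil => exact le_rfl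
  | cons i L ih =>
    simp only [usedHeight]
    have := ih (t - edgeHeight d i)
    split_ifs
    · have := le_max_left 0 (min t (edgeHeight d i)); linarith
    · linarith

theorem usedHeight_le (hd : IsEdgeSystem d) {L : List (Fin n)} (hL : L.Nodup) (t : ℝ)
    (l : Fin n) : usedHeight d L t l ≤ edgeHeight d l := by
  induction L generalizing t with
  | nil => exact (hd.edgeHeight_pos l).le
  | cons i L ih =>
    rw [List.nodup_cons] at hL
    simp only [usedHeight]
    by_cases h : l = i
    · subst h
      rw [usedHeight_of_notMem hL.1]
      simp [(hd.edgeHeight_pos l).le]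
    · simpa [h] using ih hL.2 _

/-- A fixed linear functional turns the traversed heights into the abscissa, which reduces the
comparison of paths to that of traversed heights. -/
theorem profile_eq_sum (L : List (Fin n)) (t : ℝ) :
    profile d L t = ∑ l, edgeSlope d l * usedHeight d L t l := by
  induction L generalizing t with
  | nil => simp [profile, usedHeight]
  | cons i L ih =>
    simp only [profile, usedHeight, mul_add, Finset.sum_add_distrib, ih]
    simp

/-- The total depends on the word only through its height, so it agrees for two arrangements of the
same letters. -/
theorem sum_usedHeight (hd : IsEdgeSystem d) (L : List (Fin n)) (t : ℝ) :
    ∑ l, usedHeight d L t l = max 0 (min t (wordHeight d L)) := by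
  induction L generalizing t with
  | nil => simp [usedHeight]
  | cons i L ih =>
    have := hd.edgeHeight_pos i
    have := hd.wordHeight_nonneg L
    simp only [usedHeight, Finset.sum_add_distrib, ih, wordHeight_cons]
    simp only [Finset.sum_ite_eq', Finset.mem_univ, if_true]
    simp only [max_def, min_def]
    split_ifs <;> linarith

theorem continuous_profile (L : List (Fin n)) : Continuous (profile d L) := by
  induction L with
  | nil => exact continuous_const
  | cons i L ih =>
    simp only [profile]
    fun_prop

theorem continuous_pathX (a : ℝ × ℝ) (L : List (Fin n)) : Continuous (pathX d a L) := by
  have := continuous_profile (d := d) L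
  unfold pathX
  fun_prop

/-- A label that comes before a label that has been reached is used up. -/
theorem usedHeight_of_pair_sublist (hd : IsEdgeSystem d) {L : List (Fin n)} (hL : L.Nodup)
    {a b : Fin n} (hab : [a, b].Sublist L) {t : ℝ} (hb : 0 < usedHeight d L t b) :
    usedHeight d L t a = edgeHeight d a := by
  induction L generalizing t with
  | nil => simp at hab
  | cons i L ih =>
    rw [List.nodup_cons] at hL
    by_cases h : a = i
    · subst h
      have hbL : b ∈ L := by
        rcases List.sublist_cons_iff.1 hab with h | ⟨r, hr, h⟩
        · exact absurd (h.subset (by simp)) hL.1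
        · simp only [List.cons.injEq, true_and] at hr
          subst hr
          exact h.subset (by simp)
      have hne : b ≠ a := fun h => hL.1 (h ▸ hbL)
      simp only [usedHeight, hne, if_false, zero_add] at hb
      have ht : 0 < t - edgeHeight d a := by
        by_contra hcon
        rw [usedHeight_of_nonpos hd _ (not_lt.1 hcon)] at hb
        exact lt_irrefl _ hb
      simp only [usedHeight, if_true]
      rw [usedHeight_of_notMem hL.1, min_eq_right (by linarith),
        max_eq_right (hd.edgeHeight_pos a).le, add_zero]
    · have hsub : [a, b].Sublist L := by
        rcases List.sublist_cons_iff.1 hab with h' | ⟨r, hr, h'⟩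
        · exact h'
        · simp only [List.cons.injEq] at hr
          exact absurd hr.1 h
      have hne : b ≠ i := fun h' => hL.1 (h' ▸ hsub.subset (by simp))
      simp only [usedHeight, hne, if_false, zero_add, h] at hb ⊢
      exact ih hL.2 hsub hb

/-- Every depth is that of a vertex or of an interior point of an edge. -/
theorem exists_split_of_depth (L : List (Fin n)) {t : ℝ} (h0 : 0 ≤ t)
    (h1 : t ≤ wordHeight d L) :
    (∃ α β, L = α ++ β ∧ t = wordHeight d α) ∨
    ∃ α i β r, L = α ++ i :: β ∧ t = wordHeight d α + r ∧ 0 < r ∧ r < edgeHeight d i := by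
  induction L generalizing t with
  | nil =>
    left
    exact ⟨[], [], rfl, le_antisymm h1 h0⟩
  | cons i L ih =>
    rcases h0.eq_or_lt with h0 | h0
    · exact Or.inl ⟨[], i :: L, rfl, by simp [← h0]⟩
    rcases lt_or_ge t (edgeHeight d i) with h | h
    · exact Or.inr ⟨[], i, L, t, rfl, by simp, h0, h⟩
    rcases ih (t := t - edgeHeight d i) (by linarith)
      (by rw [wordHeight_cons] at h1; linarith) with ⟨α, β, rfl, h2⟩ | ⟨α, j, β, r, rfl, h2, h3⟩
    · exact Or.inl ⟨i :: α, β, rfl, by rw [wordHeight_cons]; linarith⟩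
    · exact Or.inr ⟨i :: α, j, β, r, rfl, by rw [wordHeight_cons]; linarith, h3⟩

theorem pathX_split (hd : IsEdgeSystem d) (a : ℝ × ℝ) (α : List (Fin n)) (i : Fin n)
    (β : List (Fin n)) {r : ℝ} (h0 : 0 ≤ r) (h1 : r ≤ edgeHeight d i) :
    pathX d a (α ++ i :: β) ((a + wordSum d α).2 - r) =
      (a + wordSum d α).1 + edgeSlope d i * r := by
  have e : a.2 - ((a + wordSum d α).2 - r) = wordHeight d α + r := by
    rw [Prod.snd_add, wordSum_snd]; ring
  unfold pathX
  rw [e, profile_append, profile_of_wordHeight_le hd α (by linarith), profile,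
    profile_of_nonpos hd β (by linarith), min_eq_left (by linarith),
    max_eq_right (by linarith), Prod.fst_add]
  ring

theorem pathX_vertex (hd : IsEdgeSystem d) (a : ℝ × ℝ) (α β : List (Fin n)) :
    pathX d a (α ++ β) (a + wordSum d α).2 = (a + wordSum d α).1 := by
  have e : a.2 - (a + wordSum d α).2 = wordHeight d α := by
    rw [Prod.snd_add, wordSum_snd]; ring
  unfold pathX
  rw [e, profile_append, profile_of_wordHeight_le hd α le_rfl,
    profile_of_nonpos hd β (by linarith), Prod.fst_add]
  ring

/-- All or nothing at a vertex, as opposed to a partial amount inside an edge (`usedHeight_edge`):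
this is how vertices are told apart from interior points of edges. -/
theorem usedHeight_vertex (hd : IsEdgeSystem d) {α β : List (Fin n)} (h : (α ++ β).Nodup)
    (l : Fin n) : usedHeight d (α ++ β) (wordHeight d α) l = 0 ∨
      usedHeight d (α ++ β) (wordHeight d α) l = edgeHeight d l := by
  rw [usedHeight_append, usedHeight_of_wordHeight_le hd (List.nodup_append.1 h).1 le_rfl,
    usedHeight_of_nonpos hd β (by linarith)]
  split_ifs <;> simp

theorem usedHeight_edge (hd : IsEdgeSystem d) {α β : List (Fin n)} {i : Fin n}
    (h : (α ++ i :: β).Nodup) {r : ℝ} (h0 : 0 ≤ r) (h1 : r ≤ edgeHeight d i) :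
    usedHeight d (α ++ i :: β) (wordHeight d α + r) i = r := by
  rw [List.nodup_append] at h
  have hi : i ∉ α := fun hi => h.2.2 i hi i (by simp) rfl
  rw [usedHeight_append, usedHeight_of_notMem hi, usedHeight,
    usedHeight_of_nonpos hd β (by linarith), min_eq_left (by linarith), if_pos rfl,
    max_eq_right (by linarith)]
  ring

theorem mem_pathVertices {a : ℝ × ℝ} {L : List (Fin n)} {q : ℝ × ℝ} :
    q ∈ pathVertices d a L ↔ ∃ α β, L = α ++ β ∧ q = a + wordSum d α := by
  induction L generalizing a with
  | nil =>
    simp only [pathVertices, List.mem_singleton]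
    constructor
    · rintro rfl; exact ⟨[], [], rfl, by simp⟩
    · rintro ⟨α, β, h, rfl⟩
      obtain ⟨rfl, rfl⟩ := List.append_eq_nil_iff.1 h.symm
      simp
  | cons i L ih =>
    simp only [pathVertices, List.mem_cons, ih]
    constructor
    · rintro (rfl | ⟨α, β, rfl, rfl⟩)
      · exact ⟨[], i :: L, rfl, by simp⟩
      · exact ⟨i :: α, β, rfl, by simp [add_assoc]⟩
    · rintro ⟨α, β, h, rfl⟩
      cases α with
      | nil => simp
      | cons j α =>
        simp only [List.cons_append, List.cons.injEq] at h
        obtain ⟨rfl, rfl⟩ := h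
        exact Or.inr ⟨α, β, rfl, by simp [add_assoc]⟩

theorem mem_pathEdges {a : ℝ × ℝ} {L : List (Fin n)} {e : (ℝ × ℝ) × Fin n} :
    e ∈ pathEdges d a L ↔ ∃ α β, L = α ++ e.2 :: β ∧ e.1 = a + wordSum d α := by
  induction L generalizing a with
  | nil => simp [pathEdges]
  | cons i L ih =>
    simp only [pathEdges, List.mem_cons, ih]
    constructor
    · rintro (rfl | ⟨α, β, rfl, h⟩)
      · exact ⟨[], L, rfl, by simp⟩
      · exact ⟨i :: α, β, rfl, by simp [h, add_assoc]⟩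
    · rintro ⟨α, β, h, h2⟩
      cases α with
      | nil =>
        simp only [List.nil_append, List.cons.injEq] at h
        left; ext1
        · simpa using h2
        · exact h.1.symm
      | cons j α =>
        simp only [List.cons_append, List.cons.injEq] at h
        obtain ⟨rfl, rfl⟩ := h
        exact Or.inr ⟨α, β, rfl, by simp [h2, add_assoc]⟩

theorem mem_openSegment_edge (hd : IsEdgeSystem d) {v q : ℝ × ℝ} {i : Fin n} :
    q ∈ openSegment ℝ v (v + d i) ↔
      ∃ r, 0 < r ∧ r < edgeHeight d i ∧ q = (v.1 + edgeSlope d i * r, v.2 - r) := by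
  have hp := hd.edgeHeight_pos i
  have hs := hd.edgeSlope_mul i
  rw [openSegment_eq_image']
  constructor
  · rintro ⟨θ, ⟨h0, h1⟩, rfl⟩
    refine ⟨θ * edgeHeight d i, by positivity, by nlinarith, ?_⟩
    ext
    · simp [← hs]; ring
    · simp [edgeHeight]
  · rintro ⟨r, h0, h1, rfl⟩
    refine ⟨r / edgeHeight d i, ⟨by positivity, by rwa [div_lt_one hp]⟩, ?_⟩
    ext
    · simp [← hs]; field_simp
    · have : (d i).2 = -edgeHeight d i := by simp [edgeHeight]
      simp [this]; field_simp; ring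

theorem mem_segment_edge (hd : IsEdgeSystem d) {v q : ℝ × ℝ} {i : Fin n} :
    q ∈ segment ℝ v (v + d i) ↔
      ∃ r, 0 ≤ r ∧ r ≤ edgeHeight d i ∧ q = (v.1 + edgeSlope d i * r, v.2 - r) := by
  have hp := hd.edgeHeight_pos i
  have hs := hd.edgeSlope_mul i
  rw [segment_eq_image']
  constructor
  · rintro ⟨θ, ⟨h0, h1⟩, rfl⟩
    refine ⟨θ * edgeHeight d i, by positivity, by nlinarith, ?_⟩
    ext
    · simp [← hs]; ring
    · simp [edgeHeight]
  · rintro ⟨r, h0, h1, rfl⟩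
    refine ⟨r / edgeHeight d i, ⟨by positivity, by rwa [div_le_one hp]⟩, ?_⟩
    ext
    · simp [← hs]; field_simp
    · have : (d i).2 = -edgeHeight d i := by simp [edgeHeight]
      simp [this]; field_simp; ring

theorem mem_pathPoints (hd : IsEdgeSystem d) {a : ℝ × ℝ} {L : List (Fin n)} {q : ℝ × ℝ} :
    q ∈ pathPoints d a L ↔
      a.2 - wordHeight d L ≤ q.2 ∧ q.2 ≤ a.2 ∧ q.1 = pathX d a L q.2 := by
  induction L generalizing a with
  | nil =>
    simp only [pathPoints, Set.mem_singleton_iff, wordHeight_nil, sub_zero, pathX, profile, add_zero]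
    constructor
    · rintro rfl; simp
    · rintro ⟨h1, h2, h3⟩; ext
      · exact h3
      · exact le_antisymm h2 h1
  | cons i L ih =>
    have hp := hd.edgeHeight_pos i
    have hL := hd.wordHeight_nonneg L
    have hs := hd.edgeSlope_mul i
    have e2 : (a + d i).2 = a.2 - edgeHeight d i := by simp [edgeHeight]
    have key : ∀ y, y ≤ a.2 - edgeHeight d i → pathX d a (i :: L) y = pathX d (a + d i) L y := by
      intro y hy
      unfold pathX
      rw [profile, min_eq_right (by linarith), max_eq_right (by linarith), hs, e2,
        Prod.fst_add, sub_right_comm]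
      ring
    simp only [pathPoints, Set.mem_union, ih, mem_segment_edge hd, wordHeight_cons, e2]
    constructor
    · rintro (⟨r, h0, h1, rfl⟩ | ⟨h0, h1, h2⟩)
      · refine ⟨by dsimp only; linarith, by dsimp only; linarith, ?_⟩
        have := pathX_split hd a [] i L h0 h1
        simpa using this.symm
      · exact ⟨by linarith, by linarith, by rw [h2, key _ h1]⟩
    · rintro ⟨h0, h1, h2⟩
      rcases le_total q.2 (a.2 - edgeHeight d i) with h | h
      · exact Or.inr ⟨by linarith, h, by rw [h2, key _ h]⟩
      · left
        refine ⟨a.2 - q.2, by linarith, by linarith, ?_⟩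
        have := pathX_split hd a [] i L (r := a.2 - q.2) (by linarith) (by linarith)
        simp only [wordSum_nil, add_zero, sub_sub_cancel, List.nil_append] at this
        ext
        · rw [h2, this]
        · simp

end Profile

/-! ### Words and the weak order -/

section WeakOrder

variable {n : ℕ}

theorem pair_sublist_cons {a b c : Fin n} {L : List (Fin n)} :
    [a, b].Sublist (c :: L) ↔ (a = c ∧ b ∈ L) ∨ [a, b].Sublist L := by
  rw [List.sublist_cons_iff]
  constructor
  · rintro (h | ⟨r, hr, h⟩)
    · exact Or.inr h
    · simp only [List.cons.injEq] at hr
      obtain ⟨rfl, rfl⟩ := hr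
      exact Or.inl ⟨rfl, List.singleton_sublist.1 h⟩
  · rintro (⟨rfl, h⟩ | h)
    · exact Or.inr ⟨[b], rfl, List.singleton_sublist.2 h⟩
    · exact Or.inl h

theorem pair_sublist_append {a b : Fin n} {L M : List (Fin n)} :
    [a, b].Sublist (L ++ M) ↔ [a, b].Sublist L ∨ (a ∈ L ∧ b ∈ M) ∨ [a, b].Sublist M := by
  induction L with
  | nil => simp
  | cons c L ih =>
    simp only [List.cons_append, pair_sublist_cons, ih, List.mem_append, List.mem_cons]
    tauto

theorem pair_sublist_total {a b : Fin n} {L : List (Fin n)} (hab : a ≠ b) (ha : a ∈ L)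
    (hb : b ∈ L) : [a, b].Sublist L ∨ [b, a].Sublist L := by
  induction L with
  | nil => simp at ha
  | cons c L ih =>
    simp only [pair_sublist_cons, List.mem_cons] at *
    grind

theorem pair_sublist_asymm {a b : Fin n} {L : List (Fin n)} (hL : L.Nodup)
    (hab : [a, b].Sublist L) : ¬ [b, a].Sublist L := by
  induction L with
  | nil => simp
  | cons c L ih =>
    rw [List.nodup_cons] at hL
    have h1 : ∀ {x y}, [x, y].Sublist L → x ∈ L ∧ y ∈ L :=
      fun h => ⟨h.subset (by simp), h.subset (by simp)⟩
    simp only [pair_sublist_cons] at *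
    grind

theorem pair_sublist_ne {a b : Fin n} {L : List (Fin n)} (hL : L.Nodup)
    (hab : [a, b].Sublist L) : a ≠ b := by
  rintro rfl
  exact pair_sublist_asymm hL hab hab

theorem pair_sublist_trans {a b c : Fin n} {L : List (Fin n)} (hL : L.Nodup)
    (hab : [a, b].Sublist L) (hbc : [b, c].Sublist L) : [a, c].Sublist L := by
  induction L with
  | nil => simp at hab
  | cons x L ih =>
    rw [List.nodup_cons] at hL
    have h1 : ∀ {x y}, [x, y].Sublist L → x ∈ L ∧ y ∈ L :=
      fun h => ⟨h.subset (by simp), h.subset (by simp)⟩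
    simp only [pair_sublist_cons] at *
    grind

/-- If neighbours in `L` appear in the same order in `L'`, then so do all pairs. -/
theorem pairwise_sublist_of_adjacent {L L' : List (Fin n)} (hL' : L'.Nodup)
    (h : ∀ α a b β, L = α ++ a :: b :: β → [a, b].Sublist L') :
    L.Pairwise fun a b => [a, b].Sublist L' := by
  have : Trans (fun a b => [a, b].Sublist L') (fun a b => [a, b].Sublist L')
      (fun a b => [a, b].Sublist L') := ⟨fun h1 h2 => pair_sublist_trans hL' h1 h2⟩
  rw [← List.isChain_iff_pairwise, List.isChain_iff_forall_rel_of_append_cons_cons]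
  intro a b l1 l2 h1
  exact h _ _ _ _ h1

theorem eq_of_pairwise_sublist {L L' : List (Fin n)} (hL' : L'.Nodup) (hp : L.Perm L')
    (h : L.Pairwise fun a b => [a, b].Sublist L') : L = L' := by
  refine List.Perm.eq_of_pairwise (fun a b _ _ h1 h2 => ?_) h ?_ hp
  · exact absurd h2 (pair_sublist_asymm hL' h1)
  · exact List.pairwise_iff_forall_sublist.2 fun h => h

/-- Every inversion of `L` is an inversion of `L'`: for words with the same letters, this is the
weak order. -/
def WeakLE (L L' : List (Fin n)) : Prop :=
  ∀ a b, a < b → [b, a].Sublist L → [b, a].Sublist L'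

theorem WeakLE.refl (L : List (Fin n)) : WeakLE L L := fun _ _ _ h => h

theorem WeakLE.trans {L M N : List (Fin n)} (h1 : WeakLE L M) (h2 : WeakLE M N) : WeakLE L N :=
  fun a b hab h => h2 a b hab (h1 a b hab h)

theorem WeakLE.of_sorted {L L' : List (Fin n)} (h : L.Pairwise (· ≤ ·)) : WeakLE L L' :=
  fun _ _ hab h2 => absurd (List.pairwise_iff_forall_sublist.1 h h2) (not_le.2 hab)

theorem WeakLE.append_append {L L' : List (Fin n)} (h : WeakLE L L') (hp : L.Perm L')
    (α β : List (Fin n)) : WeakLE (α ++ L ++ β) (α ++ L' ++ β) := by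
  intro a b hab
  simp only [pair_sublist_append, List.mem_append, hp.mem_iff]
  have := h a b hab
  tauto

/-- The exchange affects the relative order of `a` and `b` only, and this pair is supplied by `hba`.
-/
theorem WeakLE.swap {α β L' : List (Fin n)} {a b : Fin n}
    (h : WeakLE (α ++ a :: b :: β) L') (hba : [b, a].Sublist L') :
    WeakLE (α ++ b :: a :: β) L' := by
  intro x y hxy hs
  have h1 := h x y hxy
  have e : ∀ c e, α ++ c :: e :: β = α ++ ([c, e] ++ β) := fun _ _ => rfl
  have hm : ∀ z, z ∈ [b, a] ++ β ↔ z ∈ [a, b] ++ β := by intro z; simp; tauto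
  have hm' : ∀ z, z ∈ [b, a] ↔ z ∈ [a, b] := by intro z; simp; tauto
  rw [e, pair_sublist_append, hm, pair_sublist_append, hm'] at hs
  rw [e, pair_sublist_append, pair_sublist_append] at h1
  rcases hs with hs | hs | hs | hs | hs
  · exact h1 (Or.inl hs)
  · exact h1 (Or.inr (Or.inl hs))
  · have := hs.eq_of_length rfl
    rwa [this]
  · exact h1 (Or.inr (Or.inr (Or.inr (Or.inl hs))))
  · exact h1 (Or.inr (Or.inr (Or.inr (Or.inr hs))))

theorem perm_swap_middle (α β : List (Fin n)) (a b : Fin n) :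
    (α ++ a :: b :: β).Perm (α ++ b :: a :: β) :=
  (List.Perm.swap b a β).append_left α

theorem weakLE_swap_ascent (α β : List (Fin n)) {a b : Fin n} (hab : a < b) :
    WeakLE (α ++ a :: b :: β) (α ++ b :: a :: β) := by
  have h : WeakLE [a, b] [b, a] := WeakLE.of_sorted (by simp [hab.le])
  simpa using h.append_append (List.Perm.swap b a []) α β

/-- A word that is not maximal below `L'` has an ascent that is inverted in `L'`. -/
theorem WeakLE.exists_ascent {L L' : List (Fin n)} (h : WeakLE L L') (hL' : L'.Nodup)
    (hp : L.Perm L') (hne : L ≠ L') :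
    ∃ α a b β, L = α ++ a :: b :: β ∧ a < b ∧ [b, a].Sublist L' := by
  by_contra! hcon
  refine hne (eq_of_pairwise_sublist hL' hp (pairwise_sublist_of_adjacent hL' ?_))
  intro α a b β hL
  have hnd : L.Nodup := hp.nodup_iff.2 hL'
  have hs : [a, b].Sublist L := by
    rw [hL]; simp
  have hab : a ≠ b := pair_sublist_ne hnd hs
  rcases hab.lt_or_gt with hlt | hlt
  · have ha : a ∈ L' := hp.mem_iff.1 (by simp [hL])
    have hb : b ∈ L' := hp.mem_iff.1 (by simp [hL])
    exact (pair_sublist_total hab ha hb).resolve_right (hcon α a b β hL hlt)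
  · exact h b a hlt hs

/-- Going from `L` to `L'` by exchanging ascents. -/
theorem WeakLE.induction_ascent {L' : List (Fin n)} (hL' : L'.Nodup) {C : List (Fin n) → Prop}
    (hC : C L') (hstep : ∀ α a b β, a < b → WeakLE (α ++ b :: a :: β) L' →
      (α ++ b :: a :: β).Perm L' → C (α ++ b :: a :: β) → C (α ++ a :: b :: β))
    {L : List (Fin n)} (hp : L.Perm L') (h : WeakLE L L') : C L := by
  classical
  -- The number of pairs not yet inverted drops with every exchange of an ascent.
  let N : List (Fin n) → ℕ := fun L =>
    (Finset.univ.filter fun x : Fin n × Fin n => x.1 < x.2 ∧ ¬ [x.2, x.1].Sublist L).card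
  induction hN : N L using Nat.strong_induction_on generalizing L with
  | _ m ih =>
    by_cases hne : L = L'
    · rwa [hne]
    obtain ⟨α, a, b, β, rfl, hab, hba⟩ := h.exists_ascent hL' hp hne
    have hp' := (perm_swap_middle α β a b).symm.trans hp
    have hle := h.swap hba
    refine hstep α a b β hab hle hp' (ih _ ?_ hp' hle rfl)
    rw [← hN]
    refine Finset.card_lt_card ⟨?_, ?_⟩
    · intro x hx
      simp only [Finset.mem_filter, Finset.mem_univ, true_and] at hx ⊢
      refine ⟨hx.1, fun hs => hx.2 ?_⟩
      exact weakLE_swap_ascent α β hab x.1 x.2 hx.1 hs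
    · intro hsub
      have hnd : (α ++ a :: b :: β).Nodup := hp.nodup_iff.2 hL'
      have h1 : [a, b].Sublist (α ++ a :: b :: β) := by
        simp
      have := @hsub (a, b) (by simp [hab, pair_sublist_asymm hnd h1])
      simp [pair_sublist_append, pair_sublist_cons] at this

end WeakOrder

/-! ### Comparing the paths of two words -/

section Compare

variable {n : ℕ} {d : Fin n → ℝ × ℝ}

/-- Amounts that are moved from smaller to larger labels move the path to the right. -/
theorem sum_slope_mul_nonneg (hd : IsEdgeSystem d) {μ : Fin n → ℝ} (h0 : ∑ l, μ l = 0)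
    (h : ∀ i j, 0 < μ i → μ j < 0 → j < i) :
    0 ≤ ∑ l, edgeSlope d l * μ l ∧ (∑ l, edgeSlope d l * μ l = 0 → ∀ l, μ l = 0) := by
  by_cases hpos : ∃ i, 0 < μ i
  · obtain ⟨i, hi, hmin⟩ := Finset.exists_min_image (Finset.univ.filter fun i => 0 < μ i)
      (edgeSlope d) (by obtain ⟨i, hi⟩ := hpos; exact ⟨i, by simp [hi]⟩)
    simp only [Finset.mem_filter, Finset.mem_univ, true_and] at hi hmin
    -- As the amounts sum to zero, all slopes may be shifted by the least slope of a label that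
    -- gains. Labels that lose lie below it, so every term becomes nonnegative.
    have e : ∑ l, edgeSlope d l * μ l = ∑ l, (edgeSlope d l - edgeSlope d i) * μ l := by
      simp only [sub_mul, Finset.sum_sub_distrib, ← Finset.mul_sum, h0]; simp
    have hterm : ∀ l ∈ Finset.univ, 0 ≤ (edgeSlope d l - edgeSlope d i) * μ l := by
      intro l _
      rcases lt_trichotomy (μ l) 0 with hl | hl | hl
      · have := hd.edgeSlope_lt (h i l hi hl)
        nlinarith
      · simp [hl]
      · have := hmin l hl
        exact mul_nonneg (by linarith) hl.le
    rw [e]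
    refine ⟨Finset.sum_nonneg hterm, fun hz => ?_⟩
    exfalso
    rw [Finset.sum_eq_zero_iff_of_nonneg hterm] at hz
    have hneg : ∃ j, μ j < 0 := by
      by_contra! hcon
      have := (Finset.sum_eq_zero_iff_of_nonneg (fun l _ => hcon l)).1 h0 i (Finset.mem_univ _)
      linarith
    obtain ⟨j, hj⟩ := hneg
    have h1 := hz j (Finset.mem_univ _)
    have := hd.edgeSlope_lt (h i j hi hj)
    nlinarith
  · push Not at hpos
    have hz : ∀ l, μ l = 0 := fun l =>
      (Finset.sum_eq_zero_iff_of_nonpos (fun l _ => hpos l)).1 h0 l (Finset.mem_univ _)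
    simp [hz]

/-- Let `i` be traversed further in `L'` and `j` further in `L`. In `L`, the label `j` is reached
while `i` is not used up, so `j` precedes `i`. If `i < j`, this inversion persists in `L'`, where
`i` is reached, so `j` would be used up there. Hence `j < i`: height moves from smaller to larger
labels, and `sum_slope_mul_nonneg` applies, including its equality case. -/
theorem WeakLE.profile_le_and (hd : IsEdgeSystem d) {L L' : List (Fin n)} (h : WeakLE L L')
    (hL' : L'.Nodup) (hp : L.Perm L') (t : ℝ) :
    profile d L t ≤ profile d L' t ∧
      (profile d L t = profile d L' t → usedHeight d L t = usedHeight d L' t) := by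
  have hL : L.Nodup := hp.nodup_iff.2 hL'
  have key := sum_slope_mul_nonneg hd (μ := fun l => usedHeight d L' t l - usedHeight d L t l)
    (by rw [Finset.sum_sub_distrib, sum_usedHeight hd, sum_usedHeight hd, wordHeight_perm hp,
      sub_self]) (by
    intro i j hi hj
    have hne : i ≠ j := by rintro rfl; linarith
    have hiL : i ∈ L := by
      by_contra hc
      rw [usedHeight_of_notMem hc, usedHeight_of_notMem (fun h' => hc (hp.mem_iff.2 h'))] at hi
      simp at hi
    have hjL : j ∈ L := by
      by_contra hc
      rw [usedHeight_of_notMem hc, usedHeight_of_notMem (fun h' => hc (hp.mem_iff.2 h'))] at hj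
      simp at hj
    have h1 := usedHeight_le hd hL' t i
    have h2 := usedHeight_nonneg (d := d) L' t j
    have h3 := usedHeight_nonneg (d := d) L t i
    have h4 := usedHeight_le hd hL t j
    have hji : [j, i].Sublist L := by
      refine (pair_sublist_total hne hiL hjL).resolve_left fun hs => ?_
      have := usedHeight_of_pair_sublist hd hL hs (t := t) (by linarith)
      linarith
    by_contra hlt
    have hij : i < j := lt_of_le_of_ne (not_lt.1 hlt) hne
    have := usedHeight_of_pair_sublist hd hL' (h i j hij hji) (t := t) (by linarith)
    linarith)
  simp only [mul_sub, Finset.sum_sub_distrib, ← profile_eq_sum] at key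
  refine ⟨by linarith [key.1], fun he => ?_⟩
  funext l
  have := key.2 (by rw [he, sub_self]) l
  linarith

theorem WeakLE.pathX_le (hd : IsEdgeSystem d) {L L' : List (Fin n)} (h : WeakLE L L')
    (hL' : L'.Nodup) (hp : L.Perm L') (a : ℝ × ℝ) (y : ℝ) : pathX d a L y ≤ pathX d a L' y :=
  add_le_add_right (h.profile_le_and hd hL' hp _).1 _

/-- Where the paths of `L` and `L'` touch, they have the same vertices. -/
theorem vertex_of_usedHeight_eq (hd : IsEdgeSystem d) {L L' : List (Fin n)} (hL : L.Nodup)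
    (hL' : L'.Nodup) {a q : ℝ × ℝ} (hq : q ∈ pathVertices d a L)
    (hlow : a.2 - wordHeight d L' ≤ q.2) (hx : q.1 = pathX d a L' q.2)
    (hu : usedHeight d L (a.2 - q.2) = usedHeight d L' (a.2 - q.2)) :
    q ∈ pathVertices d a L' := by
  obtain ⟨α, β, rfl, rfl⟩ := mem_pathVertices.1 hq
  have e : a.2 - (a + wordSum d α).2 = wordHeight d α := by
    rw [Prod.snd_add, wordSum_snd]; ring
  rw [e] at hu
  have h0 := hd.wordHeight_nonneg α
  rcases exists_split_of_depth L' h0 (by linarith) with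
    ⟨α', β', rfl, h1⟩ | ⟨α', i, β', r, rfl, h1, h2, h3⟩
  · refine mem_pathVertices.2 ⟨α', β', rfl, ?_⟩
    have e2 : (a + wordSum d α).2 = (a + wordSum d α').2 := by
      rw [Prod.snd_add, Prod.snd_add, wordSum_snd, wordSum_snd, h1]
    ext1
    · rw [hx, e2, pathX_vertex hd]
    · exact e2
  · exfalso
    have h4 := usedHeight_edge hd hL' h2.le h3.le
    rw [← h1, ← hu] at h4
    rcases usedHeight_vertex hd hL i with h5 | h5 <;> linarith

theorem pathX_of_mem_edge (hd : IsEdgeSystem d) {a q : ℝ × ℝ} {L : List (Fin n)}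
    {e : (ℝ × ℝ) × Fin n} (he : e ∈ pathEdges d a L) (hq : q ∈ openSegment ℝ e.1 (e.1 + d e.2)) :
    q.1 = pathX d a L q.2 ∧ a.2 - wordHeight d L < q.2 ∧ q.2 < a.2 := by
  obtain ⟨α, β, rfl, h⟩ := mem_pathEdges.1 he
  obtain ⟨r, h0, h1, rfl⟩ := (mem_openSegment_edge hd).1 hq
  have h2 := hd.wordHeight_nonneg α
  have h3 := hd.wordHeight_nonneg β
  refine ⟨?_, ?_, ?_⟩
  · rw [h]; exact (pathX_split hd a α e.2 β h0.le h1.le).symm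
  · rw [h]; simp [wordSum_snd]; linarith
  · rw [h]; simp [wordSum_snd]; linarith

theorem pathX_of_mem_vertices (hd : IsEdgeSystem d) {a q : ℝ × ℝ} {L : List (Fin n)}
    (hq : q ∈ pathVertices d a L) :
    q.1 = pathX d a L q.2 ∧ a.2 - wordHeight d L ≤ q.2 ∧ q.2 ≤ a.2 := by
  obtain ⟨α, β, rfl, rfl⟩ := mem_pathVertices.1 hq
  have h2 := hd.wordHeight_nonneg α
  have h3 := hd.wordHeight_nonneg β
  refine ⟨(pathX_vertex hd a α β).symm, ?_, ?_⟩ <;> simp [wordSum_snd] <;> linarith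

/-- The label of the edge would be partially traversed on one path, but untouched or used up on the
other. -/
theorem not_mem_openSegment_of_usedHeight_eq (hd : IsEdgeSystem d) {L L' : List (Fin n)}
    (hL : L.Nodup) (hL' : L'.Nodup) {a q : ℝ × ℝ} {e : (ℝ × ℝ) × Fin n}
    (hq : q ∈ pathVertices d a L) (he : e ∈ pathEdges d a L')
    (hu : usedHeight d L (a.2 - q.2) = usedHeight d L' (a.2 - q.2)) :
    q ∉ openSegment ℝ e.1 (e.1 + d e.2) := by
  intro hqe
  obtain ⟨α, β, rfl, rfl⟩ := mem_pathVertices.1 hq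
  obtain ⟨α', β', rfl, h⟩ := mem_pathEdges.1 he
  obtain ⟨r, h0, h1, h2⟩ := (mem_openSegment_edge hd).1 hqe
  have e1 : a.2 - (a + wordSum d α).2 = wordHeight d α := by
    rw [Prod.snd_add, wordSum_snd]; ring
  have e2 : wordHeight d α = wordHeight d α' + r := by
    rw [← e1, h2, h]; simp [wordSum_snd]; ring
  have h4 := usedHeight_edge hd hL' h0.le h1.le
  rw [e1] at hu
  rw [← e2, ← hu] at h4
  rcases usedHeight_vertex hd hL e.2 with h5 | h5 <;> linarith

/-- Where two comparable paths touch, an interior point of an edge of one is an interior point of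
an edge of the other. -/
theorem edge_of_usedHeight_eq (hd : IsEdgeSystem d) {L L' : List (Fin n)} (hL : L.Nodup)
    (hL' : L'.Nodup) {a q : ℝ × ℝ} {e : (ℝ × ℝ) × Fin n} (he : e ∈ pathEdges d a L)
    (hq : q ∈ openSegment ℝ e.1 (e.1 + d e.2))
    (hlow : a.2 - wordHeight d L' ≤ q.2) (hx : q.1 = pathX d a L' q.2)
    (hu : usedHeight d L (a.2 - q.2) = usedHeight d L' (a.2 - q.2)) :
    ∃ e' ∈ pathEdges d a L', q ∈ openSegment ℝ e'.1 (e'.1 + d e'.2) := by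
  have hqa := (pathX_of_mem_edge hd he hq).2.2
  rcases exists_split_of_depth (d := d) L' (t := a.2 - q.2) (by linarith) (by linarith) with
    ⟨α', β', rfl, h1⟩ | ⟨α', i, β', r, rfl, h1, h2, h3⟩
  · exfalso
    have e2 : q.2 = (a + wordSum d α').2 := by simp [wordSum_snd]; linarith
    refine not_mem_openSegment_of_usedHeight_eq hd hL' hL (e := e) (a := a) ?_ he hu.symm hq
    refine mem_pathVertices.2 ⟨α', β', rfl, ?_⟩
    ext1
    · rw [hx, e2, pathX_vertex hd]
    · exact e2
  · refine ⟨(a + wordSum d α', i), mem_pathEdges.2 ⟨α', β', rfl, rfl⟩, ?_⟩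
    refine (mem_openSegment_edge hd).2 ⟨r, h2, h3, ?_⟩
    have e2 : q.2 = (a + wordSum d α').2 - r := by simp [wordSum_snd]; linarith
    ext1
    · rw [hx, e2, pathX_split hd a α' i β' h2.le h3.le]
    · exact e2

/-- The paths of comparable words meet edge-to-edge. -/
theorem WeakLE.edge_to_edge (hd : IsEdgeSystem d) {L L' : List (Fin n)}
    (h : WeakLE L L' ∨ WeakLE L' L) (hL' : L'.Nodup) (hp : L.Perm L') {a q : ℝ × ℝ}
    {e : (ℝ × ℝ) × Fin n} (hq : q ∈ pathVertices d a L) (he : e ∈ pathEdges d a L') :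
    q ∉ openSegment ℝ e.1 (e.1 + d e.2) := by
  intro hqe
  have hL : L.Nodup := hp.nodup_iff.2 hL'
  have h1 := (pathX_of_mem_vertices hd hq).1
  have h2 := (pathX_of_mem_edge hd he hqe).1
  have h3 : profile d L (a.2 - q.2) = profile d L' (a.2 - q.2) := by
    unfold pathX at h1 h2; linarith
  refine not_mem_openSegment_of_usedHeight_eq hd hL hL' hq he ?_ hqe
  rcases h with h | h
  · exact (h.profile_le_and hd hL' hp _).2 h3
  · exact ((h.profile_le_and hd hL hp.symm _).2 h3.symm).symm

end Compare

/-! ### Regions of Elnitsky polygons -/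

namespace ElnitskyPolygon

variable {n : ℕ} {d : Fin n → ℝ × ℝ} (P : ElnitskyPolygon n)

theorem leftWord_perm : P.leftWord.Perm P.word :=
  (Finset.sort_perm_toList _ _).trans (List.toFinset_toList P.nodup)

theorem leftWord_sorted : P.leftWord.Pairwise (· ≤ ·) := Finset.pairwise_sort _ _

theorem leftWord_nodup : P.leftWord.Nodup := Finset.sort_nodup _ _

theorem leftWord_weakLE (L : List (Fin n)) : WeakLE P.leftWord L :=
  WeakLE.of_sorted P.leftWord_sorted

variable {P} in
theorem leftWord_eq {L : List (Fin n)} (hp : L.Perm P.word) (hs : L.Pairwise (· ≤ ·)) :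
    P.leftWord = L :=
  (P.leftWord_perm.trans hp.symm).eq_of_pairwise' P.leftWord_sorted hs

theorem wordHeight_leftWord : wordHeight d P.leftWord = wordHeight d P.word :=
  wordHeight_perm P.leftWord_perm

theorem pathX_leftWord_le (hd : IsEdgeSystem d) (y : ℝ) :
    pathX d P.top P.leftWord y ≤ pathX d P.top P.word y :=
  (P.leftWord_weakLE _).pathX_le hd P.nodup P.leftWord_perm _ _

variable {P}

theorem mem_region (hd : IsEdgeSystem d) {q : ℝ × ℝ} :
    q ∈ P.region d ↔ P.top.2 - wordHeight d P.word ≤ q.2 ∧ q.2 ≤ P.top.2 ∧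
      pathX d P.top P.leftWord q.2 ≤ q.1 ∧ q.1 ≤ pathX d P.top P.word q.2 := by
  simp only [region, leftBorder, rightBorder, Set.mem_ofPred_eq, mem_pathPoints hd,
    wordHeight_leftWord]
  constructor
  · rintro ⟨x₁, x₂, h1, h2, ⟨h3, h4, h5⟩, -, -, h6⟩
    exact ⟨h3, h4, h5 ▸ h1, h6 ▸ h2⟩
  · rintro ⟨h1, h2, h3, h4⟩
    exact ⟨_, _, h3, h4, ⟨h1, h2, rfl⟩, h1, h2, rfl⟩

theorem isClosed_region (hd : IsEdgeSystem d) : IsClosed (P.region d) := by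
  have h1 := continuous_pathX (d := d) P.top P.leftWord
  have h2 := continuous_pathX (d := d) P.top P.word
  have e : P.region d = {q | P.top.2 - wordHeight d P.word ≤ q.2} ∩ {q | q.2 ≤ P.top.2} ∩
      {q | pathX d P.top P.leftWord q.2 ≤ q.1} ∩ {q | q.1 ≤ pathX d P.top P.word q.2} := by
    ext q
    rw [mem_region hd]
    simp only [Set.mem_inter_iff, Set.mem_ofPred_eq, and_assoc]
  rw [e]
  refine ((IsClosed.inter ?_ ?_).inter ?_).inter ?_ <;>
    exact isClosed_le (by fun_prop) (by fun_prop)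

end ElnitskyPolygon

/-! ### Replacing a block of a word, and interiors of regions. -/

section Sweep

variable {n : ℕ} {d : Fin n → ℝ × ℝ}

theorem wordSum_perm {L M : List (Fin n)} (h : L.Perm M) : wordSum d L = wordSum d M :=
  (h.map _).sum_eq

/-- Words with the same letters have paths that differ only strictly between their endpoints. -/
theorem mem_Ioo_of_pathX_ne (hd : IsEdgeSystem d) {L M : List (Fin n)} (h : L.Perm M)
    {a : ℝ × ℝ} {y : ℝ} (hne : pathX d a L y ≠ pathX d a M y) :
    a.2 - wordHeight d M < y ∧ y < a.2 := by
  by_contra hcon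
  apply hne
  unfold pathX
  rcases not_and_or.1 hcon with h1 | h1
  · rw [profile_of_wordHeight_le hd L (by rw [wordHeight_perm h]; linarith),
      profile_of_wordHeight_le hd M (by linarith), wordSum_perm h]
  · rw [profile_of_nonpos hd L (by linarith), profile_of_nonpos hd M (by linarith)]

theorem pathX_append_append (hd : IsEdgeSystem d) (a : ℝ × ℝ) (α L β : List (Fin n)) {y : ℝ}
    (h0 : (a + wordSum d α).2 - wordHeight d L ≤ y) (h1 : y ≤ (a + wordSum d α).2) :
    pathX d a (α ++ L ++ β) y = pathX d (a + wordSum d α) L y := by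
  simp only [Prod.snd_add, wordSum_snd] at h0 h1
  unfold pathX
  rw [profile_append, profile_append, profile_of_wordHeight_le hd α (by linarith),
    profile_of_nonpos hd β (by rw [wordHeight_append]; linarith)]
  simp only [Prod.fst_add, Prod.snd_add, wordSum_snd]
  rw [show a.2 - y - wordHeight d α = a.2 + -wordHeight d α - y by ring]
  ring

/-- Both blocks have the same height, so the tail `β` starts at the same depth and its contributions
cancel, at every height. -/
theorem pathX_append_append_sub {L M : List (Fin n)} (h : L.Perm M) (a : ℝ × ℝ)
    (α β : List (Fin n)) (y : ℝ) :
    pathX d a (α ++ M ++ β) y - pathX d a (α ++ L ++ β) y =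
      pathX d (a + wordSum d α) M y - pathX d (a + wordSum d α) L y := by
  unfold pathX
  simp only [profile_append, wordHeight_append, wordHeight_perm h, Prod.snd_add, wordSum_snd]
  rw [show a.2 - y - wordHeight d α = a.2 + -wordHeight d α - y by ring]
  ring

theorem pathVertices_append_append (a : ℝ × ℝ) (α L β : List (Fin n)) {q : ℝ × ℝ}
    (h : q ∈ pathVertices d (a + wordSum d α) L) : q ∈ pathVertices d a (α ++ L ++ β) := by
  obtain ⟨γ, δ, rfl, rfl⟩ := mem_pathVertices.1 h
  exact mem_pathVertices.2 ⟨α ++ γ, δ ++ β, by simp, by simp [add_assoc]⟩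

theorem pathEdges_append_append (a : ℝ × ℝ) (α L β : List (Fin n)) {e : (ℝ × ℝ) × Fin n}
    (h : e ∈ pathEdges d (a + wordSum d α) L) : e ∈ pathEdges d a (α ++ L ++ β) := by
  obtain ⟨γ, δ, hL, h⟩ := mem_pathEdges.1 h
  exact mem_pathEdges.2 ⟨α ++ γ, δ ++ β, by simp [hL], by simp [h, add_assoc]⟩

namespace ElnitskyPolygon

variable {P : ElnitskyPolygon n}

theorem lt_and_lt_of_mem_interior (hd : IsEdgeSystem d) {q : ℝ × ℝ}
    (h : q ∈ interior (P.region d)) :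
    pathX d P.top P.leftWord q.2 < q.1 ∧ q.1 < pathX d P.top P.word q.2 := by
  obtain ⟨ε, hε, hb⟩ := Metric.isOpen_iff.1 isOpen_interior q h
  have key : ∀ s : ℝ, |s| < ε → (q.1 + s, q.2) ∈ P.region d := by
    intro s hs
    refine interior_subset (hb ?_)
    simpa [Prod.dist_eq, Real.dist_eq, hε] using hs
  have h1 := (mem_region hd).1 (key (-(ε / 2)) (by rw [abs_neg, abs_of_pos] <;> linarith))
  have h2 := (mem_region hd).1 (key (ε / 2) (by rw [abs_of_pos] <;> linarith))
  exact ⟨by linarith [h1.2.2.1], by linarith [h2.2.2.2]⟩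

/-- The strict inequality already places the point in the right range of heights, because the two
border functions agree above the top and below the bottom. -/
theorem mem_region_of_lt_of_le (hd : IsEdgeSystem d) {q : ℝ × ℝ}
    (h1 : pathX d P.top P.leftWord q.2 < q.1) (h2 : q.1 ≤ pathX d P.top P.word q.2) :
    q ∈ P.region d := by
  have h := mem_Ioo_of_pathX_ne hd P.leftWord_perm (h1.trans_le h2).ne
  exact (mem_region hd).2 ⟨h.1.le, h.2.le, h1.le, h2⟩

theorem mem_interior_of_lt (hd : IsEdgeSystem d) {q : ℝ × ℝ}
    (h1 : pathX d P.top P.leftWord q.2 < q.1) (h2 : q.1 < pathX d P.top P.word q.2) :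
    q ∈ interior (P.region d) := by
  have c1 := continuous_pathX (d := d) P.top P.leftWord
  have c2 := continuous_pathX (d := d) P.top P.word
  refine mem_interior.2 ⟨{q | pathX d P.top P.leftWord q.2 < q.1} ∩
    {q | q.1 < pathX d P.top P.word q.2}, ?_, ?_, h1, h2⟩
  · rintro q ⟨h1, h2⟩
    exact mem_region_of_lt_of_le hd h1 (le_of_lt h2)
  · exact (isOpen_lt (by fun_prop) (by fun_prop)).inter (isOpen_lt (by fun_prop) (by fun_prop))

theorem isRhombus_iff : P.IsRhombus ↔ ∃ i j : Fin n, i < j ∧ P.word = [j, i] := by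
  constructor
  · rintro ⟨h, hs⟩
    obtain ⟨j, i, hw⟩ := List.length_eq_two.1 h
    refine ⟨i, j, ?_, hw⟩
    have := (hs 1 0).1 (by decide)
    simpa [hw] using this
  · rintro ⟨i, j, hij, hw⟩
    refine ⟨by simp [hw], fun a b => ?_⟩
    fin_cases a <;> fin_cases b <;> simp [hw, hij, hij.le]

theorem leftWord_of_word_eq_pair {i j : Fin n} (hij : i < j) (hw : P.word = [j, i]) :
    P.leftWord = [i, j] :=
  leftWord_eq (by rw [hw]; exact List.Perm.swap _ _ _) (by simp [hij.le])

end ElnitskyPolygon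

/-! ### Sweeping from one path to another by polygons -/

/-- `Sweep d a L Ts L'`: the path of the word `L` with top `a` is moved to that of `L'` by
replacing successively the left border of each polygon in `Ts` by its right border. -/
inductive Sweep (d : Fin n → ℝ × ℝ) (a : ℝ × ℝ) :
    List (Fin n) → List (ElnitskyPolygon n) → List (Fin n) → Prop
  | nil (L : List (Fin n)) : Sweep d a L [] L
  | cons (P : ElnitskyPolygon n) (α β : List (Fin n)) (htop : P.top = a + wordSum d α)
      {Ts : List (ElnitskyPolygon n)} {L' : List (Fin n)}
      (h : Sweep d a (α ++ P.word ++ β) Ts L') :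
      Sweep d a (α ++ P.leftWord ++ β) (P :: Ts) L'

namespace Sweep

variable {a : ℝ × ℝ} {L M N : List (Fin n)} {Ts Us : List (ElnitskyPolygon n)}

theorem trans (h1 : Sweep d a L Ts M) (h2 : Sweep d a M Us N) : Sweep d a L (Ts ++ Us) N := by
  induction h1 with
  | nil => exact h2
  | cons P α β htop _ ih => exact Sweep.cons P α β htop (ih h2)

theorem perm (h : Sweep d a L Ts M) : L.Perm M := by
  induction h with
  | nil => exact List.Perm.refl _
  | cons P α β htop _ ih => exact ((P.leftWord_perm.append_left α).append_right β).trans ih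

theorem weakLE_cons (P : ElnitskyPolygon n) (α β : List (Fin n)) :
    WeakLE (α ++ P.leftWord ++ β) (α ++ P.word ++ β) :=
  (P.leftWord_weakLE _).append_append P.leftWord_perm α β

theorem weakLE (h : Sweep d a L Ts M) : WeakLE L M := by
  induction h with
  | nil => exact WeakLE.refl _
  | cons P α β htop _ ih => exact (weakLE_cons P α β).trans ih

/-- Each polygon lies between two successive paths of the sweep, and the paths only move to the
right. -/
theorem pathX_le_of_mem (hd : IsEdgeSystem d) (h : Sweep d a L Ts M) (hM : M.Nodup)
    {P : ElnitskyPolygon n} (hP : P ∈ Ts) {q : ℝ × ℝ} (hq : q ∈ P.region d) :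
    a.2 - wordHeight d L ≤ q.2 ∧ q.2 ≤ a.2 ∧ pathX d a L q.2 ≤ q.1 ∧ q.1 ≤ pathX d a M q.2 := by
  induction h with
  | nil => simp at hP
  | @cons R α β htop Ts M hs ih =>
    have hh : wordHeight d (α ++ R.leftWord ++ β) = wordHeight d (α ++ R.word ++ β) := by
      simp [R.wordHeight_leftWord]
    have hnd : (α ++ R.word ++ β).Nodup := hs.perm.nodup_iff.2 hM
    rcases List.mem_cons.1 hP with rfl | hP
    · obtain ⟨h1, h2, h3, h4⟩ := (ElnitskyPolygon.mem_region hd).1 hq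
      have e1 := pathX_append_append hd a α P.leftWord β (y := q.2)
        (by rw [← htop, P.wordHeight_leftWord]; exact h1) (by rw [← htop]; exact h2)
      have e2 := pathX_append_append hd a α P.word β (y := q.2)
        (by rw [← htop]; exact h1) (by rw [← htop]; exact h2)
      rw [← htop] at e1 e2
      have h5 := hs.weakLE.pathX_le hd hM hs.perm a q.2
      have hα := hd.wordHeight_nonneg α
      have hβ := hd.wordHeight_nonneg β
      rw [htop, Prod.snd_add, wordSum_snd] at h1 h2
      refine ⟨by rw [hh]; simp; linarith, by linarith, by rw [e1]; exact h3, by linarith⟩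
    · obtain ⟨h1, h2, h3, h4⟩ := ih hM hP
      have h5 := (weakLE_cons R α β).pathX_le hd hnd
        ((R.leftWord_perm.append_left α).append_right β) a q.2
      exact ⟨by rw [hh]; exact h1, h2, h5.trans h3, h4⟩

/-- The point belongs to the first polygon whose replacement carries the path up to or past it.
Points on the initial path are excluded since no polygon need touch them. -/
theorem exists_mem_region (hd : IsEdgeSystem d) (h : Sweep d a L Ts M) {q : ℝ × ℝ}
    (h1 : pathX d a L q.2 < q.1) (h2 : q.1 ≤ pathX d a M q.2) :
    ∃ P ∈ Ts, q ∈ P.region d := by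
  induction h with
  | nil => linarith
  | @cons R α β htop Ts M hs ih =>
    rcases le_or_gt q.1 (pathX d a (α ++ R.word ++ β) q.2) with h3 | h3
    · refine ⟨R, by simp, ?_⟩
      have e := pathX_append_append_sub (d := d) R.leftWord_perm a α β q.2
      rw [← htop] at e
      have h4 := mem_Ioo_of_pathX_ne hd R.leftWord_perm (a := R.top) (y := q.2)
        (by intro hc; rw [hc] at e; linarith)
      have e1 := pathX_append_append hd a α R.leftWord β (y := q.2)
        (by rw [← htop, R.wordHeight_leftWord]; exact h4.1.le) (by rw [← htop]; exact h4.2.le)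
      rw [← htop] at e1
      exact (ElnitskyPolygon.mem_region hd).2 ⟨h4.1.le, h4.2.le, by linarith, by linarith⟩
    · obtain ⟨P, hP, hq⟩ := ih h3 h2
      exact ⟨P, by simp [hP], hq⟩

/-- The path after a replacement separates: the polygon just used lies weakly left of it, all later
ones weakly right of it. -/
theorem pairwise_disjoint (hd : IsEdgeSystem d) (h : Sweep d a L Ts M) (hM : M.Nodup) :
    Ts.Pairwise fun P Q => Disjoint (P.region d) (interior (Q.region d)) ∧
      Disjoint (Q.region d) (interior (P.region d)) := by
  induction h with
  | nil => simp
  | @cons R α β htop Ts M hs ih =>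
    refine List.pairwise_cons.2 ⟨fun Q hQ => ?_, ih hM⟩
    have hR : ∀ q ∈ R.region d, pathX d a (α ++ R.word ++ β) q.2 = pathX d R.top R.word q.2 := by
      intro q hq
      obtain ⟨h1, h2, -, -⟩ := (ElnitskyPolygon.mem_region hd).1 hq
      have e2 := pathX_append_append hd a α R.word β (y := q.2)
        (by rw [← htop]; exact h1) (by rw [← htop]; exact h2)
      rw [e2, htop]
    constructor <;> rw [Set.disjoint_left]
    · intro q hq hq'
      have h1 := ((ElnitskyPolygon.mem_region hd).1 hq).2.2.2
      rw [← hR q hq] at h1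
      -- A small shift to the left stays in the later polygon but crosses the separating path.
      obtain ⟨ε, hε, hb⟩ := Metric.isOpen_iff.1 isOpen_interior q hq'
      have h2 : (q.1 - ε / 2, q.2) ∈ Q.region d := by
        refine interior_subset (hb ?_)
        simp [Prod.dist_eq, hε, abs_of_pos hε]
      have h3 := (hs.pathX_le_of_mem hd hM hQ h2).2.2.1
      dsimp only at h3
      linarith
    · intro q hq hq'
      have h1 := (ElnitskyPolygon.lt_and_lt_of_mem_interior hd hq').2
      rw [← hR q (interior_subset hq')] at h1
      have h3 := (hs.pathX_le_of_mem hd hM hQ hq).2.2.1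
      linarith

/-- The sides and vertices of the polygons of a sweep lie on pairwise comparable paths. -/
theorem exists_words (h : Sweep d a L Ts M) :
    ∃ W : Set (List (Fin n)), L ∈ W ∧ M ∈ W ∧
      (∀ c ∈ W, c.Perm M ∧ WeakLE L c ∧ WeakLE c M) ∧
      (∀ c ∈ W, ∀ c' ∈ W, WeakLE c c' ∨ WeakLE c' c) ∧
      ∀ P ∈ Ts, (∀ x ∈ P.vertices d, ∃ c ∈ W, x ∈ pathVertices d a c) ∧
        ∀ e ∈ P.edges d, ∃ c ∈ W, e ∈ pathEdges d a c := by
  induction h with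
  | nil L => exact ⟨{L}, rfl, rfl, by simp [WeakLE.refl], by simp [WeakLE.refl], by simp⟩
  | @cons R α β htop Ts M hs ih =>
    obtain ⟨W, h1, h2, h3, h4, h5⟩ := ih
    have hle := weakLE_cons R α β
    have hp := (R.leftWord_perm.append_left α).append_right β
    refine ⟨insert (α ++ R.leftWord ++ β) W, by simp, by simp [h2], ?_, ?_, ?_⟩
    · rintro c (rfl | hc)
      · exact ⟨hp.trans hs.perm, WeakLE.refl _, hle.trans hs.weakLE⟩
      · exact ⟨(h3 c hc).1, hle.trans (h3 c hc).2.1, (h3 c hc).2.2⟩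
    · rintro c (rfl | hc) c' (rfl | hc')
      · exact Or.inl (WeakLE.refl _)
      · exact Or.inl (hle.trans (h3 c' hc').2.1)
      · exact Or.inr (hle.trans (h3 c hc).2.1)
      · exact h4 c hc c' hc'
    · intro P hP
      rcases List.mem_cons.1 hP with rfl | hP
      · constructor
        · intro x hx
          rcases List.mem_append.1 hx with hx | hx <;> rw [htop] at hx
          · exact ⟨_, by simp, pathVertices_append_append a α _ β hx⟩
          · exact ⟨_, Set.mem_insert_of_mem _ h1, pathVertices_append_append a α _ β hx⟩
        · intro x hx
          rcases List.mem_append.1 hx with hx | hx <;>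
            simp only [ElnitskyPolygon.leftEdges, ElnitskyPolygon.rightEdges, htop] at hx
          · exact ⟨_, by simp, pathEdges_append_append a α _ β hx⟩
          · exact ⟨_, Set.mem_insert_of_mem _ h1, pathEdges_append_append a α _ β hx⟩
      · obtain ⟨h6, h7⟩ := h5 P hP
        refine ⟨fun x hx => ?_, fun e he => ?_⟩
        · obtain ⟨c, hc, hx⟩ := h6 x hx
          exact ⟨c, Set.mem_insert_of_mem _ hc, hx⟩
        · obtain ⟨c, hc, hx⟩ := h7 e he
          exact ⟨c, Set.mem_insert_of_mem _ hc, hx⟩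

end Sweep

/-- Comparable words are connected by a sweep with rhombi. -/
theorem WeakLE.exists_sweep (d : Fin n → ℝ × ℝ) (a : ℝ × ℝ) {L L' : List (Fin n)}
    (h : WeakLE L L') (hL' : L'.Nodup) (hp : L.Perm L') :
    ∃ Ts, Sweep d a L Ts L' ∧ ∀ P ∈ Ts, P.IsRhombus := by
  refine WeakLE.induction_ascent hL' (C := fun L => ∃ Ts, Sweep d a L Ts L' ∧
    ∀ P ∈ Ts, P.IsRhombus) ⟨[], Sweep.nil _, by simp⟩ ?_ hp h
  rintro α x y β hxy - - ⟨Ts, hs, hr⟩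
  let P : ElnitskyPolygon n := ⟨a + wordSum d α, [y, x], by simp [hxy.ne']⟩
  have hP : P.IsRhombus := ElnitskyPolygon.isRhombus_iff.2 ⟨x, y, hxy, rfl⟩
  have hl : P.leftWord = [x, y] := ElnitskyPolygon.leftWord_of_word_eq_pair hxy rfl
  refine ⟨P :: Ts, ?_, ?_⟩
  · have := Sweep.cons (d := d) (a := a) P α β rfl (Ts := Ts) (L' := L') (by simpa [P] using hs)
    simpa [hl] using this
  · intro Q hQ
    rcases List.mem_cons.1 hQ with rfl | hQ
    · exact hP
    · exact hr Q hQ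

/-- A sweep of `X(w)` is a paw tiling. -/
theorem Sweep.isPawTiling (hd : IsEdgeSystem d) {w : Equiv.Perm (Fin n)}
    {Ts : List (ElnitskyPolygon n)}
    (h : Sweep d 0 (elnitskyX w).leftWord Ts (elnitskyX w).word) :
    IsPawTiling d w {P | P ∈ Ts} where
  finite := List.finite_toSet Ts
  subset P hP q hq := by
    rw [ElnitskyPolygon.mem_region hd, ← ElnitskyPolygon.wordHeight_leftWord]
    exact h.pathX_le_of_mem hd (elnitskyX w).nodup hP hq
  cover q hq := by
    obtain ⟨h1, h2, h3, h4⟩ := (ElnitskyPolygon.mem_region hd).1 hq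
    rcases h3.eq_or_lt with h3 | h3
    · left; left
      exact (mem_pathPoints hd).2
        ⟨by rw [ElnitskyPolygon.wordHeight_leftWord]; exact h1, h2, h3.symm⟩
    · right
      obtain ⟨P, hP, hq⟩ := h.exists_mem_region hd h3 h4
      exact Set.mem_biUnion hP hq
  nonoverlapping P hP Q hQ hne := by
    have hpw := h.pairwise_disjoint hd (elnitskyX w).nodup
    let S : ElnitskyPolygon n → ElnitskyPolygon n → Prop := fun P Q =>
      Disjoint (P.region d) (interior (Q.region d)) ∧ Disjoint (Q.region d) (interior (P.region d))
    have : Std.Symm S := ⟨fun _ _ h => h.symm⟩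
    exact (List.Pairwise.forall (R := S) hpw hP hQ hne).1
  edge_to_edge := by
    obtain ⟨W, h1, h2, h3, h4, h5⟩ := h.exists_words
    have hv : ∀ P ∈ insert (elnitskyX w) {P | P ∈ Ts}, ∀ x ∈ P.vertices d,
        ∃ c ∈ W, x ∈ pathVertices d 0 c := by
      rintro P (rfl | hP) x hx
      · rcases List.mem_append.1 hx with hx | hx
        · exact ⟨_, h1, hx⟩
        · exact ⟨_, h2, hx⟩
      · exact (h5 P hP).1 x hx
    have he : ∀ P ∈ insert (elnitskyX w) {P | P ∈ Ts}, ∀ e ∈ P.edges d,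
        ∃ c ∈ W, e ∈ pathEdges d 0 c := by
      rintro P (rfl | hP) x hx
      · rcases List.mem_append.1 hx with hx | hx
        · exact ⟨_, h1, hx⟩
        · exact ⟨_, h2, hx⟩
      · exact (h5 P hP).2 x hx
    intro P hP Q hQ x hx e hq
    obtain ⟨c, hc, hxc⟩ := hv P hP x hx
    obtain ⟨c', hc', hec⟩ := he Q hQ e hq
    have hp := h3 c hc
    have hp' := h3 c' hc'
    exact WeakLE.edge_to_edge hd (h4 c hc c' hc') (hp'.1.nodup_iff.2 (elnitskyX w).nodup)
      (hp.1.trans hp'.1.symm) hxc hec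

end Sweep

/-! ### Rhombic fillings between two paths -/

section Touching

variable {n : ℕ} {d : Fin n → ℝ × ℝ}

/-- Letters have positive height, so a prefix of a given word is determined by its height. -/
theorem append_eq_append_of_wordHeight (hd : IsEdgeSystem d) {α β γ δ : List (Fin n)}
    (h : α ++ β = γ ++ δ) (hh : wordHeight d α = wordHeight d γ) : α = γ ∧ β = δ := by
  rcases List.append_eq_append_iff.1 h with ⟨x, rfl, rfl⟩ | ⟨x, rfl, rfl⟩
  · have : x = [] := hd.wordHeight_eq_zero (by simpa using hh)
    simp [this]
  · have : x = [] := hd.wordHeight_eq_zero (by simpa using hh)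
    simp [this]

theorem fst_mem_pathVertices {a : ℝ × ℝ} {L : List (Fin n)} {e : (ℝ × ℝ) × Fin n}
    (he : e ∈ pathEdges d a L) : e.1 ∈ pathVertices d a L := by
  obtain ⟨α, β, h, h1⟩ := mem_pathEdges.1 he
  exact mem_pathVertices.2 ⟨α, _, h, h1⟩

theorem add_mem_pathVertices {a : ℝ × ℝ} {L : List (Fin n)} {e : (ℝ × ℝ) × Fin n}
    (he : e ∈ pathEdges d a L) : e.1 + d e.2 ∈ pathVertices d a L := by
  obtain ⟨α, β, h, h1⟩ := mem_pathEdges.1 he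
  exact mem_pathVertices.2 ⟨α ++ [e.2], β, by simp [h], by simp [h1, add_assoc]⟩

theorem vertex_or_mem_edge (hd : IsEdgeSystem d) {a : ℝ × ℝ} {L : List (Fin n)} {q : ℝ × ℝ}
    (h0 : a.2 - wordHeight d L ≤ q.2) (h1 : q.2 ≤ a.2) (hx : q.1 = pathX d a L q.2) :
    q ∈ pathVertices d a L ∨ ∃ e ∈ pathEdges d a L, q ∈ openSegment ℝ e.1 (e.1 + d e.2) := by
  rcases exists_split_of_depth (d := d) L (t := a.2 - q.2) (by linarith) (by linarith) with
    ⟨α, β, rfl, h⟩ | ⟨α, i, β, r, rfl, h, h2, h3⟩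
  · left
    have e2 : q.2 = (a + wordSum d α).2 := by simp [wordSum_snd]; linarith
    refine mem_pathVertices.2 ⟨α, β, rfl, ?_⟩
    ext1
    · rw [hx, e2, pathX_vertex hd]
    · exact e2
  · right
    have e2 : q.2 = (a + wordSum d α).2 - r := by simp [wordSum_snd]; linarith
    refine ⟨(a + wordSum d α, i), mem_pathEdges.2 ⟨α, β, rfl, rfl⟩,
      (mem_openSegment_edge hd).2 ⟨r, h2, h3, ?_⟩⟩
    ext1
    · rw [hx, e2, pathX_split hd a α i β h2.le h3.le]
    · exact e2

/-- If one path stays on one side of another near a common interior point of two edges, then the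
edges have the same label. -/
theorem label_eq_of_touch (hd : IsEdgeSystem d) {a b q : ℝ × ℝ} {L M : List (Fin n)}
    {e e' : (ℝ × ℝ) × Fin n} (he : e ∈ pathEdges d a L) (he' : e' ∈ pathEdges d b M)
    (hq : q ∈ openSegment ℝ e.1 (e.1 + d e.2)) (hq' : q ∈ openSegment ℝ e'.1 (e'.1 + d e'.2))
    (hle : ∀ᶠ y in nhds q.2, pathX d a L y ≤ pathX d b M y) : e.2 = e'.2 := by
  have lin : ∀ {a : ℝ × ℝ} {L : List (Fin n)} {e : (ℝ × ℝ) × Fin n}, e ∈ pathEdges d a L →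
      q ∈ openSegment ℝ e.1 (e.1 + d e.2) →
      ∀ᶠ y in nhds q.2, pathX d a L y = q.1 + edgeSlope d e.2 * (q.2 - y) := by
    intro a L e he hq
    obtain ⟨r, h0, h1, rfl⟩ := (mem_openSegment_edge hd).1 hq
    obtain ⟨α, β, rfl, h⟩ := mem_pathEdges.1 he
    filter_upwards [Ioo_mem_nhds (a := e.1.2 - edgeHeight d e.2) (b := e.1.2)
      (x := (e.1.1 + edgeSlope d e.2 * r, e.1.2 - r).2) (by dsimp only; linarith)
      (by dsimp only; linarith)] with y hy
    have := pathX_split hd a α e.2 β (r := e.1.2 - y) (by linarith [hy.2]) (by linarith [hy.1])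
    rw [← h, sub_sub_cancel] at this
    rw [this]; ring
  -- Near the point both paths are linear and agree at it, so the inequality just above and just
  -- below gives both comparisons of the slopes.
  obtain ⟨ε, hε, hb⟩ := Metric.eventually_nhds_iff.1 ((hle.and (lin he hq)).and (lin he' hq'))
  have h1 := hb (y := q.2 + ε / 2) (by simp [abs_of_pos hε, hε])
  have h2 := hb (y := q.2 - ε / 2) (by simp [abs_of_pos hε, hε])
  obtain ⟨⟨h3, h4⟩, h5⟩ := h1
  obtain ⟨⟨h6, h7⟩, h8⟩ := h2
  rw [h4, h5] at h3
  rw [h7, h8] at h6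
  refine hd.edgeSlope_injective (le_antisymm ?_ ?_)
  · nlinarith
  · nlinarith

/-- Two such edges are parallel and overlap, so they are translates along a common line. A nonzero
offset would put the upper endpoint of one inside the other. -/
theorem edge_eq_of_label_eq (hd : IsEdgeSystem d) {e e' : (ℝ × ℝ) × Fin n} {q : ℝ × ℝ}
    (h : e.2 = e'.2) (hq : q ∈ openSegment ℝ e.1 (e.1 + d e.2))
    (hq' : q ∈ openSegment ℝ e'.1 (e'.1 + d e'.2))
    (h1 : e.1 ∉ openSegment ℝ e'.1 (e'.1 + d e'.2))
    (h2 : e'.1 ∉ openSegment ℝ e.1 (e.1 + d e.2)) : e = e' := by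
  obtain ⟨r, hr0, hr1, hr⟩ := (mem_openSegment_edge hd).1 hq
  obtain ⟨s, hs0, hs1, hs⟩ := (mem_openSegment_edge hd).1 hq'
  rw [hr, Prod.mk.injEq] at hs
  rw [← h] at hs hs1
  rcases lt_trichotomy r s with hlt | heq | hlt
  · refine absurd ((mem_openSegment_edge hd).2
      ⟨s - r, by linarith, by rw [← h]; linarith, ?_⟩) h1
    rw [← h]
    ext1 <;> dsimp only <;> linarith
  · subst heq
    refine Prod.ext (Prod.ext ?_ ?_) h <;> linarith
  · refine absurd ((mem_openSegment_edge hd).2 ⟨r - s, by linarith, by linarith, ?_⟩) h2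
    ext1 <;> dsimp only <;> linarith

/-- If two words traverse the same amounts of all labels at some depth, then two labels in
opposite order are both untouched or both used up. -/
theorem usedHeight_of_opposite (hd : IsEdgeSystem d) {L L' : List (Fin n)} (hL : L.Nodup)
    (hL' : L'.Nodup) {t : ℝ} (hu : usedHeight d L t = usedHeight d L' t) {i j : Fin n}
    (hij : [i, j].Sublist L) (hji : [j, i].Sublist L') :
    (usedHeight d L t i = 0 ∧ usedHeight d L t j = 0) ∨
      (usedHeight d L t i = edgeHeight d i ∧ usedHeight d L t j = edgeHeight d j) := by
  have h1 := usedHeight_nonneg (d := d) L t i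
  have h2 := usedHeight_nonneg (d := d) L t j
  have h3 : 0 < usedHeight d L t j → usedHeight d L t i = edgeHeight d i :=
    usedHeight_of_pair_sublist hd hL hij
  have h4 : 0 < usedHeight d L t i → usedHeight d L t j = edgeHeight d j := by
    rw [hu]; exact usedHeight_of_pair_sublist hd hL' hji
  have h5 := hd.edgeHeight_pos i
  rcases h2.eq_or_lt with h2 | h2
  · rcases h1.eq_or_lt with h1 | h1
    · exact Or.inl ⟨h1.symm, h2.symm⟩
    · have := h4 h1
      linarith [hd.edgeHeight_pos j]
  · have := h3 h2
    exact Or.inr ⟨this, h4 (by linarith)⟩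

namespace ElnitskyPolygon

/-- The abscissa of the left border at height `y`. -/
noncomputable abbrev leftX (d : Fin n → ℝ × ℝ) (P : ElnitskyPolygon n) (y : ℝ) : ℝ :=
  pathX d P.top P.leftWord y

/-- The abscissa of the right border at height `y`. -/
noncomputable abbrev rightX (d : Fin n → ℝ × ℝ) (P : ElnitskyPolygon n) (y : ℝ) : ℝ :=
  pathX d P.top P.word y

/-- The two borders carry the labels in opposite orders. Where they touch, `usedHeight_of_opposite`
makes both labels untouched, which happens at the top only, or both used up, which happens at the
bottom only. -/
theorem IsRhombus.leftX_lt_rightX (hd : IsEdgeSystem d) {P : ElnitskyPolygon n}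
    (hP : P.IsRhombus) {y : ℝ} (h0 : P.top.2 - wordHeight d P.word < y) (h1 : y < P.top.2) :
    P.leftX d y < P.rightX d y := by
  refine lt_of_le_of_ne (P.pathX_leftWord_le hd y) fun heq => ?_
  obtain ⟨i, j, hij, hw⟩ := isRhombus_iff.1 hP
  have hl := leftWord_of_word_eq_pair hij hw
  have hu := ((P.leftWord_weakLE P.word).profile_le_and hd P.nodup P.leftWord_perm
    (P.top.2 - y)).2 (by simpa [leftX, rightX, pathX] using heq)
  have hi := hd.edgeHeight_pos i
  have hj := hd.edgeHeight_pos j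
  have := usedHeight_of_opposite hd P.leftWord_nodup P.nodup hu (i := i) (j := j)
    (by rw [hl]) (by rw [hw])
  rw [hw] at h0
  simp only [wordHeight_cons, wordHeight_nil, add_zero] at h0
  simp only [hl, usedHeight, hij.ne', hij.ne, if_true, if_false, zero_add, add_zero] at this
  rcases this with ⟨h2, h3⟩ | ⟨h2, h3⟩
  · have := le_max_right 0 (min (P.top.2 - y) (edgeHeight d i))
    rw [h2] at this
    rcases min_le_iff.1 this <;> linarith
  · rcases le_max_iff.1 h3.ge with h4 | h4
    · linarith
    · have := h4.trans (min_le_left _ _)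
      linarith

end ElnitskyPolygon

end Touching

/-! ### Flipping rhombi between two paths. -/

section Filling

variable {n : ℕ} {d : Fin n → ℝ × ℝ}

/-- The region between the paths with top `0` of the words `L` and `G` is filled by the rhombi in
`U`, up to finitely many points at all but finitely many heights. All vertices lie in `V` and all
edges in `E`. -/
structure Filling (d : Fin n → ℝ × ℝ) (V : Set (ℝ × ℝ)) (E : Set ((ℝ × ℝ) × Fin n))
    (L G : List (Fin n)) (U : Set (ElnitskyPolygon n)) : Prop where
  finite : U.Finite
  rhombus : ∀ R ∈ U, R.IsRhombus
  height : wordHeight d G = wordHeight d L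
  le : ∀ y, pathX d 0 L y ≤ pathX d 0 G y
  bottom : ∀ R ∈ U, -wordHeight d L ≤ R.top.2 - wordHeight d R.word
  left_le : ∀ R ∈ U, ∀ y, R.leftX d y < R.rightX d y → pathX d 0 L y ≤ R.leftX d y
  le_right : ∀ R ∈ U, ∀ y, R.leftX d y < R.rightX d y → R.rightX d y ≤ pathX d 0 G y
  cover : ∃ Z : Set ℝ, Z.Finite ∧ ∀ y ∉ Z, {x | pathX d 0 L y < x ∧ x < pathX d 0 G y ∧
    ∀ R ∈ U, ¬ (R.leftX d y < R.rightX d y ∧ R.leftX d y ≤ x ∧ x ≤ R.rightX d y)}.Finite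
  nonoverlap : ∀ R ∈ U, ∀ R' ∈ U, R ≠ R' → ∀ x y, R.leftX d y < x → x < R.rightX d y →
    R'.leftX d y < x → ¬ x < R'.rightX d y
  vertices : ∀ R ∈ U, ∀ x ∈ R.vertices d, x ∈ V
  edges : ∀ R ∈ U, ∀ e ∈ R.edges d, e ∈ E
  vertices_left : ∀ x ∈ pathVertices d 0 L, x ∈ V
  edges_left : ∀ e ∈ pathEdges d 0 L, e ∈ E
  vertices_right : ∀ x ∈ pathVertices d 0 G, x ∈ V
  edges_right : ∀ e ∈ pathEdges d 0 G, e ∈ E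

variable {V : Set (ℝ × ℝ)} {E : Set ((ℝ × ℝ) × Fin n)} {L G : List (Fin n)}
  {U : Set (ElnitskyPolygon n)}

/-- An edge of the left path that is not on the right path is a left edge of a rhombus. -/
theorem Filling.exists_mem_leftEdges (hd : IsEdgeSystem d) (hF : Filling d V E L G U)
    (hVE : ∀ x ∈ V, ∀ e ∈ E, x ∉ openSegment ℝ e.1 (e.1 + d e.2)) {e : (ℝ × ℝ) × Fin n}
    (he : e ∈ pathEdges d 0 L) (he' : e ∉ pathEdges d 0 G) : ∃ R ∈ U, e ∈ R.leftEdges d := by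
  obtain ⟨Z, hZ, hcov⟩ := hF.cover
  have hpos := hd.edgeHeight_pos e.2
  -- One interior point of the edge at an unexceptional height suffices: edge-to-edge contact then
  -- identifies whole edges.
  obtain ⟨y, ⟨hy0, hy1⟩, hyZ⟩ := ((Set.Ioo_infinite (a := e.1.2 - edgeHeight d e.2)
    (b := e.1.2) (by linarith)).sdiff hZ).nonempty
  obtain ⟨q, hq, rfl⟩ : ∃ q ∈ openSegment ℝ e.1 (e.1 + d e.2), q.2 = y :=
    ⟨_, (mem_openSegment_edge hd).2 ⟨e.1.2 - y, by linarith, by linarith, rfl⟩, by simp⟩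
  obtain ⟨hqx, hq0, hq1⟩ := pathX_of_mem_edge hd he hq
  have heE := hF.edges_left e he
  have heV := hF.vertices_left _ (fst_mem_pathVertices he)
  rcases (hF.le q.2).eq_or_lt with heq | hlt
  · exfalso
    rcases vertex_or_mem_edge hd (a := 0) (L := G) (by rw [hF.height]; exact hq0.le) hq1.le
      (hqx.trans heq) with hv | ⟨e', he'', hq'⟩
    · exact hVE q (hF.vertices_right q hv) e heE hq
    · have hl := label_eq_of_touch hd he he'' hq hq' (Filter.Eventually.of_forall hF.le)
      have := edge_eq_of_label_eq hd hl hq hq' (hVE _ heV _ (hF.edges_right _ he''))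
        (hVE _ (hF.vertices_right _ (fst_mem_pathVertices he'')) _ heE)
      exact he' (this ▸ he'')
  · obtain ⟨R, hR, hRy, hRle⟩ : ∃ R ∈ U, R.leftX d q.2 < R.rightX d q.2 ∧
        R.leftX d q.2 ≤ pathX d 0 L q.2 := by
      by_contra! hcon
      have h1 : ∀ᶠ x in nhdsWithin (pathX d 0 L q.2) (Set.Ioi (pathX d 0 L q.2)), ∀ R ∈ U,
          ¬ (R.leftX d q.2 < R.rightX d q.2 ∧ R.leftX d q.2 ≤ x ∧ x ≤ R.rightX d q.2) := by
        rw [Filter.eventually_all_finite hF.finite]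
        intro R hR
        by_cases hRy : R.leftX d q.2 < R.rightX d q.2
        · filter_upwards [Ioo_mem_nhdsGT (hcon R hR hRy)] with x hx h
          exact absurd h.2.1 (not_le.2 hx.2)
        · exact Filter.Eventually.of_forall fun x h => hRy h.1
      have h2 : {x | pathX d 0 L q.2 < x ∧ x < pathX d 0 G q.2 ∧ ∀ R ∈ U,
          ¬ (R.leftX d q.2 < R.rightX d q.2 ∧ R.leftX d q.2 ≤ x ∧ x ≤ R.rightX d q.2)} ∈
          nhdsWithin (pathX d 0 L q.2) (Set.Ioi (pathX d 0 L q.2)) := by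
        filter_upwards [h1, Ioo_mem_nhdsGT hlt] with x hx hx'
        exact ⟨hx'.1, hx'.2, hx⟩
      obtain ⟨m, hm, hsub⟩ := (mem_nhdsGT_iff_exists_Ioo_subset).1 h2
      exact Set.Ioo_infinite hm ((hcov q.2 hyZ).subset hsub)
    have hRx : R.leftX d q.2 = q.1 := by
      rw [hqx]; exact le_antisymm hRle (hF.left_le R hR _ hRy)
    have hrange := mem_Ioo_of_pathX_ne hd R.leftWord_perm hRy.ne
    refine ⟨R, hR, ?_⟩
    rcases vertex_or_mem_edge hd (a := R.top) (L := R.leftWord)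
      (by rw [R.wordHeight_leftWord]; exact hrange.1.le) hrange.2.le hRx.symm with
      hv | ⟨e', he'', hq'⟩
    · exact absurd hq (hVE q (hF.vertices R hR q (List.mem_append_left _ hv)) e heE)
    · have hev : ∀ᶠ y in nhds q.2, R.leftX d y < R.rightX d y :=
        (isOpen_lt (continuous_pathX _ _) (continuous_pathX _ _)).mem_nhds hRy
      have hl := label_eq_of_touch hd he he'' hq hq' (hev.mono fun y hy => hF.left_le R hR y hy)
      have := edge_eq_of_label_eq hd hl hq hq'
        (hVE _ heV _ (hF.edges R hR _ (List.mem_append_left _ he'')))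
        (hVE _ (hF.vertices R hR _ (List.mem_append_left _ (fst_mem_pathVertices he''))) _ heE)
      rw [this]; exact he''

/-- Equal heights rule out that one word is a proper prefix of the other. -/
theorem exists_divergence (hd : IsEdgeSystem d) {L G : List (Fin n)} (hne : L ≠ G)
    (h : wordHeight d G = wordHeight d L) :
    ∃ α i j β γ, i ≠ j ∧ L = α ++ i :: β ∧ G = α ++ j :: γ := by
  induction L generalizing G with
  | nil => exact absurd (hd.wordHeight_eq_zero (by simpa using h)).symm hne
  | cons i L ih =>
    cases G with
    | nil => exact absurd (hd.wordHeight_eq_zero (by simpa using h.symm)) hne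
    | cons j G =>
      by_cases hij : i = j
      · subst hij
        obtain ⟨α, k, l, β, γ, h1, rfl, rfl⟩ := ih (G := G) (fun h => hne (by rw [h]))
          (by simpa using h)
        exact ⟨i :: α, k, l, β, γ, h1, rfl, rfl⟩
      · exact ⟨[], i, j, L, G, hij, rfl, rfl⟩

/-- Some rhombus has its left border on the left path. -/
theorem Filling.exists_flip (hd : IsEdgeSystem d) (hF : Filling d V E L G U)
    (hVE : ∀ x ∈ V, ∀ e ∈ E, x ∉ openSegment ℝ e.1 (e.1 + d e.2)) (hne : L ≠ G) :
    ∃ R ∈ U, ∃ α β i j, i < j ∧ R.word = [j, i] ∧ R.top = 0 + wordSum d α ∧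
      L = α ++ i :: j :: β := by
  -- a left edge of a rhombus is either its first or its second left edge
  have hcases : ∀ R ∈ U, ∀ e ∈ R.leftEdges d, ∃ i j, i < j ∧ R.word = [j, i] ∧
      (e = (R.top, i) ∨ e = (R.top + d i, j)) := by
    intro R hR e he
    obtain ⟨i, j, hij, hw⟩ := ElnitskyPolygon.isRhombus_iff.1 (hF.rhombus R hR)
    refine ⟨i, j, hij, hw, ?_⟩
    rw [ElnitskyPolygon.leftEdges, ElnitskyPolygon.leftWord_of_word_eq_pair hij hw] at he
    simpa [pathEdges] using he
  -- at the height of its left vertex, a rhombus is not degenerate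
  have hmid : ∀ R ∈ U, ∀ i j, i < j → R.word = [j, i] →
      R.leftX d (R.top + d i).2 < R.rightX d (R.top + d i).2 ∧
        R.leftX d (R.top + d i).2 = (R.top + d i).1 := by
    intro R hR i j hij hw
    have hi := hd.edgeHeight_pos i
    have hj := hd.edgeHeight_pos j
    have e : (R.top + d i).2 = R.top.2 - edgeHeight d i := by simp [edgeHeight]
    refine ⟨(hF.rhombus R hR).leftX_lt_rightX hd ?_ ?_, ?_⟩
    · rw [e, hw]; simp; linarith
    · rw [e]; linarith
    · have := pathX_vertex hd R.top [i] [j]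
      rw [ElnitskyPolygon.leftX, ElnitskyPolygon.leftWord_of_word_eq_pair hij hw]
      simpa using this
  -- The candidates are the rhombi whose upper left edge is on the left path. A lowest one among
  -- them will have its lower left edge there too.
  let C : Set (ElnitskyPolygon n) :=
    {R | R ∈ U ∧ ∃ i j, i < j ∧ R.word = [j, i] ∧ (R.top, i) ∈ pathEdges d 0 L}
  have hCne : C.Nonempty := by
    obtain ⟨α, i, j, β, γ, hij, hL, hG⟩ := exists_divergence hd hne hF.height
    have he : ((0 : ℝ × ℝ) + wordSum d α, i) ∈ pathEdges d 0 L :=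
      mem_pathEdges.2 ⟨α, β, hL, rfl⟩
    obtain ⟨R, hR, hRe⟩ := hF.exists_mem_leftEdges hd hVE he (by
      intro he
      obtain ⟨α', β', h1, h2⟩ := mem_pathEdges.1 he
      rw [hG] at h1
      have h3 := congrArg Prod.snd h2
      simp only [Prod.snd_add, wordSum_snd] at h3
      have := append_eq_append_of_wordHeight hd h1 (by linarith)
      exact hij (by simpa using (List.cons.inj this.2).1.symm))
    obtain ⟨k, l, hkl, hw, h | h⟩ := hcases R hR _ hRe
    · obtain ⟨h1, rfl⟩ := Prod.mk.inj h
      exact ⟨R, hR, i, l, hkl, hw, h1 ▸ he⟩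
    -- Here the point of divergence would be the left vertex of the rhombus, where the rhombus has
    -- positive width although the two paths coincide.
    · exfalso
      obtain ⟨h1, rfl⟩ := Prod.mk.inj h
      obtain ⟨h2, -⟩ := hmid R hR k i hkl hw
      have h3 := hF.left_le R hR _ h2
      have h4 := hF.le_right R hR _ h2
      rw [← h1] at h2 h3 h4
      rw [hL, pathX_vertex hd] at h3
      rw [hG, pathX_vertex hd] at h4
      linarith
  obtain ⟨R, ⟨hR, i, j, hij, hw, hRe⟩, hmin⟩ := Set.exists_min_image C (fun R => R.top.2)
    (hF.finite.subset fun R hR => hR.1) hCne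
  obtain ⟨α, β, hL, htop⟩ := mem_pathEdges.1 hRe
  dsimp only at hL htop
  refine ⟨R, hR, ?_⟩
  cases β with
  | nil =>
    exfalso
    have := hF.bottom R hR
    rw [hL, htop, hw] at this
    simp [wordSum_snd] at this
    linarith [hd.edgeHeight_pos j]
  | cons k β =>
    by_cases hkj : k = j
    · subst hkj
      exact ⟨α, β, i, k, hij, hw, htop, hL⟩
    exfalso
    obtain ⟨h1, h2⟩ := hmid R hR i j hij hw
    have he : (R.top + d i, k) ∈ pathEdges d 0 L :=
      mem_pathEdges.2 ⟨α ++ [i], β, by simp [hL], by simp [htop]⟩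
    obtain ⟨R', hR', hRe'⟩ := hF.exists_mem_leftEdges hd hVE he (by
      intro he
      have h3 := hF.le_right R hR _ h1
      have h4 := (pathX_of_mem_vertices hd (fst_mem_pathVertices he)).1
      dsimp only at h4
      linarith)
    -- As an upper left edge of `R'`, the next edge of the path would give a lower candidate. As a
    -- lower left edge, it would make the left vertices of `R` and `R'` coincide, so that both
    -- contain points just to the right of it.
    obtain ⟨i', j', hij', hw', h | h⟩ := hcases R' hR' _ hRe'
    · obtain ⟨h3, rfl⟩ := Prod.mk.inj h
      have := hmin R' ⟨hR', k, j', hij', hw', by rw [← h3]; exact he⟩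
      rw [← h3] at this
      simp at this
      linarith [hd.1 i]
    · obtain ⟨h3, rfl⟩ := Prod.mk.inj h
      obtain ⟨h4, h5⟩ := hmid R' hR' i' k hij' hw'
      rw [← h3] at h4 h5
      have hRR : R ≠ R' := by
        rintro rfl
        rw [hw] at hw'
        simp at hw'
        exact hkj hw'.1.symm
      obtain ⟨x, hx1, hx2⟩ := exists_between (lt_min h1 (by rw [h2, ← h5]; exact h4))
      refine hF.nonoverlap R hR R' hR' hRR x _ hx1 (hx2.trans_le (min_le_left _ _)) ?_
        (hx2.trans_le (min_le_right _ _))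
      rw [h5, ← h2]; exact hx1

/-- The right path of a filling is that of a word which is larger in the weak order. -/
theorem Filling.perm_and_weakLE (hd : IsEdgeSystem d) (hF : Filling d V E L G U)
    (hVE : ∀ x ∈ V, ∀ e ∈ E, x ∉ openSegment ℝ e.1 (e.1 + d e.2)) :
    L.Perm G ∧ WeakLE L G := by
  induction hN : U.ncard using Nat.strong_induction_on generalizing L U with
  | _ N ih =>
    by_cases hne : L = G
    · subst hne
      exact ⟨List.Perm.refl _, WeakLE.refl _⟩
    obtain ⟨R, hR, α, β, i, j, hij, hw, htop, hL⟩ := hF.exists_flip hd hVE hne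
    have hl := ElnitskyPolygon.leftWord_of_word_eq_pair hij hw
    have hL0 : L = α ++ R.leftWord ++ β := by rw [hL, hl]; simp
    set L' := α ++ R.word ++ β with hL'
    have hp : L.Perm L' := by rw [hL0]; exact (R.leftWord_perm.append_left α).append_right β
    have hle : WeakLE L L' := by rw [hL0]; exact Sweep.weakLE_cons R α β
    have hsub : ∀ y, pathX d 0 L' y - pathX d 0 L y = R.rightX d y - R.leftX d y := by
      intro y
      rw [hL0, hL', pathX_append_append_sub R.leftWord_perm, ← htop]
    have hin : ∀ y, R.leftX d y < R.rightX d y →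
        pathX d 0 L y = R.leftX d y ∧ pathX d 0 L' y = R.rightX d y := by
      intro y hy
      have h1 := mem_Ioo_of_pathX_ne hd R.leftWord_perm hy.ne
      have h2 := pathX_append_append hd 0 α R.leftWord β (y := y)
        (by rw [← htop, R.wordHeight_leftWord]; exact h1.1.le) (by rw [← htop]; exact h1.2.le)
      rw [← hL0, ← htop] at h2
      exact ⟨h2, by linarith [hsub y]⟩
    have hout : ∀ y, ¬ R.leftX d y < R.rightX d y → pathX d 0 L' y = pathX d 0 L y := by
      intro y hy
      have := R.pathX_leftWord_le hd y
      have := hsub y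
      linarith
    have hmono : ∀ y, pathX d 0 L y ≤ pathX d 0 L' y := by
      intro y
      have := R.pathX_leftWord_le hd y
      have := hsub y
      linarith
    -- Pushing the left path across `R` uses up `R`; the remaining rhombi fill what is left.
    have hF' : Filling d V E L' G (U \ {R}) := by
      refine ⟨hF.finite.subset Set.sdiff_subset, fun Q hQ => hF.rhombus Q hQ.1,
        hF.height.trans (wordHeight_perm hp), ?_,
        fun Q hQ => by rw [← wordHeight_perm hp]; exact hF.bottom Q hQ.1, ?_,
        fun Q hQ => hF.le_right Q hQ.1, ?_,
        fun Q hQ Q' hQ' => hF.nonoverlap Q hQ.1 Q' hQ'.1, fun Q hQ => hF.vertices Q hQ.1,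
        fun Q hQ => hF.edges Q hQ.1, ?_, ?_, hF.vertices_right, hF.edges_right⟩
      · intro y
        by_cases hy : R.leftX d y < R.rightX d y
        · rw [(hin y hy).2]; exact hF.le_right R hR y hy
        · rw [hout y hy]; exact hF.le y
      · intro Q hQ y hQy
        by_cases hy : R.leftX d y < R.rightX d y
        · rw [(hin y hy).2]
          -- Otherwise `Q` would begin within the horizontal extent of `R` at this height and
          -- overlap it.
          by_contra! hcon
          have h1 := hF.left_le Q hQ.1 y hQy
          rw [(hin y hy).1] at h1
          obtain ⟨x, hx1, hx2⟩ := exists_between (lt_min hQy hcon)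
          exact hF.nonoverlap Q hQ.1 R hR hQ.2 x y hx1 (hx2.trans_le (min_le_left _ _))
            (h1.trans_lt hx1) (hx2.trans_le (min_le_right _ _))
        · rw [hout y hy]; exact hF.left_le Q hQ.1 y hQy
      · obtain ⟨Z, hZ, hcov⟩ := hF.cover
        refine ⟨Z, hZ, fun y hy => (hcov y hy).subset ?_⟩
        rintro x ⟨h1, h2, h3⟩
        refine ⟨(hmono y).trans_lt h1, h2, fun Q hQ hQx => ?_⟩
        by_cases hQR : Q = R
        · subst hQR
          rw [(hin y hQx.1).2] at h1
          exact absurd hQx.2.2 (not_le.2 h1)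
        · exact h3 Q ⟨hQ, hQR⟩ hQx
      -- A vertex of the new path comes before the block, on `R`, or after the block; in the last
      -- case it is unchanged because the rearranged block has the same sum.
      · intro x hx
        obtain ⟨γ, δ, h1, rfl⟩ := mem_pathVertices.1 hx
        rw [hL', List.append_assoc] at h1
        rcases List.append_eq_append_iff.1 h1 with ⟨c, rfl, h2⟩ | ⟨c, h2, -⟩
        · rcases List.append_eq_append_iff.1 h2 with ⟨c', rfl, h3⟩ | ⟨c', h3, -⟩
          · refine hF.vertices_left _ (mem_pathVertices.2 ⟨α ++ R.leftWord ++ c', δ, ?_, ?_⟩)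
            · rw [hL0, h3]; simp
            · simp [wordSum_perm R.leftWord_perm]
          · refine hF.vertices R hR _ (List.mem_append_right _
              (mem_pathVertices.2 ⟨c, c', h3, ?_⟩))
            rw [htop]; simp
        · exact hF.vertices_left _ (mem_pathVertices.2 ⟨γ, c ++ (R.leftWord ++ β),
            by rw [hL0, h2]; simp, rfl⟩)
      · intro e he
        obtain ⟨γ, δ, h1, h⟩ := mem_pathEdges.1 he
        rw [hL', hw] at h1
        have h1 : α ++ ([j, i] ++ β) = γ ++ (e.2 :: δ) := by simpa using h1
        rcases List.append_eq_append_iff.1 h1 with ⟨c, rfl, h2⟩ | ⟨c, h2, h3⟩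
        · rcases List.append_eq_append_iff.1 h2 with ⟨c', rfl, h3⟩ | ⟨c', h3, h4⟩
          · refine hF.edges_left _ (mem_pathEdges.2 ⟨α ++ R.leftWord ++ c', δ, ?_, ?_⟩)
            · rw [hL0, h3]; simp
            · rw [h, wordSum_append, wordSum_append, wordSum_append, wordSum_append,
                wordSum_perm R.leftWord_perm, hw]
              simp [add_assoc]
          · cases c' with
            | nil =>
              refine hF.edges_left _ (mem_pathEdges.2 ⟨α ++ R.leftWord, δ, ?_, ?_⟩)
              · rw [hL0]; simp at h4; simp [h4]
              · rw [h]; simp at h3; simp [wordSum_perm R.leftWord_perm, hw, ← h3]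
            | cons x c' =>
              simp only [List.cons_append, List.cons.injEq] at h4
              refine hF.edges R hR _ (List.mem_append_right _
                (mem_pathEdges.2 ⟨c, c', by rw [hw, h3, h4.1], ?_⟩))
              rw [h, htop]; simp
        · cases c with
          | nil =>
            simp only [List.nil_append, List.cons_append, List.cons.injEq] at h3
            refine hF.edges R hR _ (List.mem_append_right _
                (mem_pathEdges.2 ⟨[], [i], by rw [hw, h3.1]; rfl, ?_⟩))
            rw [h, htop, h2]; simp
          | cons x c =>
            simp only [List.cons_append, List.cons.injEq] at h3
            refine hF.edges_left _ (mem_pathEdges.2 ⟨γ, c ++ (R.leftWord ++ β), ?_, h⟩)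
            rw [hL0, h2, h3.1]; simp
    have hcard : (U \ {R}).ncard < N := by
      rw [← hN]; exact Set.ncard_sdiff_singleton_lt_of_mem hR hF.finite
    obtain ⟨h1, h2⟩ := ih _ hcard hF' rfl
    exact ⟨hp.trans h1, hle.trans h2⟩

end Filling

/-! ### Borders of polygons -/

namespace ElnitskyPolygon

variable {n : ℕ} {d : Fin n → ℝ × ℝ} {P : ElnitskyPolygon n}

theorem notMem_interior (hd : IsEdgeSystem d) {q : ℝ × ℝ}
    (h : q.1 = P.leftX d q.2 ∨ q.1 = P.rightX d q.2) : q ∉ interior (P.region d) := by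
  intro hq
  have := lt_and_lt_of_mem_interior hd hq
  rcases h with h | h <;> linarith [this.1, this.2]

theorem border_of_notMem_interior (hd : IsEdgeSystem d) {q : ℝ × ℝ} (h : q ∈ P.region d)
    (h' : q ∉ interior (P.region d)) : q.1 = P.leftX d q.2 ∨ q.1 = P.rightX d q.2 := by
  obtain ⟨-, -, h1, h2⟩ := (mem_region hd).1 h
  by_contra! hcon
  exact h' (mem_interior_of_lt hd (lt_of_le_of_ne h1 hcon.1.symm) (lt_of_le_of_ne h2 hcon.2))

theorem mem_region_of_mem_vertices (hd : IsEdgeSystem d) {q : ℝ × ℝ} (h : q ∈ P.vertices d) :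
    q ∈ P.region d ∧ (q.1 = P.leftX d q.2 ∨ q.1 = P.rightX d q.2) := by
  have hle := P.pathX_leftWord_le hd q.2
  rcases List.mem_append.1 h with h | h
  · obtain ⟨h1, h2, h3⟩ := pathX_of_mem_vertices hd h
    rw [P.wordHeight_leftWord] at h2
    exact ⟨(mem_region hd).2 ⟨h2, h3, h1.ge, h1 ▸ hle⟩, Or.inl h1⟩
  · obtain ⟨h1, h2, h3⟩ := pathX_of_mem_vertices hd h
    exact ⟨(mem_region hd).2 ⟨h2, h3, h1 ▸ hle, h1.le⟩, Or.inr h1⟩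

theorem mem_region_of_mem_edges (hd : IsEdgeSystem d) {q : ℝ × ℝ} {e : (ℝ × ℝ) × Fin n}
    (h : e ∈ P.edges d) (hq : q ∈ openSegment ℝ e.1 (e.1 + d e.2)) :
    q ∈ P.region d ∧ (q.1 = P.leftX d q.2 ∨ q.1 = P.rightX d q.2) := by
  have hle := P.pathX_leftWord_le hd q.2
  rcases List.mem_append.1 h with h | h
  · obtain ⟨h1, h2, h3⟩ := pathX_of_mem_edge hd h hq
    rw [P.wordHeight_leftWord] at h2
    exact ⟨(mem_region hd).2 ⟨h2.le, h3.le, h1.ge, h1 ▸ hle⟩, Or.inl h1⟩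
  · obtain ⟨h1, h2, h3⟩ := pathX_of_mem_edge hd h hq
    exact ⟨(mem_region hd).2 ⟨h2.le, h3.le, h1 ▸ hle, h1.le⟩, Or.inr h1⟩

/-- A border point is a vertex or an interior point of a side. -/
theorem vertex_or_mem_edge_of_border (hd : IsEdgeSystem d) {q : ℝ × ℝ} (h : q ∈ P.region d)
    (h' : q.1 = P.leftX d q.2 ∨ q.1 = P.rightX d q.2) :
    q ∈ P.vertices d ∨ ∃ e ∈ P.edges d, q ∈ openSegment ℝ e.1 (e.1 + d e.2) := by
  obtain ⟨h1, h2, -, -⟩ := (mem_region hd).1 h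
  rcases h' with h' | h'
  · rcases vertex_or_mem_edge hd (by rw [P.wordHeight_leftWord]; exact h1) h2 h' with
      h | ⟨e, he, hq⟩
    · exact Or.inl (List.mem_append_left _ h)
    · exact Or.inr ⟨e, List.mem_append_left _ he, hq⟩
  · rcases vertex_or_mem_edge hd h1 h2 h' with h | ⟨e, he, hq⟩
    · exact Or.inl (List.mem_append_right _ h)
    · exact Or.inr ⟨e, List.mem_append_right _ he, hq⟩

section Inner

variable {c : List (Fin n)}

theorem leftX_le_pathX_le (hd : IsEdgeSystem d) (hc : c.Perm P.word) (hle : WeakLE c P.word)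
    (y : ℝ) : P.leftX d y ≤ pathX d P.top c y ∧ pathX d P.top c y ≤ P.rightX d y :=
  ⟨(P.leftWord_weakLE c).pathX_le hd (hc.nodup_iff.2 P.nodup) (P.leftWord_perm.trans hc.symm) _ _,
    hle.pathX_le hd P.nodup hc _ _⟩

/-- A path inside the polygon is comparable with both borders, so wherever it reaches one of them
the equality case of `WeakLE.profile_le_and` applies. -/
theorem usedHeight_eq_of_border (hd : IsEdgeSystem d) (hc : c.Perm P.word)
    (hle : WeakLE c P.word) {q : ℝ × ℝ} (hq : q.1 = pathX d P.top c q.2)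
    (h : q ∉ interior (P.region d)) :
    (q.1 = P.leftX d q.2 ∧
      usedHeight d c (P.top.2 - q.2) = usedHeight d P.leftWord (P.top.2 - q.2)) ∨
    (q.1 = P.rightX d q.2 ∧
      usedHeight d c (P.top.2 - q.2) = usedHeight d P.word (P.top.2 - q.2)) := by
  have h1 := leftX_le_pathX_le hd hc hle q.2
  rw [← hq] at h1
  rcases h1.1.eq_or_lt with h2 | h2
  · left
    refine ⟨h2.symm, ?_⟩
    refine (((P.leftWord_weakLE c).profile_le_and hd (hc.nodup_iff.2 P.nodup)
      (P.leftWord_perm.trans hc.symm) _).2 ?_).symm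
    rw [hq] at h2
    simpa [leftX, pathX] using h2
  rcases h1.2.eq_or_lt with h3 | h3
  · right
    refine ⟨h3, (hle.profile_le_and hd P.nodup hc _).2 ?_⟩
    rw [hq] at h3
    simpa [rightX, pathX] using h3
  · exact absurd (mem_interior_of_lt hd h2 h3) h

theorem mem_region_of_path_vertex (hd : IsEdgeSystem d) (hc : c.Perm P.word)
    (hle : WeakLE c P.word) {q : ℝ × ℝ} (hq : q ∈ pathVertices d P.top c) : q ∈ P.region d := by
  obtain ⟨h1, h2, h3⟩ := pathX_of_mem_vertices hd hq
  have := leftX_le_pathX_le hd hc hle q.2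
  rw [wordHeight_perm hc] at h2
  exact (mem_region hd).2 ⟨h2, h3, h1 ▸ this.1, h1 ▸ this.2⟩

theorem mem_region_of_path_edge (hd : IsEdgeSystem d) (hc : c.Perm P.word)
    (hle : WeakLE c P.word) {q : ℝ × ℝ} {e : (ℝ × ℝ) × Fin n} (he : e ∈ pathEdges d P.top c)
    (hq : q ∈ openSegment ℝ e.1 (e.1 + d e.2)) : q ∈ P.region d := by
  obtain ⟨h1, h2, h3⟩ := pathX_of_mem_edge hd he hq
  have := leftX_le_pathX_le hd hc hle q.2
  rw [wordHeight_perm hc] at h2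
  exact (mem_region hd).2 ⟨h2.le, h3.le, h1 ▸ this.1, h1 ▸ this.2⟩

/-- A vertex of a path inside `P` that is not an interior point of `P` is a vertex of `P`. -/
theorem mem_vertices_of_path_vertex (hd : IsEdgeSystem d) (hc : c.Perm P.word)
    (hle : WeakLE c P.word) {q : ℝ × ℝ} (hq : q ∈ pathVertices d P.top c)
    (h : q ∉ interior (P.region d)) : q ∈ P.vertices d := by
  obtain ⟨h1, h2, h3⟩ := pathX_of_mem_vertices hd hq
  rw [wordHeight_perm hc] at h2
  have hnd := hc.nodup_iff.2 P.nodup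
  rcases usedHeight_eq_of_border hd hc hle h1 h with ⟨h4, h5⟩ | ⟨h4, h5⟩
  · exact List.mem_append_left _ (vertex_of_usedHeight_eq hd hnd P.leftWord_nodup hq
      (by rw [P.wordHeight_leftWord]; exact h2) h4 h5)
  · exact List.mem_append_right _ (vertex_of_usedHeight_eq hd hnd P.nodup hq h2 h4 h5)

theorem exists_mem_edges_of_path_edge (hd : IsEdgeSystem d) (hc : c.Perm P.word)
    (hle : WeakLE c P.word) {q : ℝ × ℝ} {e : (ℝ × ℝ) × Fin n} (he : e ∈ pathEdges d P.top c)
    (hq : q ∈ openSegment ℝ e.1 (e.1 + d e.2)) (h : q ∉ interior (P.region d)) :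
    ∃ e' ∈ P.edges d, q ∈ openSegment ℝ e'.1 (e'.1 + d e'.2) := by
  obtain ⟨h1, h2, h3⟩ := pathX_of_mem_edge hd he hq
  rw [wordHeight_perm hc] at h2
  have hnd := hc.nodup_iff.2 P.nodup
  rcases usedHeight_eq_of_border hd hc hle h1 h with ⟨h4, h5⟩ | ⟨h4, h5⟩
  · obtain ⟨e', he', hq'⟩ := edge_of_usedHeight_eq hd hnd P.leftWord_nodup he hq
      (by rw [P.wordHeight_leftWord]; exact h2.le) h4 h5
    exact ⟨e', List.mem_append_left _ he', hq'⟩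
  · obtain ⟨e', he', hq'⟩ := edge_of_usedHeight_eq hd hnd P.nodup he hq h2.le h4 h5
    exact ⟨e', List.mem_append_right _ he', hq'⟩

end Inner

end ElnitskyPolygon

/-! ### Paths along the edges of a tiling -/

section Extend

open Filter Topology

variable {n : ℕ} {d : Fin n → ℝ × ℝ} {w : Equiv.Perm (Fin n)} {T : Set (ElnitskyPolygon n)}

/-- The vertices of a tiling and of `X(w)`. -/
def tilingVertices (d : Fin n → ℝ × ℝ) (w : Equiv.Perm (Fin n)) (T : Set (ElnitskyPolygon n)) :
    Set (ℝ × ℝ) := {x | ∃ Q ∈ insert (elnitskyX w) T, x ∈ Q.vertices d}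

/-- The edges of a tiling and of `X(w)`. -/
def tilingEdges (d : Fin n → ℝ × ℝ) (w : Equiv.Perm (Fin n)) (T : Set (ElnitskyPolygon n)) :
    Set ((ℝ × ℝ) × Fin n) := {e | ∃ Q ∈ insert (elnitskyX w) T, e ∈ Q.edges d}

theorem ElnitskyPolygon.exists_path_of_mem_vertices {P : ElnitskyPolygon n} {x : ℝ × ℝ}
    (h : x ∈ P.vertices d) : ∃ L, L.Perm P.word ∧ x ∈ pathVertices d P.top L ∧
      ∀ e ∈ pathEdges d P.top L, e ∈ P.edges d := by
  rcases List.mem_append.1 h with h | h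
  · exact ⟨_, P.leftWord_perm, h, fun e he => List.mem_append_left _ he⟩
  · exact ⟨_, List.Perm.refl _, h, fun e he => List.mem_append_right _ he⟩

theorem tilingVertices_of_mem_edges {e : (ℝ × ℝ) × Fin n} (h : e ∈ tilingEdges d w T) :
    e.1 ∈ tilingVertices d w T ∧ e.1 + d e.2 ∈ tilingVertices d w T := by
  obtain ⟨Q, hQ, he⟩ := h
  rcases List.mem_append.1 he with he | he
  · exact ⟨⟨Q, hQ, List.mem_append_left _ (fst_mem_pathVertices he)⟩,
      ⟨Q, hQ, List.mem_append_left _ (add_mem_pathVertices he)⟩⟩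
  · exact ⟨⟨Q, hQ, List.mem_append_right _ (fst_mem_pathVertices he)⟩,
      ⟨Q, hQ, List.mem_append_right _ (add_mem_pathVertices he)⟩⟩

namespace IsPawTiling

theorem region_subset (hT : IsPawTiling d w T) {Q : ElnitskyPolygon n}
    (hQ : Q ∈ insert (elnitskyX w) T) : Q.region d ⊆ (elnitskyX w).region d := by
  rcases hQ with rfl | hQ
  · exact subset_rfl
  · exact hT.subset Q hQ

/-- Every vertex of a tiling is a vertex of `X(w)` or of a paw that extends upwards (or
downwards) from it. -/
theorem exists_paw_at_vertex (hd : IsEdgeSystem d) (hT : IsPawTiling d w T) {x : ℝ × ℝ}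
    (hx : x ∈ tilingVertices d w T) {F : Filter ℝ} [F.NeBot] (hF : F ≤ 𝓝 x.2) :
    x ∈ (elnitskyX w).vertices d ∨
      ∃ Q ∈ T, x ∈ Q.vertices d ∧ ∃ᶠ y in F, (x.1, y) ∈ Q.region d := by
  obtain ⟨P, hP, hxP⟩ := hx
  obtain ⟨hxR, hxB⟩ := ElnitskyPolygon.mem_region_of_mem_vertices hd hxP
  have hxX := hT.region_subset hP hxR
  by_cases hint : x ∈ interior ((elnitskyX w).region d)
  · right
    obtain ⟨h1, h2⟩ := ElnitskyPolygon.lt_and_lt_of_mem_interior hd hint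
    have hlt : ∀ᶠ y in F, (elnitskyX w).leftX d y < x.1 ∧ x.1 < (elnitskyX w).rightX d y := by
      refine hF (Filter.inter_mem
        ((isOpen_lt (continuous_pathX _ _) continuous_const).mem_nhds h1)
        ((isOpen_lt continuous_const (continuous_pathX _ _)).mem_nhds h2))
    have hcov : ∀ᶠ y in F, ∃ Q ∈ T, (x.1, y) ∈ Q.region d := by
      refine hlt.mono fun y hy => ?_
      rcases hT.cover (ElnitskyPolygon.mem_region_of_lt_of_le hd (q := (x.1, y)) hy.1 hy.2.le) with
        (h | h) | h
      · exact absurd ((mem_pathPoints hd).1 h).2.2 hy.1.ne'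
      · exact absurd ((mem_pathPoints hd).1 h).2.2 hy.2.ne
      · simpa using h
    -- Points vertically near `x` are covered, and there are finitely many paws, so a single paw
    -- contains such points arbitrarily close to `x`. It contains `x` since its region is closed.
    obtain ⟨Q, hQ, hfr⟩ : ∃ Q ∈ T, ∃ᶠ y in F, (x.1, y) ∈ Q.region d := by
      by_contra! hcon
      have : ∀ᶠ y in F, ∀ Q ∈ T, (x.1, y) ∉ Q.region d := by
        rw [eventually_all_finite hT.finite]
        exact fun Q hQ => hcon Q hQ
      obtain ⟨y, ⟨Q, hQ, h1⟩, h2⟩ := (hcov.and this).exists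
      exact h2 Q hQ h1
    refine ⟨Q, hQ, ?_, hfr⟩
    have hxQ : x ∈ Q.region d := by
      refine (ElnitskyPolygon.isClosed_region hd).mem_of_frequently_of_tendsto hfr ?_
      have : Tendsto (fun y : ℝ => (x.1, y)) (𝓝 x.2) (𝓝 (x.1, x.2)) :=
        (Continuous.prodMk_right x.1).tendsto x.2
      exact this.mono_left hF
    have hxQ' : x ∉ interior (Q.region d) := by
      rcases hP with rfl | hP
      · exact absurd hint (ElnitskyPolygon.notMem_interior hd hxB)
      · by_cases hPQ : P = Q
        · exact hPQ ▸ ElnitskyPolygon.notMem_interior hd hxB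
        · exact Set.disjoint_left.1 (hT.nonoverlapping P hP Q hQ hPQ) hxR
    refine (ElnitskyPolygon.vertex_or_mem_edge_of_border hd hxQ
      (ElnitskyPolygon.border_of_notMem_interior hd hxQ hxQ')).resolve_right ?_
    rintro ⟨e, he, hxe⟩
    exact hT.edge_to_edge P hP Q (Set.mem_insert_of_mem _ hQ) x hxP e he hxe
  · left
    refine (ElnitskyPolygon.vertex_or_mem_edge_of_border hd hxX
      (ElnitskyPolygon.border_of_notMem_interior hd hxX hint)).resolve_right ?_
    rintro ⟨e, he, hxe⟩
    exact hT.edge_to_edge P hP _ (Set.mem_insert _ _) x hxP e he hxe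

/-- A polygon that contains points straight above `x` does not have `x` as its top, so one of its
borders has an edge ending at `x`. On the border of `X(w)` the polygon itself serves. -/
theorem exists_edge_above (hd : IsEdgeSystem d) (hT : IsPawTiling d w T) {x : ℝ × ℝ}
    (hx : x ∈ tilingVertices d w T) (h0 : x ≠ 0) :
    ∃ e ∈ tilingEdges d w T, e.1 + d e.2 = x := by
  obtain ⟨Q, hQ, hxQ, hne⟩ : ∃ Q ∈ insert (elnitskyX w) T, x ∈ Q.vertices d ∧ x ≠ Q.top := by
    rcases hT.exists_paw_at_vertex hd hx (F := 𝓝[>] x.2) nhdsWithin_le_nhds with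
      h | ⟨Q, hQ, hxQ, hfr⟩
    · exact ⟨_, Set.mem_insert _ _, h, h0⟩
    · refine ⟨Q, Set.mem_insert_of_mem _ hQ, hxQ, ?_⟩
      rintro rfl
      obtain ⟨y, h1, h2⟩ := (hfr.and_eventually self_mem_nhdsWithin).exists
      exact absurd ((ElnitskyPolygon.mem_region hd).1 h1).2.1 (not_le.2 h2)
  obtain ⟨L, -, hxL, hLE⟩ := ElnitskyPolygon.exists_path_of_mem_vertices hxQ
  obtain ⟨α, β, rfl, hα⟩ := mem_pathVertices.1 hxL
  rcases List.eq_nil_or_concat α with rfl | ⟨α, i, rfl⟩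
  · exact absurd (by simpa using hα) hne
  · refine ⟨(Q.top + wordSum d α, i), ⟨Q, hQ, hLE _ (mem_pathEdges.2 ⟨α, β, by simp, rfl⟩)⟩, ?_⟩
    simp [hα, add_assoc]

theorem exists_edge_below (hd : IsEdgeSystem d) (hT : IsPawTiling d w T) {x : ℝ × ℝ}
    (hx : x ∈ tilingVertices d w T) (h0 : x.2 ≠ -wordHeight d (elnitskyX w).word) :
    ∃ e ∈ tilingEdges d w T, e.1 = x := by
  obtain ⟨Q, hQ, hxQ, hne⟩ : ∃ Q ∈ insert (elnitskyX w) T, x ∈ Q.vertices d ∧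
      x.2 ≠ Q.top.2 - wordHeight d Q.word := by
    rcases hT.exists_paw_at_vertex hd hx (F := 𝓝[<] x.2) nhdsWithin_le_nhds with
      h | ⟨Q, hQ, hxQ, hfr⟩
    · exact ⟨_, Set.mem_insert _ _, h, by simpa [elnitskyX] using h0⟩
    · refine ⟨Q, Set.mem_insert_of_mem _ hQ, hxQ, ?_⟩
      intro heq
      obtain ⟨y, h1, h2⟩ := (hfr.and_eventually self_mem_nhdsWithin).exists
      have h3 := ((ElnitskyPolygon.mem_region hd).1 h1).1
      rw [← heq] at h3
      exact absurd h3 (not_le.2 h2)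
  obtain ⟨L, hLp, hxL, hLE⟩ := ElnitskyPolygon.exists_path_of_mem_vertices hxQ
  obtain ⟨α, β, rfl, hα⟩ := mem_pathVertices.1 hxL
  cases β with
  | nil =>
    refine absurd ?_ hne
    rw [hα, ← wordHeight_perm hLp]
    simp [wordSum_snd]; ring
  | cons i β =>
    exact ⟨(x, i), ⟨Q, hQ, hLE _ (mem_pathEdges.2 ⟨α, β, by simp, hα⟩)⟩, rfl⟩

theorem mem_region_of_mem_vertices (hd : IsEdgeSystem d) (hT : IsPawTiling d w T) {x : ℝ × ℝ}
    (hx : x ∈ tilingVertices d w T) : x ∈ (elnitskyX w).region d := by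
  obtain ⟨P, hP, hxP⟩ := hx
  exact hT.region_subset hP (ElnitskyPolygon.mem_region_of_mem_vertices hd hxP).1

end IsPawTiling

theorem pathEdges_append (a : ℝ × ℝ) (L M : List (Fin n)) :
    pathEdges d a (L ++ M) = pathEdges d a L ++ pathEdges d (a + wordSum d L) M := by
  induction L generalizing a with
  | nil => simp [pathEdges]
  | cons i L ih => simp [pathEdges, ih, add_assoc]

/-- Bounds the number of edges needed to climb or descend along a tiling, which makes the next two
constructions terminate. -/
theorem IsEdgeSystem.exists_lower_bound (hd : IsEdgeSystem d) :
    ∃ δ > 0, ∀ i, δ ≤ edgeHeight d i := by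
  rcases isEmpty_or_nonempty (Fin n) with h | h
  · exact ⟨1, one_pos, fun i => isEmptyElim i⟩
  · obtain ⟨i, hi⟩ := Finite.exists_min (edgeHeight d)
    exact ⟨_, hd.edgeHeight_pos i, hi⟩

namespace IsPawTiling

theorem exists_path_above (hd : IsEdgeSystem d) (hT : IsPawTiling d w T) {x : ℝ × ℝ}
    (hx : x ∈ tilingVertices d w T) :
    ∃ α, x = 0 + wordSum d α ∧ ∀ e ∈ pathEdges d 0 α, e ∈ tilingEdges d w T := by
  obtain ⟨δ, hδ, hδi⟩ := hd.exists_lower_bound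
  obtain ⟨N, hN⟩ := exists_nat_ge (-x.2 / δ)
  rw [div_le_iff₀ hδ] at hN
  induction N generalizing x with
  | zero =>
    have h := (ElnitskyPolygon.mem_region hd).1 (hT.mem_region_of_mem_vertices hd hx)
    have h2 : x.2 = 0 := le_antisymm h.2.1 (by simpa using hN)
    refine ⟨[], ?_, by simp [pathEdges]⟩
    have h3 := pathX_vertex hd 0 [] (elnitskyX w).leftWord
    have h4 := pathX_vertex hd 0 [] (elnitskyX w).word
    simp only [List.nil_append, wordSum_nil, add_zero, Prod.snd_zero, Prod.fst_zero] at h3 h4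
    rw [h2] at h
    have h5 : (elnitskyX w).top = 0 := rfl
    rw [h5, h3, h4] at h
    simp only [wordSum_nil, add_zero]
    exact Prod.ext (le_antisymm h.2.2.2 h.2.2.1) h2
  | succ N ih =>
    by_cases h0 : x = 0
    · exact ⟨[], by simp [h0], by simp [pathEdges]⟩
    obtain ⟨e, he, hex⟩ := hT.exists_edge_above hd hx h0
    have hh : x.2 = e.1.2 - edgeHeight d e.2 := by rw [← hex]; simp [edgeHeight]
    obtain ⟨α, h1, h2⟩ := ih (tilingVertices_of_mem_edges he).1
      (by push_cast at hN; linarith [hδi e.2])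
    refine ⟨α ++ [e.2], by rw [← hex, h1]; simp, ?_⟩
    intro e' he'
    rw [pathEdges_append, List.mem_append] at he'
    rcases he' with he' | he'
    · exact h2 e' he'
    · simp only [pathEdges, List.mem_singleton] at he'
      rw [he', ← h1]; exact he

/-- Only the final height is controlled. That the labels of a full path do not repeat, and that it
ends at the bottom vertex, follows later from `weakLE_of_path`. -/
theorem exists_path_below (hd : IsEdgeSystem d) (hT : IsPawTiling d w T) {x : ℝ × ℝ}
    (hx : x ∈ tilingVertices d w T) :
    ∃ β, (x + wordSum d β).2 = -wordHeight d (elnitskyX w).word ∧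
      ∀ e ∈ pathEdges d x β, e ∈ tilingEdges d w T := by
  obtain ⟨δ, hδ, hδi⟩ := hd.exists_lower_bound
  obtain ⟨N, hN⟩ := exists_nat_ge ((x.2 + wordHeight d (elnitskyX w).word) / δ)
  rw [div_le_iff₀ hδ] at hN
  induction N generalizing x with
  | zero =>
    have h := (ElnitskyPolygon.mem_region hd).1 (hT.mem_region_of_mem_vertices hd hx)
    have h5 : (elnitskyX w).top = 0 := rfl
    rw [h5] at h
    refine ⟨[], ?_, by simp [pathEdges]⟩
    have h1 := h.1
    simp only [Prod.snd_zero, zero_sub] at h1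
    simp only [wordSum_nil, add_zero]
    simp only [Nat.cast_zero, zero_mul] at hN
    linarith
  | succ N ih =>
    by_cases h0 : x.2 = -wordHeight d (elnitskyX w).word
    · exact ⟨[], by simp [h0], by simp [pathEdges]⟩
    obtain ⟨e, he, rfl⟩ := hT.exists_edge_below hd hx h0
    have hh : (e.1 + d e.2).2 = e.1.2 - edgeHeight d e.2 := by simp [edgeHeight]
    obtain ⟨β, h1, h2⟩ := ih (tilingVertices_of_mem_edges he).2
      (by rw [hh]; push_cast at hN; linarith [hδi e.2])
    refine ⟨e.2 :: β, by rw [← h1]; simp [add_assoc], ?_⟩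
    intro e' he'
    simp only [pathEdges, List.mem_cons] at he'
    rcases he' with rfl | he'
    · exact he
    · exact h2 e' he'

end IsPawTiling

end Extend

/-! ### Words through a paw of a tiling -/

section Through

variable {n : ℕ} {d : Fin n → ℝ × ℝ} {w : Equiv.Perm (Fin n)} {T : Set (ElnitskyPolygon n)}

namespace IsPawTiling

/-- The paws of a tiling can be subdivided into rhombi. -/
theorem exists_subdivision (hd : IsEdgeSystem d) (hT : IsPawTiling d w T) :
    ∃ (U : Set (ElnitskyPolygon n)) (V : Set (ℝ × ℝ)) (E : Set ((ℝ × ℝ) × Fin n)),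
      U.Finite ∧ (∀ R ∈ U, R.IsRhombus) ∧ tilingVertices d w T ⊆ V ∧ tilingEdges d w T ⊆ E ∧
      (∀ R ∈ U, ∀ x ∈ R.vertices d, x ∈ V) ∧ (∀ R ∈ U, ∀ e ∈ R.edges d, e ∈ E) ∧
      (∀ x ∈ V, ∀ e ∈ E, x ∉ openSegment ℝ e.1 (e.1 + d e.2)) ∧
      (∀ R ∈ U, ∃ P ∈ T, R.region d ⊆ P.region d) ∧
      (∀ R ∈ U, ∀ R' ∈ U, R ≠ R' → Disjoint (R.region d) (interior (R'.region d))) ∧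
      ∃ Z : Set ℝ, Z.Finite ∧ ∀ y ∉ Z, {x | (elnitskyX w).leftX d y < x ∧
        x < (elnitskyX w).rightX d y ∧ ∀ R ∈ U, ¬ (R.leftX d y < R.rightX d y ∧
          R.leftX d y ≤ x ∧ x ≤ R.rightX d y)}.Finite := by
  -- Each paw is swept by rhombi on its own; no agreement between neighbouring paws has to be
  -- arranged, since their common points lie on their borders.
  choose rh hsw hrh using fun P : ElnitskyPolygon n =>
    (P.leftWord_weakLE P.word).exists_sweep d P.top P.nodup P.leftWord_perm
  choose W hWl hWr hW hWc hWt using fun P => (hsw P).exists_words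
  have hreg : ∀ P, ∀ R ∈ rh P, R.region d ⊆ P.region d := by
    intro P R hR q hq
    rw [ElnitskyPolygon.mem_region hd, ← P.wordHeight_leftWord]
    exact (hsw P).pathX_le_of_mem hd P.nodup hR hq
  have hUfin : {R | ∃ P ∈ T, R ∈ rh P}.Finite := by
    have : {R | ∃ P ∈ T, R ∈ rh P} = ⋃ P ∈ T, {R | R ∈ rh P} := by ext; simp
    rw [this]
    exact hT.finite.biUnion fun P _ => List.finite_toSet _
  refine ⟨{R | ∃ P ∈ T, R ∈ rh P},
    tilingVertices d w T ∪ {x | ∃ P ∈ T, ∃ c ∈ W P, x ∈ pathVertices d P.top c},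
    tilingEdges d w T ∪ {e | ∃ P ∈ T, ∃ c ∈ W P, e ∈ pathEdges d P.top c},
    hUfin, ?_, Set.subset_union_left, Set.subset_union_left, ?_, ?_, ?_, ?_, ?_, ?_⟩
  · rintro R ⟨P, -, hR⟩
    exact hrh P R hR
  · rintro R ⟨P, hP, hR⟩ x hx
    exact Or.inr ⟨P, hP, (hWt P R hR).1 x hx⟩
  · rintro R ⟨P, hP, hR⟩ e he
    exact Or.inr ⟨P, hP, (hWt P R hR).2 e he⟩
  · -- every vertex and every edge lies on a path inside a paw, or on the border of `X(w)`
    have hV : ∀ x ∈ tilingVertices d w T ∪ {x | ∃ P ∈ T, ∃ c ∈ W P, x ∈ pathVertices d P.top c},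
        x ∈ (elnitskyX w).vertices d ∨ ∃ P ∈ T, ∃ c ∈ W P, x ∈ pathVertices d P.top c := by
      rintro x (⟨Q, rfl | hQ, hx⟩ | h)
      · exact Or.inl hx
      · rcases List.mem_append.1 hx with hx | hx
        · exact Or.inr ⟨Q, hQ, _, hWl Q, hx⟩
        · exact Or.inr ⟨Q, hQ, _, hWr Q, hx⟩
      · exact Or.inr h
    have hE : ∀ e ∈ tilingEdges d w T ∪ {x | ∃ P ∈ T, ∃ c ∈ W P, x ∈ pathEdges d P.top c},
        e ∈ (elnitskyX w).edges d ∨ ∃ P ∈ T, ∃ c ∈ W P, e ∈ pathEdges d P.top c := by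
      rintro x (⟨Q, rfl | hQ, hx⟩ | h)
      · exact Or.inl hx
      · rcases List.mem_append.1 hx with hx | hx
        · exact Or.inr ⟨Q, hQ, _, hWl Q, hx⟩
        · exact Or.inr ⟨Q, hQ, _, hWr Q, hx⟩
      · exact Or.inr h
    have hX := Set.mem_insert (elnitskyX w) T
    have hins : ∀ {P}, P ∈ T → P ∈ insert (elnitskyX w) T := fun h => Set.mem_insert_of_mem _ h
    intro x hx e he hxe
    rcases hV x hx with hx | ⟨P, hP, c, hc, hx⟩ <;> rcases hE e he with he | ⟨Q, hQ, c', hc', he⟩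
    · exact hT.edge_to_edge _ hX _ hX x hx e he hxe
    · obtain ⟨h1, -, h2⟩ := hW Q c' hc'
      have hint : x ∉ interior (Q.region d) := fun h =>
        ElnitskyPolygon.notMem_interior hd (ElnitskyPolygon.mem_region_of_mem_vertices hd hx).2
          (interior_mono (hT.subset Q hQ) h)
      obtain ⟨e', he', hxe'⟩ :=
        ElnitskyPolygon.exists_mem_edges_of_path_edge hd h1 h2 he hxe hint
      exact hT.edge_to_edge _ hX _ (hins hQ) x hx e' he' hxe'
    · obtain ⟨h1, -, h2⟩ := hW P c hc
      have hint : x ∉ interior (P.region d) := fun h =>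
        ElnitskyPolygon.notMem_interior hd (ElnitskyPolygon.mem_region_of_mem_edges hd he hxe).2
          (interior_mono (hT.subset P hP) h)
      exact hT.edge_to_edge _ (hins hP) _ hX x
        (ElnitskyPolygon.mem_vertices_of_path_vertex hd h1 h2 hx hint) e he hxe
    · by_cases hPQ : P = Q
      · subst hPQ
        exact WeakLE.edge_to_edge hd (hWc P c hc c' hc') ((hW P c' hc').1.nodup_iff.2 P.nodup)
          ((hW P c hc).1.trans (hW P c' hc').1.symm) hx he hxe
      · obtain ⟨h1, -, h2⟩ := hW P c hc
        obtain ⟨h3, -, h4⟩ := hW Q c' hc'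
        have hxP := ElnitskyPolygon.mem_region_of_path_vertex hd h1 h2 hx
        have hxQ := ElnitskyPolygon.mem_region_of_path_edge hd h3 h4 he hxe
        -- A point common to two paws is interior to neither. There it is already a vertex of the
        -- one and inside a side of the other, against the edge-to-edge condition of the original
        -- tiling.
        have hP' : x ∉ interior (P.region d) :=
          Set.disjoint_left.1 (hT.nonoverlapping Q hQ P hP (Ne.symm hPQ)) hxQ
        have hQ' : x ∉ interior (Q.region d) :=
          Set.disjoint_left.1 (hT.nonoverlapping P hP Q hQ hPQ) hxP
        obtain ⟨e', he', hxe'⟩ :=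
          ElnitskyPolygon.exists_mem_edges_of_path_edge hd h3 h4 he hxe hQ'
        exact hT.edge_to_edge _ (hins hP) _ (hins hQ) x
          (ElnitskyPolygon.mem_vertices_of_path_vertex hd h1 h2 hx hP') e' he' hxe'
  · rintro R ⟨P, hP, hR⟩
    exact ⟨P, hP, hreg P R hR⟩
  · rintro R ⟨P, hP, hR⟩ R' ⟨P', hP', hR'⟩ hne
    by_cases hPP : P = P'
    · subst hPP
      let S : ElnitskyPolygon n → ElnitskyPolygon n → Prop := fun P Q =>
        Disjoint (P.region d) (interior (Q.region d)) ∧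
          Disjoint (Q.region d) (interior (P.region d))
      have : Std.Symm S := ⟨fun _ _ h => h.symm⟩
      exact (List.Pairwise.forall (R := S) ((hsw P).pairwise_disjoint hd P.nodup) hR hR' hne).1
    · exact (hT.nonoverlapping P hP P' hP' hPP).mono (hreg P R hR)
        (interior_mono (hreg P' R' hR'))
  -- The exceptional heights are those of tops and bottoms, where rhombi have no width. The
  -- exceptional points lie on left borders of paws, which a sweep need not cover.
  · refine ⟨(fun R : ElnitskyPolygon n => R.top.2) '' {R | ∃ P ∈ T, R ∈ rh P} ∪
      (fun R : ElnitskyPolygon n => R.top.2 - wordHeight d R.word) '' {R | ∃ P ∈ T, R ∈ rh P},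
      (hUfin.image _).union (hUfin.image _), fun y hy => ?_⟩
    refine (hT.finite.image fun P => P.leftX d y).subset ?_
    rintro x ⟨h1, h2, h3⟩
    rcases hT.cover (ElnitskyPolygon.mem_region_of_lt_of_le hd (q := (x, y)) h1 h2.le) with
      (h | h) | h
    · exact absurd ((mem_pathPoints hd).1 h).2.2 h1.ne'
    · exact absurd ((mem_pathPoints hd).1 h).2.2 h2.ne
    · obtain ⟨P, hP, hq⟩ : ∃ P ∈ T, (x, y) ∈ P.region d := by simpa using h
      refine ⟨P, hP, ?_⟩
      obtain ⟨-, -, h4, h5⟩ := (ElnitskyPolygon.mem_region hd).1 hq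
      by_contra hne
      obtain ⟨R, hR, hxR⟩ := (hsw P).exists_mem_region hd (q := (x, y))
        (lt_of_le_of_ne h4 hne) h5
      obtain ⟨h6, h7, h8, h9⟩ := (ElnitskyPolygon.mem_region hd).1 hxR
      simp only [Set.mem_union, Set.mem_image, not_or, not_exists, not_and] at hy
      refine h3 R ⟨P, hP, hR⟩ ⟨(hrh P R hR).leftX_lt_rightX hd ?_ ?_, h8, h9⟩
      · exact lt_of_le_of_ne h6 (hy.2 R ⟨P, hP, hR⟩)
      · exact lt_of_le_of_ne h7 (Ne.symm (hy.1 R ⟨P, hP, hR⟩))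

/-- A path along the edges of a tiling of `X(w)` from top to bottom is the path of a permutation
that is at most `w` in the weak order. -/
theorem weakLE_of_path (hd : IsEdgeSystem d) (hT : IsPawTiling d w T) {G : List (Fin n)}
    (hGh : wordHeight d G = wordHeight d (elnitskyX w).word)
    (hGV : ∀ x ∈ pathVertices d 0 G, x ∈ tilingVertices d w T)
    (hGE : ∀ e ∈ pathEdges d 0 G, e ∈ tilingEdges d w T) :
    G.Perm (elnitskyX w).word ∧ WeakLE G (elnitskyX w).word := by
  obtain ⟨U, V, E, hUfin, hUr, hTV, hTE, hUV, hUE, hVE, hUP, hdisj, Z, hZ, hcov⟩ :=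
    hT.exists_subdivision hd
  have hX0 : (elnitskyX w).top = 0 := rfl
  -- points of the path lie on borders of paws
  have hGb : ∀ y, -wordHeight d G ≤ y → y ≤ 0 → ∃ Q ∈ insert (elnitskyX w) T,
      (pathX d 0 G y, y) ∈ Q.region d ∧
      (pathX d 0 G y = Q.leftX d y ∨ pathX d 0 G y = Q.rightX d y) := by
    intro y h0 h1
    rcases vertex_or_mem_edge hd (a := 0) (L := G) (q := (pathX d 0 G y, y)) (by simpa using h0)
      h1 rfl with h | ⟨e, he, hq⟩
    · obtain ⟨Q, hQ, hx⟩ := hGV _ h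
      exact ⟨Q, hQ, ElnitskyPolygon.mem_region_of_mem_vertices hd hx⟩
    · obtain ⟨Q, hQ, hx⟩ := hGE _ he
      exact ⟨Q, hQ, ElnitskyPolygon.mem_region_of_mem_edges hd hx hq⟩
  have hGX : ∀ y, (elnitskyX w).leftX d y ≤ pathX d 0 G y ∧
      pathX d 0 G y ≤ (elnitskyX w).rightX d y := by
    have hin : ∀ y, -wordHeight d G ≤ y → y ≤ 0 → (elnitskyX w).leftX d y ≤ pathX d 0 G y ∧
        pathX d 0 G y ≤ (elnitskyX w).rightX d y := by
      intro y h0 h1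
      obtain ⟨Q, hQ, h2, -⟩ := hGb y h0 h1
      exact ((ElnitskyPolygon.mem_region hd).1 (hT.region_subset hQ h2)).2.2
    have hGn := hd.wordHeight_nonneg G
    have hlh := (elnitskyX w).wordHeight_leftWord (d := d)
    -- Outside the common range of heights all three paths are constant, so the endpoints of the
    -- range decide.
    intro y
    rcases le_or_gt 0 y with h1 | h1
    · have key : ∀ M, pathX d 0 M y = pathX d 0 M 0 := by
        intro M
        unfold pathX
        rw [profile_of_nonpos hd M (by simpa using h1), profile_of_nonpos hd M (by simp)]
      have := hin 0 (by linarith) le_rfl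
      rw [ElnitskyPolygon.leftX, ElnitskyPolygon.rightX, hX0] at this ⊢
      rw [key, key, key]; exact this
    rcases le_or_gt (-wordHeight d G) y with h0 | h0
    · exact hin y h0 h1.le
    · have key : ∀ M, wordHeight d M = wordHeight d G →
          pathX d 0 M y = pathX d 0 M (-wordHeight d G) := by
        intro M hM
        unfold pathX
        rw [profile_of_wordHeight_le hd M (by simp; linarith),
          profile_of_wordHeight_le hd M (by simp; linarith)]
      have := hin _ le_rfl (by linarith)
      rw [ElnitskyPolygon.leftX, ElnitskyPolygon.rightX, hX0] at this ⊢
      rw [key G rfl, key _ (hlh.trans hGh.symm), key _ hGh.symm]; exact this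
  have hUX : ∀ R ∈ U, R.region d ⊆ (elnitskyX w).region d := by
    intro R hR
    obtain ⟨P, hP, h⟩ := hUP R hR
    exact h.trans (hT.subset P hP)
  have hUX' : ∀ R ∈ U, ∀ y, R.leftX d y < R.rightX d y →
      (elnitskyX w).leftX d y ≤ R.leftX d y ∧ R.rightX d y ≤ (elnitskyX w).rightX d y := by
    intro R hR y hy
    obtain ⟨h1, h2⟩ := mem_Ioo_of_pathX_ne hd R.leftWord_perm hy.ne
    have h3 : (R.leftX d y, y) ∈ R.region d :=
      (ElnitskyPolygon.mem_region hd).2 ⟨h1.le, h2.le, le_rfl, hy.le⟩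
    have h4 : (R.rightX d y, y) ∈ R.region d :=
      (ElnitskyPolygon.mem_region hd).2 ⟨h1.le, h2.le, hy.le, le_rfl⟩
    exact ⟨((ElnitskyPolygon.mem_region hd).1 (hUX R hR h3)).2.2.1,
      ((ElnitskyPolygon.mem_region hd).1 (hUX R hR h4)).2.2.2⟩
  -- the path does not enter a rhombus
  have havoid : ∀ R ∈ U, ∀ y, R.leftX d y < pathX d 0 G y → ¬ pathX d 0 G y < R.rightX d y := by
    intro R hR y h1 h2
    obtain ⟨P, hP, hRP⟩ := hUP R hR
    have hq : (pathX d 0 G y, y) ∈ interior (P.region d) :=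
      interior_mono hRP (ElnitskyPolygon.mem_interior_of_lt hd h1 h2)
    have hqX := (ElnitskyPolygon.mem_region hd).1 (hT.subset P hP (interior_subset hq))
    obtain ⟨Q, hQ, h3, h4⟩ := hGb y (by rw [hGh]; simpa [hX0] using hqX.1) hqX.2.1
    rcases hQ with rfl | hQ
    · exact ElnitskyPolygon.notMem_interior hd h4 (interior_mono (hT.subset P hP) hq)
    · by_cases hQP : Q = P
      · subst hQP
        exact ElnitskyPolygon.notMem_interior hd h4 hq
      · exact Set.disjoint_left.1 (hT.nonoverlapping Q hQ P hP hQP) h3 hq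
  -- each rhombus lies on one side of the path
  have hside : ∀ R ∈ U, (∀ y, R.leftX d y < R.rightX d y → R.rightX d y ≤ pathX d 0 G y) ∨
      ∀ y, R.leftX d y < R.rightX d y → pathX d 0 G y ≤ R.leftX d y := by
    intro R hR
    by_contra! hcon
    obtain ⟨⟨y₁, h1, h2⟩, ⟨y₂, h3, h4⟩⟩ := hcon
    have h5 := not_lt.1 (mt (havoid R hR y₁) (by simpa using h2))
    have h6 := not_lt.1 (havoid R hR y₂ h4)
    have c1 := continuous_pathX (d := d) R.top R.leftWord
    have c2 := continuous_pathX (d := d) R.top R.word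
    have c3 := continuous_pathX (d := d) 0 G
    -- A path passing from one side of the rhombus to the other would cross its midline, at a height
    -- where the rhombus has positive width.
    obtain ⟨y, hy, heq⟩ := (isPreconnected_Ioo (a := R.top.2 - wordHeight d R.word)
      (b := R.top.2)).intermediate_value₂ (mem_Ioo_of_pathX_ne hd R.leftWord_perm h1.ne)
      (mem_Ioo_of_pathX_ne hd R.leftWord_perm h3.ne) (f := pathX d 0 G)
      (g := fun y => (R.leftX d y + R.rightX d y) / 2) c3.continuousOn
      (Continuous.continuousOn (by fun_prop)) (by linarith) (by linarith)
    have hlt := (hUr R hR).leftX_lt_rightX hd hy.1 hy.2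
    exact havoid R hR y (by linarith) (by linarith)
  -- the part of the tiling between two paths
  have fill : ∀ (A B : List (Fin n)) (U' : Set (ElnitskyPolygon n)), U' ⊆ U →
      wordHeight d A = wordHeight d (elnitskyX w).word →
      wordHeight d B = wordHeight d (elnitskyX w).word →
      (∀ y, (elnitskyX w).leftX d y ≤ pathX d 0 A y) → (∀ y, pathX d 0 A y ≤ pathX d 0 B y) →
      (∀ y, pathX d 0 B y ≤ (elnitskyX w).rightX d y) →
      (∀ R ∈ U', ∀ y, R.leftX d y < R.rightX d y → pathX d 0 A y ≤ R.leftX d y) →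
      (∀ R ∈ U', ∀ y, R.leftX d y < R.rightX d y → R.rightX d y ≤ pathX d 0 B y) →
      (∀ R ∈ U, R ∉ U' → ∀ y, R.leftX d y < R.rightX d y →
        R.rightX d y ≤ pathX d 0 A y ∨ pathX d 0 B y ≤ R.leftX d y) →
      (∀ x ∈ pathVertices d 0 A, x ∈ tilingVertices d w T) →
      (∀ e ∈ pathEdges d 0 A, e ∈ tilingEdges d w T) →
      (∀ x ∈ pathVertices d 0 B, x ∈ tilingVertices d w T) →
      (∀ e ∈ pathEdges d 0 B, e ∈ tilingEdges d w T) → Filling d V E A B U' := by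
    intro A B U' hU' hA hB hXA hAB hBX hl hr hout hAV hAE hBV hBE
    refine ⟨hUfin.subset hU', fun R hR => hUr R (hU' hR), hB.trans hA.symm, hAB, ?_, hl, hr, ?_,
      ?_, fun R hR => hUV R (hU' hR), fun R hR => hUE R (hU' hR), fun x hx => hTV (hAV x hx),
      fun e he => hTE (hAE e he), fun x hx => hTV (hBV x hx), fun e he => hTE (hBE e he)⟩
    · intro R hR
      have hv : R.top + wordSum d R.word ∈ R.vertices d :=
        List.mem_append_right _ (mem_pathVertices.2 ⟨R.word, [], by simp, rfl⟩)
      have := ((ElnitskyPolygon.mem_region hd).1 (hUX R (hU' hR)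
        (ElnitskyPolygon.mem_region_of_mem_vertices hd hv).1)).1
      rw [hX0, Prod.snd_add, wordSum_snd] at this
      rw [hA]; simpa [sub_eq_add_neg] using this
    · refine ⟨Z, hZ, fun y hy => (hcov y hy).subset ?_⟩
      rintro x ⟨h1, h2, h3⟩
      refine ⟨(hXA y).trans_lt h1, h2.trans_le (hBX y), fun R hR hRx => ?_⟩
      by_cases hRU : R ∈ U'
      · exact h3 R hRU hRx
      · rcases hout R hR hRU y hRx.1 with h | h <;> linarith [hRx.2.1, hRx.2.2]
    · intro R hR R' hR' hne x y h1 h2 h3 h4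
      exact Set.disjoint_left.1 (hdisj R (hU' hR) R' (hU' hR') hne)
        (ElnitskyPolygon.mem_region_of_lt_of_le hd (q := (x, y)) h1 h2.le)
        (ElnitskyPolygon.mem_interior_of_lt hd (q := (x, y)) h3 h4)
  have hX := Set.mem_insert (elnitskyX w) T
  have F1 := fill (elnitskyX w).leftWord G
    {R | R ∈ U ∧ ∀ y, R.leftX d y < R.rightX d y → R.rightX d y ≤ pathX d 0 G y}
    (fun R hR => hR.1) (elnitskyX w).wordHeight_leftWord hGh (fun y => le_rfl)
    (fun y => (hGX y).1) (fun y => (hGX y).2) (fun R hR y hy => (hUX' R hR.1 y hy).1)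
    (fun R hR => hR.2)
    (fun R hR hn y hy => Or.inr ((hside R hR).resolve_left (fun h => hn ⟨hR, h⟩) y hy))
    (fun x hx => ⟨_, hX, List.mem_append_left _ hx⟩)
    (fun x hx => ⟨_, hX, List.mem_append_left _ hx⟩) hGV hGE
  have F2 := fill G (elnitskyX w).word
    {R | R ∈ U ∧ ∀ y, R.leftX d y < R.rightX d y → pathX d 0 G y ≤ R.leftX d y}
    (fun R hR => hR.1) hGh rfl (fun y => (hGX y).1)
    (fun y => (hGX y).2) (fun y => le_rfl) (fun R hR => hR.2)
    (fun R hR y hy => (hUX' R hR.1 y hy).2)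
    (fun R hR hn y hy => Or.inl ((hside R hR).resolve_right (fun h => hn ⟨hR, h⟩) y hy))
    hGV hGE (fun x hx => ⟨_, hX, List.mem_append_right _ hx⟩)
    (fun x hx => ⟨_, hX, List.mem_append_right _ hx⟩)
  -- The part left of the path shows that its labels are a permutation; the part right of it gives
  -- the comparison with `w`.
  have h1 := (F1.perm_and_weakLE hd hVE).1
  exact ⟨h1.symm.trans (elnitskyX w).leftWord_perm, (F2.perm_and_weakLE hd hVE).2⟩

/-- The right border of a paw of a tiling of `X(w)` is part of the path of a permutation that is
at most `w` in the weak order. -/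
theorem exists_word_through (hd : IsEdgeSystem d) (hT : IsPawTiling d w T)
    {P : ElnitskyPolygon n} (hP : P ∈ T) :
    ∃ α β, P.top = 0 + wordSum d α ∧ (α ++ P.word ++ β).Perm (elnitskyX w).word ∧
      WeakLE (α ++ P.word ++ β) (elnitskyX w).word := by
  have hPi : P ∈ insert (elnitskyX w) T := Set.mem_insert_of_mem _ hP
  obtain ⟨α, hα, hαE⟩ := hT.exists_path_above hd (x := P.top)
    ⟨P, hPi, List.mem_append_right _ (mem_pathVertices.2 ⟨[], P.word, rfl, by simp⟩)⟩
  obtain ⟨β, hβ, hβE⟩ := hT.exists_path_below hd (x := P.top + wordSum d P.word)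
    ⟨P, hPi, List.mem_append_right _ (mem_pathVertices.2 ⟨P.word, [], by simp, rfl⟩)⟩
  have hE : ∀ e ∈ pathEdges d 0 (α ++ P.word ++ β), e ∈ tilingEdges d w T := by
    intro e he
    rw [pathEdges_append, pathEdges_append, wordSum_append, ← add_assoc, ← hα, List.mem_append,
      List.mem_append] at he
    rcases he with (he | he) | he
    · exact hαE e he
    · exact ⟨P, hPi, List.mem_append_right _ he⟩
    · exact hβE e he
  refine ⟨α, β, hα, hT.weakLE_of_path hd ?_ ?_ hE⟩
  · rw [hα] at hβ
    simp [wordSum_snd] at hβ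
    simp; linarith
  · intro x hx
    obtain ⟨γ, δ, h1, h2⟩ := mem_pathVertices.1 hx
    rcases List.eq_nil_or_concat γ with rfl | ⟨γ, i, rfl⟩
    · refine ⟨_, Set.mem_insert _ _, List.mem_append_right _
        (mem_pathVertices.2 ⟨[], _, rfl, ?_⟩)⟩
      rw [h2]; rfl
    · have := (tilingVertices_of_mem_edges (hE (0 + wordSum d γ, i)
        (mem_pathEdges.2 ⟨γ, δ, by rw [h1]; simp, rfl⟩))).2
      rw [h2]
      simpa [add_assoc] using this

end IsPawTiling

end Through

/-! ### Length and inversions -/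

section Length

variable {n : ℕ}

/-- The inversions of a permutation, as pairs of values. -/
def invPairs (w : Equiv.Perm (Fin n)) : Finset (Fin n × Fin n) :=
  Finset.univ.filter fun x => x.1 < x.2 ∧ w⁻¹ x.2 < w⁻¹ x.1

theorem mem_invPairs {w : Equiv.Perm (Fin n)} {a b : Fin n} :
    (a, b) ∈ invPairs w ↔ a < b ∧ w⁻¹ b < w⁻¹ a := by simp [invPairs]

theorem swap_lt_swap_iff {i j x y : Fin n} (hij : (j : ℕ) = i + 1)
    (h1 : ¬ (x = i ∧ y = j)) (h2 : ¬ (x = j ∧ y = i)) :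
    Equiv.swap i j x < Equiv.swap i j y ↔ x < y := by
  simp only [Equiv.swap_apply_def]
  split_ifs <;> simp only [Fin.ext_iff, Fin.lt_def] at * <;> omega

/-- Multiplication on the right exchanges two neighbouring entries and no other pair of values
changes its relative order. This is why inversions are recorded by values. -/
theorem invPairs_mul_swap {w : Equiv.Perm (Fin n)} {i j : Fin n} (hij : (j : ℕ) = i + 1)
    (h : w i < w j) :
    (w i, w j) ∉ invPairs w ∧ invPairs (w * Equiv.swap i j) = insert (w i, w j) (invPairs w) := by
  have hlt : i < j := by rw [Fin.lt_def]; omega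
  refine ⟨by simp [mem_invPairs, h, hlt.le], ?_⟩
  ext ⟨a, b⟩
  simp only [mem_invPairs, Finset.mem_insert, Prod.mk.injEq, mul_inv_rev, Equiv.Perm.mul_apply,
    Equiv.swap_inv]
  by_cases h1 : a = w i ∧ b = w j
  · obtain ⟨rfl, rfl⟩ := h1
    simp [h, hlt]
  by_cases h2 : a = w j ∧ b = w i
  · obtain ⟨rfl, rfl⟩ := h2
    simp [h.le, h.ne, h.ne']
  rw [swap_lt_swap_iff hij]
  · simp [h1]
  · rintro ⟨h3, h4⟩
    exact h2 ⟨by simp [← h4], by simp [← h3]⟩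
  · rintro ⟨h3, h4⟩
    exact h1 ⟨by simp [← h4], by simp [← h3]⟩

/-- A factor of `m` adjacent transpositions creates at most `m` inversions; if it creates `m`
inversions, then it removes none. -/
theorem card_invPairs_mul_prod_le (w : Equiv.Perm (Fin n)) (l : List (Equiv.Perm (Fin n)))
    (hl : ∀ t ∈ l, IsAdjacentTransposition t) :
    (invPairs (w * l.prod)).card ≤ (invPairs w).card + l.length ∧
      ((invPairs (w * l.prod)).card = (invPairs w).card + l.length →
        invPairs w ⊆ invPairs (w * l.prod)) := by
  induction l generalizing w with
  | nil => simp
  | cons t l ih =>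
    obtain ⟨i, j, hij, rfl⟩ := hl t (by simp)
    obtain ⟨h1, h2⟩ := ih (w * Equiv.swap i j) fun t ht => hl t (by simp [ht])
    have hne : i ≠ j := by rw [Ne, Fin.ext_iff]; omega
    rw [List.prod_cons, ← mul_assoc, List.length_cons]
    rcases (w.injective.ne hne).lt_or_gt with h | h
    · obtain ⟨h3, h4⟩ := invPairs_mul_swap hij h
      rw [h4, Finset.card_insert_of_notMem h3] at h1 h2
      exact ⟨by omega, fun he => (Finset.subset_insert _ _).trans (h2 (by omega))⟩
    · obtain ⟨h3, h4⟩ := invPairs_mul_swap (w := w * Equiv.swap i j) hij (by simpa using h)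
      rw [mul_assoc, Equiv.swap_mul_self, mul_one] at h4
      have h5 := congrArg Finset.card h4
      rw [Finset.card_insert_of_notMem h3] at h5
      -- The first factor removes an inversion and the remaining ones cannot make up for it, so
      -- equality is impossible.
      exact ⟨by omega, fun he => by omega⟩

/-- Otherwise all neighbours of `w'` appear in the same order in `w`, so `w⁻¹ * w'` is strictly
increasing and hence the identity. -/
theorem exists_adjacent_of_ne {w w' : Equiv.Perm (Fin n)} (h : invPairs w' ⊆ invPairs w)
    (hne : w' ≠ w) : ∃ i j : Fin n, (j : ℕ) = i + 1 ∧ w' i < w' j ∧ (w' i, w' j) ∈ invPairs w := by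
  by_contra! hcon
  have hadj : ∀ i j : Fin n, (j : ℕ) = i + 1 → w⁻¹ (w' i) < w⁻¹ (w' j) := by
    intro i j hij
    have hlt : i < j := by rw [Fin.lt_def]; omega
    rcases (w'.injective.ne hlt.ne).lt_or_gt with h1 | h1
    · have h2 := hcon i j hij h1
      rw [mem_invPairs] at h2
      have h3 : w⁻¹ (w' i) ≠ w⁻¹ (w' j) := fun h => h1.ne (w⁻¹.injective h)
      exact lt_of_le_of_ne (not_lt.1 fun h => h2 ⟨h1, h⟩) h3
    · exact (mem_invPairs.1 (h (mem_invPairs.2 ⟨h1, by simpa using hlt⟩))).2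
  have hmono : StrictMono fun i => w⁻¹ (w' i) := by
    cases n with
    | zero => exact fun i => i.elim0
    | succ n => exact Fin.strictMono_iff_lt_succ.2 fun i => hadj _ _ (by simp)
  let e : Fin n ≃o Fin n :=
    StrictMono.orderIsoOfSurjective _ hmono (w'.surjective |> (w⁻¹.surjective.comp ·))
  have he : ∀ i, e i = w⁻¹ (w' i) := fun i => rfl
  have he' : e = OrderIso.refl _ := Subsingleton.elim _ _
  refine hne (Equiv.ext fun i => ?_)
  have := he i
  rw [he', OrderIso.refl_apply] at this
  simpa using (congrArg w this).symm

/-- Climb from `w'` by adding, one at a time, inversions of `w` between neighbouring entries. -/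
theorem exists_adjacent_factorization {w w' : Equiv.Perm (Fin n)}
    (h : invPairs w' ⊆ invPairs w) :
    ∃ l : List (Equiv.Perm (Fin n)), (∀ t ∈ l, IsAdjacentTransposition t) ∧ w' * l.prod = w ∧
      (invPairs w).card = (invPairs w').card + l.length := by
  induction hN : (invPairs w).card - (invPairs w').card using Nat.strong_induction_on
    generalizing w' with
  | _ N ih =>
    by_cases hne : w' = w
    · exact ⟨[], by simp, by simp [hne], by simp [hne]⟩
    obtain ⟨i, j, hij, hlt, hmem⟩ := exists_adjacent_of_ne h hne
    obtain ⟨h1, h2⟩ := invPairs_mul_swap hij hlt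
    have hsub : invPairs (w' * Equiv.swap i j) ⊆ invPairs w := by
      rw [h2]; exact Finset.insert_subset hmem h
    have hcard := Finset.card_le_card hsub
    have hc2 := congrArg Finset.card h2
    rw [Finset.card_insert_of_notMem h1] at hc2
    obtain ⟨l, hl, hp, hc⟩ := ih _ (by omega) hsub rfl
    refine ⟨Equiv.swap i j :: l, ?_, ?_, ?_⟩
    · intro t ht
      rcases List.mem_cons.1 ht with rfl | ht
      · exact ⟨i, j, hij, rfl⟩
      · exact hl t ht
    · rw [List.prod_cons, ← mul_assoc, hp]
    · rw [List.length_cons]; omega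

theorem invPairs_one : invPairs (1 : Equiv.Perm (Fin n)) = ∅ := by
  ext ⟨a, b⟩
  simp only [mem_invPairs, inv_one, Equiv.Perm.one_apply, Finset.notMem_empty, iff_false]
  exact fun h => lt_asymm h.1 h.2

theorem exists_reduced_word (w : Equiv.Perm (Fin n)) :
    ∃ l : List (Equiv.Perm (Fin n)), (∀ t ∈ l, IsAdjacentTransposition t) ∧
      l.length = permLength w ∧ l.prod = w := by
  obtain ⟨l, hl, hp, -⟩ := exists_adjacent_factorization (w := w) (w' := 1)
    (by rw [invPairs_one]; exact Finset.empty_subset _)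
  exact Nat.sInf_mem (s := {m : ℕ | ∃ s : List (Equiv.Perm (Fin n)),
    (∀ t ∈ s, IsAdjacentTransposition t) ∧ s.length = m ∧ s.prod = w})
    ⟨_, l, hl, rfl, by simpa using hp⟩

theorem permLength_prod_le {l : List (Equiv.Perm (Fin n))}
    (hl : ∀ t ∈ l, IsAdjacentTransposition t) : permLength l.prod ≤ l.length :=
  Nat.sInf_le ⟨l, hl, rfl, rfl⟩

theorem permLength_eq_card_invPairs (w : Equiv.Perm (Fin n)) :
    permLength w = (invPairs w).card := by
  apply le_antisymm
  · obtain ⟨l, hl, hp, hc⟩ := exists_adjacent_factorization (w := w) (w' := 1)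
      (by rw [invPairs_one]; exact Finset.empty_subset _)
    have := permLength_prod_le hl
    rw [one_mul] at hp
    rw [hp] at this
    rw [invPairs_one] at hc
    simpa [hc] using this
  · obtain ⟨l, hl, hlen, hp⟩ := exists_reduced_word w
    have := (card_invPairs_mul_prod_le 1 l hl).1
    rw [one_mul, hp, invPairs_one] at this
    simpa [hlen] using this

/-- Length counts inversions. If the lengths add up, a reduced word of `v` creates one inversion per
factor and so destroys none; conversely, the climb from `w'` to `w` is as short as the inversion
counts allow. -/
theorem exists_isReducedProduct_iff {w w' : Equiv.Perm (Fin n)} :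
    (∃ v, IsReducedProduct w w' v) ↔ invPairs w' ⊆ invPairs w := by
  constructor
  · rintro ⟨v, rfl, hlen⟩
    obtain ⟨l, hl, hlen', rfl⟩ := exists_reduced_word v
    refine (card_invPairs_mul_prod_le w' l hl).2 ?_
    rw [← permLength_eq_card_invPairs, ← permLength_eq_card_invPairs, hlen, hlen']
  · intro h
    obtain ⟨l, hl, hp, hc⟩ := exists_adjacent_factorization h
    refine ⟨l.prod, hp.symm, le_antisymm ?_ ?_⟩
    · obtain ⟨m, hm, hlen, hmp⟩ := exists_reduced_word l.prod
      have := (card_invPairs_mul_prod_le w' m hm).1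
      rw [hmp, hp] at this
      rwa [permLength_eq_card_invPairs, permLength_eq_card_invPairs, ← hlen]
    · have := permLength_prod_le hl
      rw [permLength_eq_card_invPairs w, permLength_eq_card_invPairs w', hc]
      omega

theorem pair_sublist_ofFn {w : Equiv.Perm (Fin n)} {a b : Fin n} :
    [a, b].Sublist (List.ofFn w) ↔ w⁻¹ a < w⁻¹ b := by
  have hnd : (List.ofFn w).Nodup := List.nodup_ofFn.2 w.injective
  have hpw : (List.ofFn w).Pairwise fun a b => w⁻¹ a < w⁻¹ b := by
    rw [List.pairwise_ofFn]
    intro i j hij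
    simpa using hij
  have key : ∀ {a b : Fin n}, [a, b].Sublist (List.ofFn w) → w⁻¹ a < w⁻¹ b :=
    fun h => List.pairwise_iff_forall_sublist.1 hpw h
  have hmem : ∀ a : Fin n, a ∈ List.ofFn w := fun a => by
    rw [List.mem_ofFn]; exact w.surjective a
  refine ⟨key, fun h => ?_⟩
  have hab : a ≠ b := by rintro rfl; exact lt_irrefl _ h
  exact (pair_sublist_total hab (hmem a) (hmem b)).resolve_right fun h' => lt_asymm h (key h')

theorem exists_isReducedProduct_iff_weakLE {w w' : Equiv.Perm (Fin n)} :
    (∃ v, IsReducedProduct w w' v) ↔ WeakLE (List.ofFn w') (List.ofFn w) := by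
  rw [exists_isReducedProduct_iff]
  constructor
  · intro h a b hab hs
    rw [pair_sublist_ofFn] at hs ⊢
    exact (mem_invPairs.1 (h (mem_invPairs.2 ⟨hab, hs⟩))).2
  · rintro h ⟨a, b⟩ hx
    rw [mem_invPairs] at hx ⊢
    exact ⟨hx.1, pair_sublist_ofFn.1 (h a b hx.1 (pair_sublist_ofFn.2 hx.2))⟩

theorem exists_perm_ofFn_eq {w : Equiv.Perm (Fin n)} {L : List (Fin n)}
    (h : L.Perm (List.ofFn w)) : ∃ w' : Equiv.Perm (Fin n), List.ofFn w' = L := by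
  have hlen : L.length = n := by simpa using h.length_eq
  have hnd : L.Nodup := h.nodup_iff.2 (List.nodup_ofFn.2 w.injective)
  let f : Fin n → Fin n := fun i => L.get (i.cast hlen.symm)
  have hf : Function.Injective f := fun i j hij => by
    have := List.nodup_iff_injective_get.1 hnd hij
    simpa using this
  refine ⟨Equiv.ofBijective f (Finite.injective_iff_bijective.1 hf), ?_⟩
  refine List.ext_get (by simp [hlen]) fun i h1 h2 => ?_
  simp [f]

end Length

/-! ### Isolated paws and value-stable occurrences -/

section Isolated

variable {n : ℕ} {d : Fin n → ℝ × ℝ} {w : Equiv.Perm (Fin n)}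

/-- Sort the block of `P`, reach the resulting word by rhombi, and use `P` as the last replacement.
The sweep can then be continued to any larger word. -/
theorem exists_sweep_through (P : ElnitskyPolygon n) {α β : List (Fin n)}
    (htop : P.top = 0 + wordSum d α) (hp : (α ++ P.word ++ β).Perm (elnitskyX w).word) :
    ∃ Ts, Sweep d 0 (elnitskyX w).leftWord (Ts ++ [P]) (α ++ P.word ++ β) ∧
      ∀ Q ∈ Ts, Q.IsRhombus := by
  have hp' : (α ++ P.leftWord ++ β).Perm (elnitskyX w).word :=
    ((P.leftWord_perm.append_left α).append_right β).trans hp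
  obtain ⟨Ts, hs, hr⟩ := ((elnitskyX w).leftWord_weakLE (α ++ P.leftWord ++ β)).exists_sweep d 0
    (hp'.nodup_iff.2 (elnitskyX w).nodup) ((elnitskyX w).leftWord_perm.trans hp'.symm)
  exact ⟨Ts, hs.trans (Sweep.cons P α β htop (Sweep.nil _)), hr⟩

theorem apply_of_ofFn_eq_append {w' : Equiv.Perm (Fin n)} {α u β : List (Fin n)}
    (h : List.ofFn w' = α ++ u ++ β) {a : ℕ} (ha : a < u.length) {i : Fin n}
    (hi : (i : ℕ) = α.length + a) : w' i = u[a] := by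
  have h1 : (List.ofFn w')[(i : ℕ)]? = some (w' i) := by simp
  rw [h, hi, List.append_assoc, List.getElem?_append_right (by omega), Nat.add_sub_cancel_left,
    List.getElem?_append_left ha, List.getElem?_eq_getElem ha] at h1
  exact (Option.some.inj h1).symm

/-- Two sequences with the same values and the same pattern agree. -/
theorem eq_of_pattern_eq {k : ℕ} {p : Equiv.Perm (Fin k)} {f g : Fin k → Fin n}
    (hf : ∀ a b, p a < p b ↔ f a < f b) (hg : ∀ a b, p a < p b ↔ g a < g b)
    (h : Set.range f = Set.range g) : f = g := by
  have hf' : StrictMono (f ∘ p.symm) := fun a b hab => (hf _ _).1 (by simpa using hab)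
  have hg' : StrictMono (g ∘ p.symm) := fun a b hab => (hg _ _).1 (by simpa using hab)
  have := (hf'.range_inj hg').1 (by
    rw [p.symm.surjective.range_comp, p.symm.surjective.range_comp, h])
  funext a
  simpa using congrFun this (p a)

/-- Of two edges of a path, one comes after and below the other. -/
theorem pathEdges_order (hd : IsEdgeSystem d) {a : ℝ × ℝ} {L : List (Fin n)}
    {e e' : (ℝ × ℝ) × Fin n} (he : e ∈ pathEdges d a L) (he' : e' ∈ pathEdges d a L)
    (hne : e ≠ e') :
    ([e.2, e'.2].Sublist L ∧ e'.1.2 ≤ e.1.2 - edgeHeight d e.2) ∨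
      ([e'.2, e.2].Sublist L ∧ e.1.2 ≤ e'.1.2 - edgeHeight d e'.2) := by
  have key : ∀ {e e' : (ℝ × ℝ) × Fin n} {α β c β' : List (Fin n)}, L = α ++ e.2 :: β →
      e.1 = a + wordSum d α → e'.1 = a + wordSum d (α ++ c) → e.2 :: β = c ++ e'.2 :: β' →
      e ≠ e' → [e.2, e'.2].Sublist L ∧ e'.1.2 ≤ e.1.2 - edgeHeight d e.2 := by
    intro e e' α β c β' hL h1 h2 h3 hne
    cases c with
    | nil =>
      simp only [List.nil_append, List.cons.injEq] at h3
      exact absurd (Prod.ext (by rw [h1, h2]; simp) h3.1) hne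
    | cons x c =>
      simp only [List.cons_append, List.cons.injEq] at h3
      obtain ⟨rfl, rfl⟩ := h3
      refine ⟨by rw [hL]; simp, ?_⟩
      rw [h1, h2]
      have := hd.wordHeight_nonneg c
      have hdx : (d e.2).2 = -edgeHeight d e.2 := by simp [edgeHeight]
      simp [wordSum_snd, hdx]
      linarith
  obtain ⟨α, β, h1, h2⟩ := mem_pathEdges.1 he
  obtain ⟨α', β', h3, h4⟩ := mem_pathEdges.1 he'
  rcases List.append_eq_append_iff.1 (h1.symm.trans h3) with ⟨c, rfl, h5⟩ | ⟨c, rfl, h5⟩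
  · exact Or.inl (key h1 h2 h4 h5 hne)
  · exact Or.inr (key h3 h4 h2 h5 hne.symm)

/-- The labels of an isolated paw appear in `w` in the order of its right border. -/
theorem IsIsolatedPaw.pairwise_sublist (hd : IsEdgeSystem d) {T : Set (ElnitskyPolygon n)}
    {P : ElnitskyPolygon n} (h : IsIsolatedPaw d w T P) {α β : List (Fin n)}
    (htop : P.top = 0 + wordSum d α) (hp : (α ++ P.word ++ β).Perm (elnitskyX w).word)
    (hle : WeakLE (α ++ P.word ++ β) (elnitskyX w).word) :
    P.word.Pairwise fun a b => [a, b].Sublist (elnitskyX w).word := by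
  refine pairwise_sublist_of_adjacent (elnitskyX w).nodup fun u₁ a b u₂ hu => ?_
  by_contra hcon
  have hsub : [a, b].Sublist P.word := by rw [hu]; simp
  have hsub' : [a, b].Sublist (α ++ P.word ++ β) :=
    hsub.trans ((List.sublist_append_right _ _).trans (List.sublist_append_left _ _))
  have hab : a ≠ b := pair_sublist_ne P.nodup hsub
  have hmem : ∀ {x}, x ∈ α ++ P.word ++ β → x ∈ (elnitskyX w).word := fun h => hp.mem_iff.1 h
  have hba : [b, a].Sublist (elnitskyX w).word :=
    (pair_sublist_total hab (hmem (hsub'.subset (by simp)))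
      (hmem (hsub'.subset (by simp)))).resolve_left hcon
  -- A descent of the border is an inversion of a word below `w`, so it could not be reversed in
  -- `w`.
  have hlt : a < b := hab.lt_of_le (not_lt.1 fun hlt => hcon (hle b a hlt hsub'))
  -- This rhombus lies to the right of the edges `a`, `b` of the border. It is used directly after
  -- `P` in a sweep whose other polygons are rhombi.
  let Q : ElnitskyPolygon n := ⟨0 + wordSum d (α ++ u₁), [b, a], by simp [hab.symm]⟩
  have hQr : Q.IsRhombus := ElnitskyPolygon.isRhombus_iff.2 ⟨a, b, hlt, rfl⟩
  have hQl : Q.leftWord = [a, b] := ElnitskyPolygon.leftWord_of_word_eq_pair hlt rfl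
  have e1 : α ++ P.word ++ β = (α ++ u₁) ++ a :: b :: (u₂ ++ β) := by rw [hu]; simp
  have hle' : WeakLE ((α ++ u₁) ++ b :: a :: (u₂ ++ β)) (elnitskyX w).word :=
    WeakLE.swap (by rw [← e1]; exact hle) hba
  have hp' : ((α ++ u₁) ++ b :: a :: (u₂ ++ β)).Perm (elnitskyX w).word :=
    (perm_swap_middle _ _ _ _).symm.trans (by rw [← e1]; exact hp)
  obtain ⟨Ts, hs, hr⟩ := exists_sweep_through P htop hp
  obtain ⟨Rs, hs', hr'⟩ := hle'.exists_sweep d 0 (elnitskyX w).nodup hp'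
  have hs'' := Sweep.cons (d := d) (a := 0) Q (α ++ u₁) (u₂ ++ β) rfl (Ts := Rs)
    (L' := (elnitskyX w).word) (by simpa [Q] using hs')
  have e2 : α ++ u₁ ++ Q.leftWord ++ (u₂ ++ β) = α ++ P.word ++ β := by rw [hQl, e1]; simp
  rw [e2] at hs''
  have htil := (hs.trans hs'').isPawTiling hd
  have hQP : Q ≠ P := by
    intro hQP
    rw [← hQP] at hsub
    exact pair_sublist_asymm (L := Q.word) Q.nodup hsub (List.Sublist.refl _)
  refine h.2.2 _ ⟨htil, by simp, fun R hR hRP => ?_⟩ Q (by simp) hQP hQr ?_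
  · have hR' : R ∈ Ts ∨ R = P ∨ R = Q ∨ R ∈ Rs := by simpa [or_assoc] using hR
    rcases hR' with h | h | rfl | h
    · exact hr R h
    · exact absurd h hRP
    · exact hQr
    · exact hr' R h
  · have hQt : Q.top = P.top + wordSum d u₁ := by rw [htop]; simp [Q]
    refine ⟨(Q.top, a), List.mem_append_left _ ?_, (Q.top + d a, b), List.mem_append_left _ ?_,
      fun h => hab (congrArg Prod.snd h), mem_pathEdges.2 ⟨u₁, b :: u₂, hu, hQt⟩,
      mem_pathEdges.2 ⟨u₁ ++ [a], u₂, by simp [hu], by simp [hQt, add_assoc]⟩⟩ <;>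
    simp [ElnitskyPolygon.leftEdges, hQl, pathEdges]

/-- Two nonoverlapping polygons do not have a common descent of their right borders. -/
theorem not_disjoint_of_common_descent (hd : IsEdgeSystem d) {P Q : ElnitskyPolygon n}
    {i j : Fin n} (hij : i < j) (hQ : Q.word = [j, i]) (h1 : (Q.top, j) ∈ P.rightEdges d)
    (h2 : (Q.top + d j, i) ∈ P.rightEdges d) :
    ¬ Disjoint (P.region d) (interior (Q.region d)) := by
  obtain ⟨γ, δ, hw, hγ⟩ := mem_pathEdges.1 h1
  obtain ⟨γ', δ', hw', hγ'⟩ := mem_pathEdges.1 h2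
  dsimp only at hw hγ hw' hγ'
  have hi := hd.edgeHeight_pos i
  have hj := hd.edgeHeight_pos j
  have hjd : (Q.top + d j).2 = Q.top.2 - edgeHeight d j := by simp [edgeHeight]
  have hPr : P.rightX d (Q.top + d j).2 = (Q.top + d j).1 := by
    have := pathX_vertex hd P.top γ' (i :: δ')
    rw [← hw', ← hγ'] at this
    exact this
  have hQr : Q.rightX d (Q.top + d j).2 = (Q.top + d j).1 := by
    have := pathX_vertex hd Q.top [j] [i]
    rw [ElnitskyPolygon.rightX, hQ]
    simpa using this
  have hQlt : Q.leftX d (Q.top + d j).2 < Q.rightX d (Q.top + d j).2 := by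
    refine (ElnitskyPolygon.isRhombus_iff.2 ⟨i, j, hij, hQ⟩).leftX_lt_rightX hd ?_ ?_
    · rw [hjd, hQ]; simp; linarith
    · rw [hjd]; linarith
  -- At the vertex between the two edges `j` is used up and `i` untouched. On the left border `i`
  -- comes before `j`, so the borders of `P` cannot touch at this height.
  have hPlt : P.leftX d (Q.top + d j).2 < P.rightX d (Q.top + d j).2 := by
    refine lt_of_le_of_ne (P.pathX_leftWord_le hd _) fun heq => ?_
    have hu := ((P.leftWord_weakLE P.word).profile_le_and hd P.nodup P.leftWord_perm
      (P.top.2 - (Q.top + d j).2)).2 (by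
        simpa [ElnitskyPolygon.leftX, ElnitskyPolygon.rightX, pathX] using heq)
    have ej : P.top.2 - (Q.top + d j).2 = wordHeight d γ + edgeHeight d j := by
      rw [hjd, hγ]; simp [wordSum_snd]; ring
    have ei : P.top.2 - (Q.top + d j).2 = wordHeight d γ' + 0 := by
      rw [hγ']; simp [wordSum_snd]
    have hnd := P.nodup
    have uj : usedHeight d P.word (P.top.2 - (Q.top + d j).2) j = edgeHeight d j := by
      rw [hw] at hnd
      rw [ej, hw, usedHeight_edge hd hnd hj.le le_rfl]
    have hnd := P.nodup
    have ui : usedHeight d P.word (P.top.2 - (Q.top + d j).2) i = 0 := by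
      rw [hw'] at hnd
      rw [ei, hw', usedHeight_edge hd hnd le_rfl hi.le]
    have hjP : j ∈ P.word := by rw [hw]; simp
    have hiP : i ∈ P.word := by rw [hw']; simp
    have hji : [j, i].Sublist P.word := by
      refine (pair_sublist_total hij.ne hiP hjP).resolve_left fun hs => ?_
      have := usedHeight_of_pair_sublist hd P.nodup hs
        (t := P.top.2 - (Q.top + d j).2) (by rw [uj]; exact hj)
      linarith
    have hij' : [i, j].Sublist P.leftWord := by
      refine (pair_sublist_total hij.ne (P.leftWord_perm.mem_iff.2 hiP)
        (P.leftWord_perm.mem_iff.2 hjP)).resolve_right fun hs => ?_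
      exact absurd (List.pairwise_iff_forall_sublist.1 P.leftWord_sorted hs) (not_le.2 hij)
    have := usedHeight_of_opposite hd P.leftWord_nodup P.nodup hu hij' hji
    rw [hu, ui, uj] at this
    rcases this with h | h <;> linarith [h.1, h.2]
  -- Points just left of the common vertex are interior to both polygons.
  obtain ⟨x, hx1, hx2⟩ := exists_between
    (max_lt (hPr ▸ hPlt) (hQr ▸ hQlt))
  refine Set.not_disjoint_iff.2 ⟨(x, (Q.top + d j).2),
    ElnitskyPolygon.mem_region_of_lt_of_le hd ((le_max_left _ _).trans_lt hx1) ?_,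
    ElnitskyPolygon.mem_interior_of_lt hd ((le_max_right _ _).trans_lt hx1) ?_⟩
  · exact hx2.le.trans hPr.ge
  · exact hx2.trans_le hQr.ge

/-- A paw whose labels appear in `w` in the order of its right border is isolated. -/
theorem not_sharesTwoRightEdges (hd : IsEdgeSystem d) {S : Set (ElnitskyPolygon n)}
    (hS : IsPawTiling d w S) {P Q : ElnitskyPolygon n} (hP : P ∈ S) (hQ : Q ∈ S) (hne : Q ≠ P)
    (hQr : Q.IsRhombus) (hord : P.word.Pairwise fun a b => [a, b].Sublist (elnitskyX w).word) :
    ¬ SharesTwoRightEdges d Q P := by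
  obtain ⟨i, j, hij, hw⟩ := ElnitskyPolygon.isRhombus_iff.1 hQr
  have hQl := ElnitskyPolygon.leftWord_of_word_eq_pair hij hw
  have hi := hd.edgeHeight_pos i
  have hj := hd.edgeHeight_pos j
  -- A path through the right border of `Q` has this inversion and is below `w`.
  have hji : [j, i].Sublist (elnitskyX w).word := by
    obtain ⟨α, β, -, -, hle⟩ := hS.exists_word_through hd hQ
    refine hle i j hij ?_
    rw [hw]
    simp
  have hedges : ∀ e ∈ Q.edges d, e = (Q.top, i) ∨ e = (Q.top + d i, j) ∨ e = (Q.top, j) ∨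
      e = (Q.top + d j, i) := by
    intro e he
    simpa [ElnitskyPolygon.edges, ElnitskyPolygon.leftEdges, ElnitskyPolygon.rightEdges, hQl, hw,
      pathEdges] using he
  have key : ∀ e ∈ Q.edges d, ∀ e' ∈ Q.edges d, e ∈ P.rightEdges d → e' ∈ P.rightEdges d →
      [e.2, e'.2].Sublist P.word → e'.1.2 ≤ e.1.2 - edgeHeight d e.2 → False := by
    intro e he e' he' hr hr' hs hh
    have hlab := pair_sublist_ne P.nodup hs
    have hij' : ¬ [i, j].Sublist P.word := fun h =>
      pair_sublist_asymm (elnitskyX w).nodup hji (List.pairwise_iff_forall_sublist.1 hord h)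
    have hdi : (d i).2 = -edgeHeight d i := by simp [edgeHeight]
    have hdj : (d j).2 = -edgeHeight d j := by simp [edgeHeight]
    -- Apart from equal labels and impossible heights, either `i` precedes `j` on the border of `P`,
    -- as when the left edges of `Q` are shared, or its two right edges are shared and the polygons
    -- overlap.
    rcases hedges e he with rfl | rfl | rfl | rfl <;>
      rcases hedges e' he' with rfl | rfl | rfl | rfl <;>
      simp only [Prod.snd_add, hdi, hdj] at hs hh hlab <;>
      first
      | exact hlab rfl
      | exact hij' hs
      | linarith
      | exact not_disjoint_of_common_descent hd hij hw hr hr'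
          (hS.nonoverlapping P hP Q hQ hne.symm)
  rintro ⟨e, he, e', he', hne', hr, hr'⟩
  rcases pathEdges_order hd hr hr' hne' with ⟨h1, h2⟩ | ⟨h1, h2⟩
  · exact key e he e' he' hr hr' h1 h2
  · exact key e' he' e he hr' hr h1 h2

end Isolated

/-! ### The equivalence of isolated paws and value-stable occurrences. -/

theorem corollary4p12 {n k : ℕ} (d : Fin n → ℝ × ℝ) (hd : IsEdgeSystem d)
    (w : Equiv.Perm (Fin n)) (p : Equiv.Perm (Fin k)) (I : Finset (Fin n)) :
    (∃ T : Set (ElnitskyPolygon n), IsPawTiling d w T ∧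
      ∃ P ∈ T, P.HasShape p ∧ P.labels = I ∧ IsIsolatedPaw d w T P) ↔
    (ValueStable p w ∧ IsValueStableOccurrence p w I) := by
  constructor
  · rintro ⟨T, hT, P, hP, ⟨hlen, hshape⟩, rfl, hiso⟩
    subst hlen
    simp only [Fin.cast_eq_self, List.get_eq_getElem] at hshape
    obtain ⟨α, β, htop, hp, hle⟩ := hT.exists_word_through hd hP
    have hord := hiso.pairwise_sublist hd htop hp hle
    obtain ⟨w', hw'⟩ := exists_perm_ofFn_eq hp
    rw [← hw'] at hle
    obtain ⟨v, hv⟩ := exists_isReducedProduct_iff_weakLE.2 hle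
    have hlen : α.length + P.word.length + β.length = n := by
      simpa [add_assoc] using (congrArg List.length hw').symm
    have himage : Finset.univ.image (fun a : Fin P.word.length => P.word[(a : ℕ)]) = P.labels := by
      ext x
      simp only [Finset.mem_image, Finset.mem_univ, true_and, ElnitskyPolygon.labels,
        List.mem_toFinset, List.mem_iff_get, List.get_eq_getElem]
    let ι : Fin P.word.length ↪o Fin n := OrderEmbedding.ofStrictMono
      (fun a => ⟨α.length + a, by omega⟩) fun a b hab =>
        Nat.add_lt_add_left hab _
    have hι : ∀ a, w' (ι a) = P.word[(a : ℕ)] := fun a =>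
      apply_of_ofFn_eq_append hw' a.2 rfl
    have hocc : IsOccurrenceAt p w' ι := fun a b => by rw [hι, hι]; exact hshape a b
    have hcons : ConsecutivePositions ι := ⟨α.length, fun a => rfl⟩
    refine ⟨⟨w', v, hv, ι, hocc, hcons⟩, ?_, w', v, hv, ι, hocc, hcons, ?_⟩
    -- The positions in `w` of the labels of the border increase because the paw is isolated.
    · let κ : Fin P.word.length ↪o Fin n := OrderEmbedding.ofStrictMono
        (fun a => w⁻¹ P.word[(a : ℕ)]) fun a b hab =>
          pair_sublist_ofFn.1 (List.pairwise_iff_getElem.1 hord a b a.2 b.2 hab)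
      have hκ : ∀ a, w (κ a) = P.word[(a : ℕ)] := fun a => by simp [κ]
      refine ⟨κ, fun a b => by rw [hκ, hκ]; exact hshape a b, ?_⟩
      simp only [valuesAt, hκ]
      exact himage
    · simp only [valuesAt, hι]
      exact himage
  · rintro ⟨-, ⟨κ, hκ, hκI⟩, w', v, hv, ι, hι, ⟨x, hx⟩, hιI⟩
    have hle := exists_isReducedProduct_iff_weakLE.1 ⟨v, hv⟩
    -- Both occurrences have the same pattern and the same values, so they are the same sequence.
    -- This transfers the order of the block in `w'` to `w`.
    have hfg : (fun a => w' (ι a)) = fun a => w (κ a) := by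
      refine eq_of_pattern_eq hι hκ ?_
      have := congrArg (fun s : Finset (Fin n) => (s : Set (Fin n))) (hιI.trans hκI.symm)
      simpa [valuesAt] using this
    set L := List.ofFn w' with hL
    have hsplit : L.take x ++ List.ofFn (fun a => w' (ι a)) ++ (L.drop x).drop k = L := by
      have hk : k ≤ n - x := by
        -- For the empty pattern the starting position `x` is unconstrained and may exceed `n`.
        rcases Nat.eq_zero_or_pos k with h | h
        · omega
        · have h1 := hx ⟨k - 1, by omega⟩
          have h2 := (ι ⟨k - 1, by omega⟩).2
          dsimp only at h1
          omega
      have : List.ofFn (fun a => w' (ι a)) = (L.drop x).take k := by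
        refine List.ext_getElem (by simp [hL, hk]) fun a h1 h2 => ?_
        simp only [List.length_ofFn] at h1
        simp only [List.getElem_ofFn, List.getElem_take, List.getElem_drop, hL]
        congr 1
        exact Fin.ext (hx ⟨a, h1⟩)
      rw [this, List.append_assoc, List.take_append_drop, List.take_append_drop]
    let P : ElnitskyPolygon n := ⟨0 + wordSum d (L.take x), List.ofFn fun a => w' (ι a),
      List.nodup_ofFn.2 (w'.injective.comp ι.injective)⟩
    have hord : P.word.Pairwise fun a b => [a, b].Sublist (elnitskyX w).word := by
      change (List.ofFn fun a => w' (ι a)).Pairwise _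
      rw [hfg, List.pairwise_ofFn]
      intro a b hab
      refine pair_sublist_ofFn.2 ?_
      simpa using hab
    have hp : (L.take x ++ P.word ++ (L.drop x).drop k).Perm (elnitskyX w).word := by
      change (L.take x ++ List.ofFn (fun a => w' (ι a)) ++ (L.drop x).drop k).Perm _
      rw [hsplit]
      refine (List.perm_ext_iff_of_nodup (List.nodup_ofFn.2 w'.injective)
        (List.nodup_ofFn.2 w.injective)).2 fun a => ?_
      simp only [List.mem_ofFn]
      exact ⟨fun _ => w.surjective a, fun _ => w'.surjective a⟩
    obtain ⟨Ts, hs, -⟩ := exists_sweep_through (d := d) P rfl hp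
    rw [show L.take x ++ P.word ++ (L.drop x).drop k = L from hsplit] at hs hp
    obtain ⟨Rs, hs', -⟩ := hle.exists_sweep d 0 (elnitskyX w).nodup hp
    have htil := (hs.trans hs').isPawTiling hd
    have hPmem : P ∈ {Q | Q ∈ Ts ++ [P] ++ Rs} := by simp
    refine ⟨_, htil, P, hPmem, ⟨by simp [P], fun a b => ?_⟩, ?_, htil, hPmem, ?_⟩
    · rw [hι a b]
      simp [P]
    · rw [← hιI]
      ext y
      simp [ElnitskyPolygon.labels, P, valuesAt, List.mem_ofFn]
    · intro S hS Q hQ hne hQr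
      exact not_sharesTwoRightEdges hd hS.1 hS.2.1 hQ hne hQr hord
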